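/- Let $\alpha\ge 0$ be fixed and let $$K_N(x,y)=(w(x)w(y))^{1/2}\sum_{n=0}^{N-1}\frac{p_n(x)p_n(y)}{h_n},\qquad w(x)=x^{a}e^{-x}\chi_{x>0},\quad p_n(x)=(-1)^n n!\,L_n^{a}(x),\quad h_n=n!\,\Gamma(a+n+1),$$ be the correlation kernel of the Laguerre unitary ensemble (LUE) with $N$ eigenvalues and parameter $a=\alpha N$, where $L_n^a$ are the Laguerre polynomials. Put $$s_{t,\alpha}=N(\sqrt{1+\alpha}+1)^2+N^{1/3}(\sqrt{1+\alpha}+1)\Big(\frac1{\sqrt{1+\alpha}}+1\Big)^{1/3}t .$$ Then, as $N\to\infty$, uniformly for real $x,y$ in bounded sets (with $\alpha$ fixed), $$\Big(\frac{\partial s_{x,\alpha}}{\partial x}\Big)K_N(s_{x,\alpha},s_{y,\alpha})=K(x,y)+\frac1{N^{2/3}}L_\alpha(x,y)+O\Big(\frac1N\Big),$$ so that in particular there is no term of order $N^{-1/3}$. Here $$K(x,y)=\frac{\mathrm{Ai}(x)\mathrm{Ai}'(y)-\mathrm{Ai}'(x)\mathrm{Ai}(y)}{x-y}$$ is the Airy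 kernel and $$\begin{aligned}L_\alpha(x,y)={}&-\frac{\alpha^2(1+\alpha+\sqrt{1+\alpha})^{1/3}}{32(1+\alpha)^{5/6}(1+\sqrt{1+\alpha})^3}\,\frac{(x^2+y^2)^2\big(\mathrm{Ai}(x)\mathrm{Ai}'(y)-\mathrm{Ai}'(x)\mathrm{Ai}(y)\big)}{x-y}\\ &+\frac{1}{160(1+\alpha)^{2/3}(1+\sqrt{1+\alpha})^{2/3}(x-y)}\Big(-8(2+\alpha-6\sqrt{1+\alpha})(x^3-y^3)\mathrm{Ai}(x)\mathrm{Ai}(y)\\ &\quad+\big(4(6+2\sqrt{1+\alpha}+3\alpha)(x-y)-5(\sqrt{1+\alpha}-1)^2(x^2+y^2)^2\big)\mathrm{Ai}(y)\mathrm{Ai}'(x)\\ &\quad+\big(4(6+2\sqrt{1+\alpha}+3\alpha)(x-y)+5(\sqrt{1+\alpha}-1)^2(x^2+y^2)^2\big)\mathrm{Ai}(x)\mathrm{Ai}'(y)\\ &\quad+8(2+\alpha-6\sqrt{1+\alpha})(x^2-y^2)\mathrm{Ai}'(x)\mathrm{Ai}'(y)\Big),\end{aligned}$$ both being understood as limits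 when $x=y$. Setting $\alpha=0$ in this formula gives the functional form of the correction for the LUE with $a$ fixed: $$L_0(x,y)=\frac{2^{1/3}}{10}\Big[(x^2+xy+y^2)\mathrm{Ai}(x)\mathrm{Ai}(y)-(x+y)\mathrm{Ai}'(x)\mathrm{Ai}'(y)+\mathrm{Ai}'(x)\mathrm{Ai}(y)+\mathrm{Ai}(x)\mathrm{Ai}'(y)\Big].$$ -/

import Mathlib

open Complex MeasureTheory in
/-- The Airy function of a real variable, by its (absolutely convergent) contour integral
`Ai(x) = (1 / (2πi)) ∫ exp(z³/3 - x z) dz`, the contour consisting of the two rays that come in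
from `∞ e^{-iπ/3}` to `0` and go out from `0` to `∞ e^{iπ/3}`.  The value of the contour integral is
real; `.re` only changes the type. -/
noncomputable def airyAi (x : ℝ) : ℝ :=
  ((1 / (2 * Real.pi * I)) *
    ((∫ r in Set.Ioi (0 : ℝ),
        exp (((r : ℂ) * exp (I * Real.pi / 3)) ^ 3 / 3 - x * ((r : ℂ) * exp (I * Real.pi / 3)))
          * exp (I * Real.pi / 3))
      - ∫ r in Set.Ioi (0 : ℝ),
        exp (((r : ℂ) * exp (-(I * Real.pi / 3))) ^ 3 / 3
            - x * ((r : ℂ) * exp (-(I * Real.pi / 3))))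
          * exp (-(I * Real.pi / 3)))).re

/-- The derivative `Ai'` of the Airy function. -/
noncomputable def airyAi' (x : ℝ) : ℝ := deriv airyAi x

/-- The Airy kernel `(Ai(x) Ai'(y) - Ai'(x) Ai(y)) / (x - y)`; on the diagonal it is understood as
the limit, which by `Ai'' (x) = x Ai(x)` is `Ai'(x)² - x Ai(x)²`. -/
noncomputable def airyKernel (x y : ℝ) : ℝ :=
  if x = y then airyAi' x ^ 2 - x * airyAi x ^ 2
  else (airyAi x * airyAi' y - airyAi' x * airyAi y) / (x - y)

/-- The Laguerre weight `x^a e^{-x}` on `x > 0`, zero elsewhere. -/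
noncomputable def laguerreWeight (a x : ℝ) : ℝ :=
  if 0 < x then x ^ a * Real.exp (-x) else 0

/-- The Laguerre polynomial `L_n^a(x) = ∑_{k=0}^n (-1)^k binom(n+a, n-k) x^k / k!` (`a > -1`), with
`binom(n+a, n-k) = Γ(n+a+1) / (Γ(k+a+1) (n-k)!)`. -/
noncomputable def laguerreL (n : ℕ) (a x : ℝ) : ℝ :=
  ∑ k ∈ Finset.range (n + 1),
    (-1) ^ k * (Real.Gamma (n + a + 1) / (Real.Gamma (k + a + 1) * ((n - k).factorial : ℝ)))
      * x ^ k / (k.factorial : ℝ)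

/-- The monic orthogonal polynomials `p_n = (-1)^n n! L_n^a` of the Laguerre weight. -/
noncomputable def laguerreMonic (n : ℕ) (a x : ℝ) : ℝ :=
  (-1) ^ n * (n.factorial : ℝ) * laguerreL n a x

/-- The squared norm `h_n = n! Γ(a+n+1)` of `p_n` with respect to the Laguerre weight. -/
noncomputable def laguerreNormSq (n : ℕ) (a : ℝ) : ℝ :=
  (n.factorial : ℝ) * Real.Gamma (a + n + 1)

/-- The correlation kernel of the Laguerre unitary ensemble with `N` eigenvalues and parameter `a`:
`K_N(x,y) = (w(x) w(y))^{1/2} ∑_{n=0}^{N-1} p_n(x) p_n(y) / h_n`. -/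
noncomputable def lueKernel (a : ℝ) (N : ℕ) (x y : ℝ) : ℝ :=
  Real.sqrt (laguerreWeight a x * laguerreWeight a y) *
    ∑ n ∈ Finset.range N, laguerreMonic n a x * laguerreMonic n a y / laguerreNormSq n a

/-- The soft edge scaling variable
`s_{t,α} = N (√(1+α) + 1)² + N^{1/3} (√(1+α) + 1) (1/√(1+α) + 1)^{1/3} t`. -/
noncomputable def softEdge (α : ℝ) (N : ℕ) (t : ℝ) : ℝ :=
  N * (Real.sqrt (1 + α) + 1) ^ 2 +
    (N : ℝ) ^ (1 / 3 : ℝ) * (Real.sqrt (1 + α) + 1) *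
      (1 / Real.sqrt (1 + α) + 1) ^ (1 / 3 : ℝ) * t

/-- The correction kernel `L_α(x,y)`.  For `x ≠ y` it is the displayed formula; on the diagonal it is
the limit of that formula: `(Ai(x)Ai'(y) - Ai'(x)Ai(y)) / (x-y)` becomes `Ai'(x)² - x Ai(x)²`, while
`(x³-y³)/(x-y)` and `(x²-y²)/(x-y)` become `3x²` and `2x`. -/
noncomputable def lueCorrection (α x y : ℝ) : ℝ :=
  if x = y then
    -(α ^ 2 * (1 + α + Real.sqrt (1 + α)) ^ (1 / 3 : ℝ)
        / (32 * (1 + α) ^ (5 / 6 : ℝ) * (1 + Real.sqrt (1 + α)) ^ 3))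
      * ((x ^ 2 + x ^ 2) ^ 2 * (airyAi' x ^ 2 - x * airyAi x ^ 2))
    + 1 / (160 * (1 + α) ^ (2 / 3 : ℝ) * (1 + Real.sqrt (1 + α)) ^ (2 / 3 : ℝ))
      * (-8 * (2 + α - 6 * Real.sqrt (1 + α)) * (3 * x ^ 2) * airyAi x ^ 2
        + 2 * (4 * (6 + 2 * Real.sqrt (1 + α) + 3 * α)) * (airyAi x * airyAi' x)
        + 5 * (Real.sqrt (1 + α) - 1) ^ 2 * (x ^ 2 + x ^ 2) ^ 2
            * (airyAi' x ^ 2 - x * airyAi x ^ 2)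
        + 8 * (2 + α - 6 * Real.sqrt (1 + α)) * (2 * x) * airyAi' x ^ 2)
  else
    -(α ^ 2 * (1 + α + Real.sqrt (1 + α)) ^ (1 / 3 : ℝ)
        / (32 * (1 + α) ^ (5 / 6 : ℝ) * (1 + Real.sqrt (1 + α)) ^ 3))
      * ((x ^ 2 + y ^ 2) ^ 2 * (airyAi x * airyAi' y - airyAi' x * airyAi y) / (x - y))
    + 1 / (160 * (1 + α) ^ (2 / 3 : ℝ) * (1 + Real.sqrt (1 + α)) ^ (2 / 3 : ℝ) * (x - y))
      * (-8 * (2 + α - 6 * Real.sqrt (1 + α)) * (x ^ 3 - y ^ 3) * (airyAi x * airyAi y)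
        + (4 * (6 + 2 * Real.sqrt (1 + α) + 3 * α) * (x - y)
            - 5 * (Real.sqrt (1 + α) - 1) ^ 2 * (x ^ 2 + y ^ 2) ^ 2) * (airyAi y * airyAi' x)
        + (4 * (6 + 2 * Real.sqrt (1 + α) + 3 * α) * (x - y)
            + 5 * (Real.sqrt (1 + α) - 1) ^ 2 * (x ^ 2 + y ^ 2) ^ 2) * (airyAi x * airyAi' y)
        + 8 * (2 + α - 6 * Real.sqrt (1 + α)) * (x ^ 2 - y ^ 2) * (airyAi' x * airyAi' y))

/-- The `N^{-2/3}` correction kernel at the soft edge of the Laguerre unitary ensemble with `a`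
fixed. -/
noncomputable def lueFixedCorrection (x y : ℝ) : ℝ :=
  (2 : ℝ) ^ (1 / 3 : ℝ) / 10 *
    ((x ^ 2 + x * y + y ^ 2) * (airyAi x * airyAi y)
      - (x + y) * (airyAi' x * airyAi' y)
      + (airyAi' x * airyAi y + airyAi x * airyAi' y))

/-!
Put `N = ε⁻³`, `s = √(1 + α)`, `p = 1 / (s + 1)`, `q = 1 - p` and `λ = q^{1/3}`.

The polynomial `L_n^a(x)` is the coefficient of `u^n` in `e^{-xu} (1 + u)^{n+a}`
(`ofReal_laguerreL`). At the soft edge `x = N / p² + t / (p λ ε)` the logarithm of the generating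
integrand has a double saddle point at `u = -p`. The contour is a circle slightly inside `|u| = p`,
on which `u = -p e^{-λ ε w}` with `w = 1 + i y`; there the exponent is
`w³ / 3 - t w + ε r₁ + ε² r₂ + O(ε³)` (`exp2_edgeExponent`), and the integrand has a Gaussian
majorant in `y` that does not depend on `ε` (`exists_norm_exp_edgeExponent_le`). Hence the scaled
contour integrals `edgeIntegral k`, in which `k` factors of the displacement from the saddle point
are inserted, expand to second order in `ε` with coefficients that are combinations of the Airy
moments `(1 / 2π) ∫ w^k exp(w³ / 3 - t w) dy` (`exists_norm_edgeIntegral_sub_le`). Moments `0` and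
`1` are `Ai` and `-Ai'`, since the contour in the definition of `Ai` may be moved to the line
`Re w = 1` (`airyRays_eq_airyMoment`), and integration by parts reduces all other moments to these two.

By the Christoffel–Darboux formula the kernel is a constant times
`√(w(x) w(y)) (L_N(x) L_{N-1}(y) - L_{N-1}(x) L_N(y)) / (x - y)`, and both polynomials are
combinations of `edgeIntegral 0` and `edgeIntegral 1`. The constants combine to a quotient of
Stirling remainders, which is `1 + O(ε³)`, and to two factors `1 - γ ε t² + γ² ε² t⁴ / 2 + O(ε³)` that
come from the weight (`sqrt_laguerreWeight_mul`, `ofReal_lueKernel_edge`). Since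
`∂/∂t edgeIntegral k = -edgeIntegral (k + 1)`, the expansion may be differentiated in `t`, so it
passes to difference quotients, uniformly in `x ≠ y`. Multiplying the expansions, the terms of order
`ε` cancel and those of order `ε²` give the correction kernel (`exists_norm_edgeKernel_sub_le`). The
diagonal follows by continuity.

Estimates with unspecified constants are handled by `AsymScale`, a domain with a small parameter and
a weight; `AsymScale.Exp2` is the notion of an expansion to second order in the parameter.
-/

/-! ### Stirling's formula for the real Gamma function -/

/-- The remainder `log Γ(x) - (x - 1/2) log x + x` in Stirling's formula. -/
noncomputable def stirlingRemainder (x : ℝ) : ℝ :=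
  Real.log (Real.Gamma x) - (x - 1 / 2) * Real.log x + x

lemma log_le_half_sub_inv {u : ℝ} (hu : 1 ≤ u) : Real.log u ≤ (u - u⁻¹) / 2 := by
  rw [← Real.sinh_log (by linarith)]
  exact Real.self_le_sinh_iff.2 (Real.log_nonneg hu)

lemma stirlingRemainder_add_one_sub {x : ℝ} (hx : 0 < x) :
    stirlingRemainder (x + 1) - stirlingRemainder x
      = 1 - (x + 1 / 2) * Real.log (1 + 1 / x) := by
  have h1 : Real.log (Real.Gamma (x + 1)) = Real.log x + Real.log (Real.Gamma x) := by
    rw [Real.Gamma_add_one hx.ne', Real.log_mul hx.ne' (Real.Gamma_pos_of_pos hx).ne']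
  have h2 : Real.log (1 + 1 / x) = Real.log (x + 1) - Real.log x := by
    rw [← Real.log_div (by positivity) hx.ne']
    congr 1
    field_simp
  unfold stirlingRemainder
  rw [h1, h2]
  ring

/-- The bound telescopes, so that it may be summed over `x, x + 1, x + 2, …`. -/
lemma abs_stirlingRemainder_add_one_sub_le {x : ℝ} (hx : 0 < x) :
    |stirlingRemainder (x + 1) - stirlingRemainder x| ≤ 1 / x - 1 / (x + 1) := by
  rw [stirlingRemainder_add_one_sub hx]
  have hlow := Real.le_log_one_add_of_nonneg (x := 1 / x) (by positivity)
  have hup := log_le_half_sub_inv (u := 1 + 1 / x) (by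
    have : 0 < 1 / x := by positivity
    linarith)
  have e1 : (x + 1 / 2) * (2 * (1 / x) / (1 / x + 2)) = 1 := by
    field_simp
    ring
  have e2 : (x + 1 / 2) * ((1 + 1 / x - (1 + 1 / x)⁻¹) / 2)
      = 1 + (1 / x - 1 / (x + 1)) / 4 := by
    field_simp
    ring
  have hpos : 0 ≤ x + 1 / 2 := by positivity
  have i1 := mul_le_mul_of_nonneg_left hlow hpos
  have i2 := mul_le_mul_of_nonneg_left hup hpos
  have hd : 0 ≤ 1 / x - 1 / (x + 1) := by
    rw [sub_nonneg]
    exact one_div_le_one_div_of_le hx (by linarith)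
  rw [abs_le]
  constructor <;> linarith

lemma abs_stirlingRemainder_add_nat_sub_le {x : ℝ} (hx : 0 < x) (n : ℕ) :
    |stirlingRemainder (x + n) - stirlingRemainder x| ≤ 1 / x - 1 / (x + n) := by
  induction n with
  | zero => simp
  | succ n ih =>
    have h := abs_stirlingRemainder_add_one_sub_le (x := x + n) (by positivity)
    push_cast
    rw [← add_assoc]
    calc _ ≤ |stirlingRemainder (x + n + 1) - stirlingRemainder (x + n)|
          + |stirlingRemainder (x + n) - stirlingRemainder x| := abs_sub_le _ _ _
      _ ≤ _ := by linarith

open Filter Topology in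
/-- By Euler's limit formula, `log Γ(x + n + 1) = x log n + log n! + o(1)`; so the remainder along
`x + n + 1` has a limiting behaviour that does not depend on `x`. -/
lemma tendsto_stirlingRemainder_add_nat {x : ℝ} (hx : 0 < x) :
    Tendsto (fun n : ℕ => stirlingRemainder (x + (n + 1 : ℕ))
      - (Real.log (n.factorial) - (n + 1 / 2) * Real.log n + n)) atTop (𝓝 0) := by
  have hG := Real.BohrMollerup.tendsto_log_gamma hx
  have hsum : ∀ n : ℕ, Real.log (Real.Gamma (x + (n + 1 : ℕ)))
      = Real.log (Real.Gamma x) + ∑ m ∈ Finset.range (n + 1), Real.log (x + m) := fun n =>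
    Real.BohrMollerup.f_add_nat_eq (f := Real.log ∘ Real.Gamma)
      (fun {y} hy => by
        simp only [Function.comp]
        rw [Real.Gamma_add_one hy.ne', Real.log_mul hy.ne' (Real.Gamma_pos_of_pos hy).ne',
          add_comm]) hx (n + 1)
  have hT := Real.tendsto_mul_log_one_add_div_atTop (x + 1)
  have hTn := hT.comp tendsto_natCast_atTop_atTop
  have hL : Tendsto (fun n : ℕ => Real.log (1 + (x + 1) / (n : ℝ))) atTop (𝓝 0) := by
    have h0 : Tendsto (fun n : ℕ => 1 + (x + 1) / (n : ℝ)) atTop (𝓝 (1 + 0)) :=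
      tendsto_const_nhds.add (tendsto_const_div_atTop_nhds_zero_nat _)
    have := h0.log (by norm_num)
    simpa using this
  have hmain := ((tendsto_const_nhds (x := Real.log (Real.Gamma x))).sub hG).add
    ((tendsto_const_nhds (x := x + 1)).sub (hTn.add (hL.const_mul (x + 1 / 2))))
  simp only [sub_self, mul_zero, add_zero] at hmain
  refine hmain.congr' ?_
  filter_upwards [eventually_ge_atTop 1] with n hn
  have hn' : (0 : ℝ) < n := by exact_mod_cast hn
  have hlog : Real.log (1 + (x + 1) / (n : ℝ)) = Real.log (x + (n + 1 : ℕ)) - Real.log n := by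
    rw [← Real.log_div (by positivity) hn'.ne']
    congr 1
    push_cast
    field_simp
    ring
  simp only [Function.comp, hlog, stirlingRemainder, hsum, Real.BohrMollerup.logGammaSeq]
  push_cast
  ring

open Filter Topology in
/-- Stirling's formula with relative error `O(1/x)`, stated for a quotient so that the constant
`√(2π)` drops out. -/
lemma abs_stirlingRemainder_sub_le {x y : ℝ} (hx : 0 < x) (hy : 0 < y) :
    |stirlingRemainder x - stirlingRemainder y| ≤ 1 / x + 1 / y := by
  have h := ((tendsto_stirlingRemainder_add_nat hx).sub (tendsto_stirlingRemainder_add_nat hy)).abs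
  simp only [sub_self, abs_zero, sub_sub_sub_cancel_right] at h
  have hle : ∀ n : ℕ, |stirlingRemainder x - stirlingRemainder y| - (1 / x + 1 / y)
      ≤ |stirlingRemainder (x + (n + 1 : ℕ)) - stirlingRemainder (y + (n + 1 : ℕ))| := by
    intro n
    have h1 := abs_stirlingRemainder_add_nat_sub_le hx (n + 1)
    have h2 := abs_stirlingRemainder_add_nat_sub_le hy (n + 1)
    have p1 : 0 ≤ 1 / (x + (n + 1 : ℕ)) := by positivity
    have p2 : 0 ≤ 1 / (y + (n + 1 : ℕ)) := by positivity
    rw [abs_le] at h1 h2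
    have := abs_le.1 (le_refl |stirlingRemainder (x + (n + 1 : ℕ))
      - stirlingRemainder (y + (n + 1 : ℕ))|)
    rw [sub_le_iff_le_add, abs_le]
    constructor <;> linarith
  have := ge_of_tendsto' h hle
  linarith

/-! ### The Airy function as an integral along a vertical line -/

open Complex in
/-- The vertical line `Re w = 1`, parametrised by its imaginary part. -/
noncomputable def airyLine (y : ℝ) : ℂ := 1 + y * I

open Complex in
/-- The Airy exponential `exp(w³/3 - t w)`. -/
noncomputable def airyExp (t : ℝ) (w : ℂ) : ℂ := exp (w ^ 3 / 3 - t * w)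

open Complex in
/-- The moment `(1/2π) ∫ w^k exp(w³/3 - t w) dy` along the line `w = 1 + iy`. Up to the sign
`(-1)^k` it is the `k`-th derivative of the Airy function. -/
noncomputable def airyMoment (k : ℕ) (t : ℝ) : ℂ :=
  (1 / (2 * Real.pi)) * ∫ y : ℝ, airyLine y ^ k * airyExp t (airyLine y)

lemma airyLine_re (y : ℝ) : (airyLine y).re = 1 := by simp [airyLine]

lemma airyLine_im (y : ℝ) : (airyLine y).im = y := by simp [airyLine]

@[fun_prop]
lemma continuous_airyLine : Continuous airyLine := by unfold airyLine; fun_prop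

lemma norm_airyLine_le (y : ℝ) : ‖airyLine y‖ ≤ 1 + |y| := by
  unfold airyLine
  refine (norm_add_le _ _).trans ?_
  simp

open Complex in
lemma hasDerivAt_airyLine (y : ℝ) : HasDerivAt airyLine I y := by
  unfold airyLine
  simpa using ((Complex.ofRealCLM.hasDerivAt (x := y)).mul_const I).const_add 1

open Complex in
lemma norm_airyExp (t : ℝ) (z : ℂ) :
    ‖airyExp t z‖ = Real.exp (z.re ^ 3 / 3 - z.re * z.im ^ 2 - t * z.re) := by
  unfold airyExp
  rw [norm_exp]
  congr 1
  have : z ^ 3 / 3 = ((z.re ^ 3 / 3 - z.re * z.im ^ 2 : ℝ) : ℂ)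
      + ((z.re ^ 2 * z.im - z.im ^ 3 / 3 : ℝ) : ℂ) * I := by
    conv_lhs => rw [← re_add_im z]
    push_cast
    have h3 : (I : ℂ) ^ 3 = -I := by rw [pow_succ, I_sq]; ring
    ring_nf
    rw [h3, I_sq]
    ring
  rw [sub_re, this]
  simp [-ofReal_pow]

lemma norm_airyExp_airyLine (t y : ℝ) :
    ‖airyExp t (airyLine y)‖ = Real.exp (1 / 3 - t) * Real.exp (-1 * y ^ 2) := by
  rw [norm_airyExp, airyLine_re, airyLine_im, ← Real.exp_add]
  congr 1
  ring

/-- A polynomial is absorbed by half of a Gaussian. -/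
lemma one_add_abs_pow_mul_exp_le (m : ℕ) {c : ℝ} (hc : 0 < c) (y : ℝ) :
    (1 + |y|) ^ m * Real.exp (-c * y ^ 2)
      ≤ Real.exp (m ^ 2 / (2 * c)) * Real.exp (-(c / 2) * y ^ 2) := by
  have h1 : (1 + |y|) ^ m ≤ Real.exp (m * |y|) := by
    rw [Real.exp_nat_mul]
    refine pow_le_pow_left₀ (by positivity) ?_ m
    have := Real.add_one_le_exp |y|
    linarith
  calc _ ≤ Real.exp (m * |y|) * Real.exp (-c * y ^ 2) := by gcongr
    _ ≤ _ := by
      rw [← Real.exp_add, ← Real.exp_add, Real.exp_le_exp]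
      have h2 : (m ^ 2 / (2 * c) + -(c / 2) * y ^ 2) - (m * |y| + -c * y ^ 2)
          = (m - c * |y|) ^ 2 / (2 * c) := by
        rw [← sq_abs y]
        field_simp
        ring
      have h3 : 0 ≤ (m - c * |y|) ^ 2 / (2 * c) := by positivity
      linarith

lemma integrable_one_add_abs_pow_mul_exp (m : ℕ) {c : ℝ} (hc : 0 < c) :
    MeasureTheory.Integrable (fun y : ℝ => (1 + |y|) ^ m * Real.exp (-c * y ^ 2)) := by
  have h := (integrable_exp_neg_mul_sq (b := c / 2) (by positivity)).const_mul
    (Real.exp (m ^ 2 / (2 * c)))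
  refine h.mono' (by fun_prop) (Filter.Eventually.of_forall fun y => ?_)
  rw [Real.norm_of_nonneg (by positivity)]
  exact one_add_abs_pow_mul_exp_le m hc y

@[fun_prop]
lemma continuous_airyExp (t : ℝ) : Continuous (airyExp t) := by unfold airyExp; fun_prop

lemma norm_pow_mul_airyExp_le (k : ℕ) (t y : ℝ) :
    ‖airyLine y ^ k * airyExp t (airyLine y)‖
      ≤ Real.exp (1 / 3 - t) * ((1 + |y|) ^ k * Real.exp (-1 * y ^ 2)) := by
  rw [norm_mul, norm_pow, norm_airyExp_airyLine]
  have := pow_le_pow_left₀ (norm_nonneg _) (norm_airyLine_le y) k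
  calc _ ≤ (1 + |y|) ^ k * (Real.exp (1 / 3 - t) * Real.exp (-1 * y ^ 2)) := by gcongr
    _ = _ := by ring

lemma integrable_pow_mul_airyExp (k : ℕ) (t : ℝ) :
    MeasureTheory.Integrable (fun y : ℝ => airyLine y ^ k * airyExp t (airyLine y)) := by
  refine ((integrable_one_add_abs_pow_mul_exp k one_pos).const_mul
    (Real.exp (1 / 3 - t))).mono' (by fun_prop) (Filter.Eventually.of_forall fun y => ?_)
  exact norm_pow_mul_airyExp_le k t y

open Complex in
lemma hasDerivAt_airyExp_left (t : ℝ) (w : ℂ) :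
    HasDerivAt (fun t : ℝ => airyExp t w) (-w * airyExp t w) t := by
  have h := (((hasDerivAt_id (t : ℂ)).mul_const w).const_sub (w ^ 3 / 3)).cexp
  exact h.comp_ofReal.congr_deriv (by simp only [airyExp, id]; ring)

open Complex in
lemma hasDerivAt_airyExp_airyLine (t y : ℝ) : HasDerivAt (fun y => airyExp t (airyLine y))
    (I * (airyLine y ^ 2 - t) * airyExp t (airyLine y)) y := by
  have h1 : HasDerivAt (airyExp t) ((airyLine y ^ 2 - t) * airyExp t (airyLine y))
      (airyLine y) := by
    have h := ((((hasDerivAt_id (airyLine y)).pow 3).div_const 3).sub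
      ((hasDerivAt_id (airyLine y)).const_mul (t : ℂ))).cexp
    exact h.congr_deriv (by simp [airyExp]; ring)
  exact (h1.comp y (hasDerivAt_airyLine y)).congr_deriv (by ring)

lemma hasDerivAt_airyMoment (k : ℕ) (t : ℝ) :
    HasDerivAt (airyMoment k) (-airyMoment (k + 1) t) t := by
  have h := hasDerivAt_integral_of_dominated_loc_of_deriv_le (μ := MeasureTheory.volume)
    (F := fun t y => airyLine y ^ k * airyExp t (airyLine y))
    (F' := fun t y => -(airyLine y ^ (k + 1) * airyExp t (airyLine y)))
    (bound := fun y => Real.exp (1 / 3 - (t - 1)) * ((1 + |y|) ^ (k + 1) * Real.exp (-1 * y ^ 2)))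
    (x₀ := t) (Metric.ball_mem_nhds t one_pos)
    (Filter.Eventually.of_forall fun t => by fun_prop)
    (integrable_pow_mul_airyExp k t) (by fun_prop)
    (Filter.Eventually.of_forall fun y t' ht' => by
      rw [norm_neg]
      refine (norm_pow_mul_airyExp_le (k + 1) t' y).trans ?_
      have : t - 1 ≤ t' := by
        rw [Metric.mem_ball, Real.dist_eq] at ht'
        linarith [(abs_lt.1 ht').1]
      gcongr)
    ((integrable_one_add_abs_pow_mul_exp (k + 1) one_pos).const_mul _)
    (Filter.Eventually.of_forall fun y t' _ => by
      have h := (hasDerivAt_airyExp_left t' (airyLine y)).const_mul (airyLine y ^ k)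
      rwa [show airyLine y ^ k * (-airyLine y * airyExp t' (airyLine y))
        = -(airyLine y ^ (k + 1) * airyExp t' (airyLine y)) by ring] at h)
  have h2 := h.2.const_mul (1 / (2 * Real.pi) : ℂ)
  rwa [MeasureTheory.integral_neg, mul_neg] at h2

lemma continuous_airyMoment (k : ℕ) : Continuous (airyMoment k) :=
  continuous_iff_continuousAt.2 fun t => (hasDerivAt_airyMoment k t).continuousAt

open Complex in
/-- Integration by parts: `∫ d(w^(k+1) exp(w³/3 - tw)) = 0`. -/
lemma airyMoment_add_three (k : ℕ) (t : ℝ) :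
    airyMoment (k + 3) t = t * airyMoment (k + 1) t - (k + 1) * airyMoment k t := by
  have hd : ∀ y : ℝ, HasDerivAt (fun y => airyLine y ^ (k + 1) * airyExp t (airyLine y))
      (I * ((k + 1) * (airyLine y ^ k * airyExp t (airyLine y))
        + (airyLine y ^ (k + 3) * airyExp t (airyLine y))
        - t * (airyLine y ^ (k + 1) * airyExp t (airyLine y)))) y := by
    intro y
    have h1 := (hasDerivAt_airyLine y).pow (k + 1)
    refine (h1.mul (hasDerivAt_airyExp_airyLine t y)).congr_deriv ?_
    simp only [Nat.add_sub_cancel, Pi.pow_apply, Nat.cast_add, Nat.cast_one]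
    ring
  have i0 := (integrable_pow_mul_airyExp k t).const_mul ((k : ℂ) + 1)
  have i1 := (integrable_pow_mul_airyExp (k + 1) t).const_mul (t : ℂ)
  have i3 := integrable_pow_mul_airyExp (k + 3) t
  have h := MeasureTheory.integral_eq_zero_of_hasDerivAt_of_integrable hd
    (((i0.add i3).sub i1).const_mul I) (integrable_pow_mul_airyExp (k + 1) t)
  have e1 := MeasureTheory.integral_sub (i0.add i3) i1
  have e2 := MeasureTheory.integral_add i0 i3
  simp only [Pi.add_apply] at e1
  rw [MeasureTheory.integral_const_mul, e1, e2, MeasureTheory.integral_const_mul,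
    MeasureTheory.integral_const_mul, mul_eq_zero, or_iff_right I_ne_zero] at h
  unfold airyMoment
  linear_combination (1 / (2 * Real.pi) : ℂ) * h

open Complex in
lemma airyMoment_two (t : ℝ) : airyMoment 2 t = t * airyMoment 0 t := by
  have hd : ∀ y : ℝ, HasDerivAt (fun y => airyLine y ^ 0 * airyExp t (airyLine y))
      (I * ((airyLine y ^ 2 * airyExp t (airyLine y))
        - t * (airyLine y ^ 0 * airyExp t (airyLine y)))) y := by
    intro y
    simp only [pow_zero, one_mul]
    exact (hasDerivAt_airyExp_airyLine t y).congr_deriv (by ring)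
  have i1 := (integrable_pow_mul_airyExp 0 t).const_mul (t : ℂ)
  have i3 := integrable_pow_mul_airyExp 2 t
  have h := MeasureTheory.integral_eq_zero_of_hasDerivAt_of_integrable hd
    ((i3.sub i1).const_mul I) (integrable_pow_mul_airyExp 0 t)
  rw [MeasureTheory.integral_const_mul, MeasureTheory.integral_sub i3 i1,
    MeasureTheory.integral_const_mul, mul_eq_zero, or_iff_right I_ne_zero] at h
  unfold airyMoment
  linear_combination (1 / (2 * Real.pi) : ℂ) * h

open Complex Set in
/-- On the horizontal segments that join the rays `arg z = ±π/3` to the line `Re z = 1`, the Airy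
exponential is so small that the two contours give the same integral. -/
lemma norm_sub_le_of_airyExp_primitive {t T v : ℝ} {P : ℂ → ℂ} (hT : 2 ≤ T)
    (hv : v ^ 2 = 3 / 4 * T ^ 2) (ht : 0 ≤ 2 / 3 * T ^ 2 + t)
    (hP : ∀ z ∈ Metric.ball (0 : ℂ) (2 * T), HasDerivAt P (airyExp t z) z) :
    ‖P ((T / 2 : ℝ) + v * I) - P ((1 : ℝ) + v * I)‖
      ≤ Real.exp (-(2 / 3 * T ^ 2 + t)) * T := by
  have hconv : Convex ℝ (Icc 1 (T / 2) ×ℂ {v}) := ((convex_Icc _ _).linear_preimage reLm).inter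
      ((convex_singleton _).linear_preimage imLm)
  have hb : ∀ z ∈ Icc 1 (T / 2) ×ℂ {v}, ‖airyExp t z‖ ≤ Real.exp (-(2 / 3 * T ^ 2 + t)) := by
    intro z hz
    obtain ⟨⟨h1, h2⟩, h3⟩ := mem_reProdIm.1 hz
    rw [mem_singleton_iff] at h3
    rw [norm_airyExp, Real.exp_le_exp, h3, hv]
    have e1 : z.re ^ 2 ≤ T ^ 2 / 4 := by nlinarith
    nlinarith [mul_le_mul_of_nonneg_left e1 (by linarith : (0 : ℝ) ≤ z.re),
      mul_nonneg (sub_nonneg.2 h1) ht]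
  have hin : ∀ z ∈ Icc 1 (T / 2) ×ℂ {v}, z ∈ Metric.ball (0 : ℂ) (2 * T) := by
    intro z hz
    obtain ⟨⟨h1, h2⟩, h3⟩ := mem_reProdIm.1 hz
    rw [mem_singleton_iff] at h3
    rw [mem_ball_zero_iff]
    refine lt_of_pow_lt_pow_left₀ 2 (by linarith) ?_
    rw [← normSq_eq_norm_sq, normSq_apply, h3]
    nlinarith
  have h := hconv.norm_image_sub_le_of_norm_hasDerivWithin_le
    (fun z hz => (hP z (hin z hz)).hasDerivWithinAt) hb
    (x := (1 : ℝ) + v * I) (y := (T / 2 : ℝ) + v * I)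
    (by rw [mem_reProdIm]; simp; linarith) (by rw [mem_reProdIm]; simp; linarith)
  refine h.trans ?_
  gcongr
  have : (((T / 2 : ℝ) : ℂ) + v * I) - ((1 : ℝ) + v * I) = ((T / 2 - 1 : ℝ) : ℂ) := by
    push_cast; ring
  rw [this, norm_real, Real.norm_of_nonneg (by linarith)]
  linarith

open Complex in
lemma airyRay_eq (T : ℝ) :
    (T : ℂ) * exp (I * Real.pi / 3) = (T / 2 : ℝ) + (Real.sqrt 3 / 2 * T : ℝ) * I := by
  have : I * Real.pi / 3 = ((Real.pi / 3 : ℝ) : ℂ) * I := by push_cast; ring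
  rw [this, exp_mul_I, ← ofReal_cos, ← ofReal_sin, Real.cos_pi_div_three, Real.sin_pi_div_three]
  push_cast
  ring

open Complex in
lemma airyRay_eq_neg (T : ℝ) :
    (T : ℂ) * exp (-(I * Real.pi / 3)) = (T / 2 : ℝ) + (-(Real.sqrt 3 / 2 * T) : ℝ) * I := by
  have : -(I * Real.pi / 3) = ((-(Real.pi / 3) : ℝ) : ℂ) * I := by push_cast; ring
  rw [this, exp_mul_I, ← ofReal_cos, ← ofReal_sin, Real.cos_neg, Real.sin_neg,
    Real.cos_pi_div_three, Real.sin_pi_div_three]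
  push_cast
  ring

open Complex in
/-- The integral along a ray as a difference of values of a primitive. -/
lemma integral_airyExp_ray {t T : ℝ} {P : ℂ → ℂ} (hT : 0 ≤ T) (u : ℂ) (hu : ‖u‖ = 1)
    (hP : ∀ z ∈ Metric.ball (0 : ℂ) (2 * T + 1), HasDerivAt P (airyExp t z) z) :
    ∫ r in (0 : ℝ)..T, airyExp t (r * u) * u = P (T * u) - P 0 := by
  have hd : ∀ r ∈ Set.uIcc 0 T, HasDerivAt (fun r : ℝ => P (r * u)) (airyExp t (r * u) * u) r := by
    intro r hr
    rw [Set.uIcc_of_le hT] at hr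
    have h1 : HasDerivAt (fun r : ℝ => (r : ℂ) * u) u r := by
      simpa using (Complex.ofRealCLM.hasDerivAt (x := r)).mul_const u
    refine (hP _ ?_).comp r h1
    rw [mem_ball_zero_iff, norm_mul, hu, norm_real, Real.norm_of_nonneg hr.1]
    linarith [hr.2]
  rw [intervalIntegral.integral_eq_sub_of_hasDerivAt hd
    (Continuous.intervalIntegrable (by fun_prop) _ _)]
  simp

open Complex in
lemma integral_airyExp_line {t T v : ℝ} {P : ℂ → ℂ} (hv0 : 0 ≤ v) (hvT : v ≤ 2 * T)
    (hP : ∀ z ∈ Metric.ball (0 : ℂ) (2 * T + 2), HasDerivAt P (airyExp t z) z) :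
    ∫ y in (-v)..v, airyExp t (airyLine y) * I
      = P ((1 : ℝ) + v * I) - P ((1 : ℝ) + (-v : ℝ) * I) := by
  have hd : ∀ y ∈ Set.uIcc (-v) v, HasDerivAt (fun y : ℝ => P (airyLine y))
      (airyExp t (airyLine y) * I) y := by
    intro y hy
    rw [Set.uIcc_of_le (by linarith)] at hy
    refine (hP _ ?_).comp y (hasDerivAt_airyLine y)
    rw [mem_ball_zero_iff]
    have := norm_airyLine_le y
    have := abs_le.2 hy
    linarith
  rw [intervalIntegral.integral_eq_sub_of_hasDerivAt hd
    (Continuous.intervalIntegrable (by fun_prop) _ _)]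
  simp [airyLine]

open Complex MeasureTheory Set in
/-- Integrability of the Airy exponential on a ray on which `Re z³ = -r³`. -/
lemma integrableOn_airyExp_ray (t : ℝ) (u : ℂ) (hu : ‖u‖ = 1) (hu3 : u ^ 3 = -1) :
    IntegrableOn (fun r : ℝ => airyExp t (r * u) * u) (Ioi 0) := by
  have hI := (integrable_one_add_abs_pow_mul_exp 0 (one_pos (α := ℝ))).const_mul
    (Real.exp (2 * (2 + |t|) ^ 3))
  refine hI.integrableOn.mono' (by fun_prop) ((ae_restrict_iff' measurableSet_Ioi).2
    (Filter.Eventually.of_forall fun r hr => ?_))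
  have hr0 : 0 < r := hr
  rw [norm_mul, hu, mul_one, airyExp, norm_exp, mul_pow, hu3, pow_zero, one_mul, ← Real.exp_add,
    Real.exp_le_exp]
  have e1 : ((r : ℂ) ^ 3 * -1 / 3 - t * (r * u)).re = - r ^ 3 / 3 - t * r * u.re := by
    have : (r : ℂ) ^ 3 * -1 / 3 = ((- r ^ 3 / 3 : ℝ) : ℂ) := by push_cast; ring
    rw [sub_re, this, ofReal_re, ← mul_assoc, ← ofReal_mul, re_ofReal_mul]
  rw [e1]
  have e2 : |u.re| ≤ 1 := hu ▸ abs_re_le_norm u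
  have e3 : -(t * r * u.re) ≤ |t| * r := by
    calc _ ≤ |t * r * u.re| := neg_le_abs _
      _ = |t| * r * |u.re| := by rw [abs_mul, abs_mul, abs_of_pos hr0]
      _ ≤ _ := mul_le_of_le_one_right (by positivity) e2
  -- with `A = 2 + |t|`: either `r ≤ 3A`, or the cubic dominates
  have hA : 0 ≤ |t| := abs_nonneg t
  set A := 2 + |t| with hAdef
  have h2 : r ^ 2 + |t| * r ≤ r ^ 3 / 3 + 2 * A ^ 3 := by
    have : |t| = A - 2 := by rw [hAdef]; ring
    rw [this]
    have hA2 : 2 ≤ A := by linarith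
    nlinarith [mul_nonneg hr0.le (sq_nonneg (r - 2 * A)), mul_nonneg (by linarith : 0 ≤ A)
      (sq_nonneg (r - A)), sq_nonneg (r - A), sq_nonneg (r - 2),
      mul_nonneg hr0.le (sq_nonneg (r - 2)), mul_nonneg hr0.le (sq_nonneg (r - A))]
  linarith

open Complex MeasureTheory Set Filter Topology in
/-- The contour of the definition of `Ai`, two rays at angles `±π/3`, moved to the line
`Re w = 1`. -/
lemma airyRays_eq_airyMoment (t : ℝ) :
    (1 / (2 * Real.pi * I)) *
    ((∫ r in Set.Ioi (0 : ℝ),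
        exp (((r : ℂ) * exp (I * Real.pi / 3)) ^ 3 / 3 - t * ((r : ℂ) * exp (I * Real.pi / 3)))
          * exp (I * Real.pi / 3))
      - ∫ r in Set.Ioi (0 : ℝ),
        exp (((r : ℂ) * exp (-(I * Real.pi / 3))) ^ 3 / 3
            - t * ((r : ℂ) * exp (-(I * Real.pi / 3))))
          * exp (-(I * Real.pi / 3))) = airyMoment 0 t := by
  set u := exp (I * Real.pi / 3) with hu
  set u' := exp (-(I * Real.pi / 3)) with hu'
  have hun : ‖u‖ = 1 := by
    rw [hu, show I * Real.pi / 3 = ((Real.pi / 3 : ℝ) : ℂ) * I by push_cast; ring,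
      norm_exp_ofReal_mul_I]
  have hun' : ‖u'‖ = 1 := by
    rw [hu', show -(I * Real.pi / 3) = ((-(Real.pi / 3) : ℝ) : ℂ) * I by push_cast; ring,
      norm_exp_ofReal_mul_I]
  have hu3 : u ^ 3 = -1 := by
    rw [hu, ← exp_nat_mul, show ((3 : ℕ) : ℂ) * (I * Real.pi / 3) = Real.pi * I by push_cast; ring,
      exp_pi_mul_I]
  have hu3' : u' ^ 3 = -1 := by
    rw [hu', ← exp_nat_mul, show ((3 : ℕ) : ℂ) * (-(I * Real.pi / 3)) = -(Real.pi * I) by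
      push_cast; ring, exp_neg, exp_pi_mul_I]
    norm_num
  have l1 := intervalIntegral_tendsto_integral_Ioi 0 (integrableOn_airyExp_ray t u hun hu3)
    tendsto_id
  have l2 := intervalIntegral_tendsto_integral_Ioi 0 (integrableOn_airyExp_ray t u' hun' hu3')
    tendsto_id
  have hs : Tendsto (fun T : ℝ => Real.sqrt 3 / 2 * T) atTop atTop :=
    tendsto_id.const_mul_atTop (by positivity)
  have i0 : Integrable (fun y => airyExp t (airyLine y) * I) := by
    simpa using (integrable_pow_mul_airyExp 0 t).mul_const I
  have l3 := intervalIntegral_tendsto_integral i0 (tendsto_neg_atTop_atBot.comp hs) hs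
  have hlim := (l1.sub l2).sub l3
  have hzero : Tendsto (fun T : ℝ => 2 * (Real.exp (-(2 / 3 * T ^ 2 + t)) * T)) atTop (𝓝 0) := by
    have h1 : Tendsto (fun T : ℝ => 2 * Real.exp (-t) * (T ^ 1 * Real.exp (-T))) atTop
        (𝓝 (2 * Real.exp (-t) * 0)) :=
      (Real.tendsto_pow_mul_exp_neg_atTop_nhds_zero 1).const_mul _
    rw [mul_zero] at h1
    refine squeeze_zero' ?_ ?_ h1
    · filter_upwards [eventually_ge_atTop 0] with T hT
      positivity
    · filter_upwards [eventually_ge_atTop 2] with T hT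
      rw [pow_one]
      have : Real.exp (-(2 / 3 * T ^ 2 + t)) ≤ Real.exp (-t) * Real.exp (-T) := by
        rw [← Real.exp_add, Real.exp_le_exp]
        nlinarith
      nlinarith [mul_le_mul_of_nonneg_right this (by linarith : (0 : ℝ) ≤ T)]
  have hdiff : Tendsto (fun T : ℝ => ((∫ r in (0 : ℝ)..T, airyExp t (r * u) * u)
      - ∫ r in (0 : ℝ)..T, airyExp t (r * u') * u')
      - ∫ y in (-(Real.sqrt 3 / 2 * T))..(Real.sqrt 3 / 2 * T), airyExp t (airyLine y) * I)
      atTop (𝓝 0) := by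
    refine squeeze_zero_norm' ?_ hzero
    filter_upwards [eventually_ge_atTop 2, eventually_ge_atTop (|t|)] with T hT hTt
    have hdiffable : DifferentiableOn ℂ (airyExp t) (Metric.ball 0 (2 * T + 2)) := by
      unfold airyExp; fun_prop
    obtain ⟨P, hP⟩ := hdiffable.isExactOn_ball
    have hsq : Real.sqrt 3 ^ 2 = 3 := Real.sq_sqrt (by norm_num)
    have hs2 : Real.sqrt 3 ≤ 2 := by
      rw [Real.sqrt_le_left (by norm_num)]; norm_num
    have hv : (Real.sqrt 3 / 2 * T) ^ 2 = 3 / 4 * T ^ 2 := by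
      rw [mul_pow, div_pow, hsq]; ring
    have hv' : (-(Real.sqrt 3 / 2 * T)) ^ 2 = 3 / 4 * T ^ 2 := by rw [neg_sq, hv]
    have ht : 0 ≤ 2 / 3 * T ^ 2 + t := by
      have := neg_abs_le t
      nlinarith
    have sub1 : Metric.ball (0 : ℂ) (2 * T) ⊆ Metric.ball 0 (2 * T + 2) :=
      Metric.ball_subset_ball (by linarith)
    have sub2 : Metric.ball (0 : ℂ) (2 * T + 1) ⊆ Metric.ball 0 (2 * T + 2) :=
      Metric.ball_subset_ball (by linarith)
    have b1 := norm_sub_le_of_airyExp_primitive hT hv ht fun z hz => hP z (sub1 hz)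
    have b2 := norm_sub_le_of_airyExp_primitive hT hv' ht fun z hz => hP z (sub1 hz)
    rw [integral_airyExp_ray (by linarith) u hun fun z hz => hP z (sub2 hz),
      integral_airyExp_ray (by linarith) u' hun' fun z hz => hP z (sub2 hz),
      integral_airyExp_line (by positivity) (by nlinarith) hP, hu, hu', airyRay_eq, airyRay_eq_neg]
    set a := P ((T / 2 : ℝ) + (Real.sqrt 3 / 2 * T : ℝ) * I)
    set b := P ((T / 2 : ℝ) + (-(Real.sqrt 3 / 2 * T) : ℝ) * I)
    set c := P ((1 : ℝ) + (Real.sqrt 3 / 2 * T : ℝ) * I)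
    set d := P ((1 : ℝ) + (-(Real.sqrt 3 / 2 * T) : ℝ) * I)
    calc _ = ‖(a - c) - (b - d)‖ := by congr 1; ring
      _ ≤ ‖a - c‖ + ‖b - d‖ := norm_sub_le _ _
      _ ≤ _ := by linarith
  have huniq := tendsto_nhds_unique hlim hdiff
  have hI := integral_mul_const I (fun y => airyExp t (airyLine y)) (μ := volume)
  rw [hI, sub_eq_zero] at huniq
  unfold airyMoment
  simp only [pow_zero, one_mul]
  change (1 / (2 * Real.pi * I)) * ((∫ r in Set.Ioi (0 : ℝ), airyExp t (r * u) * u)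
    - ∫ r in Set.Ioi (0 : ℝ), airyExp t (r * u') * u') = _
  rw [huniq]
  have := I_ne_zero
  have hpi : (Real.pi : ℂ) ≠ 0 := ofReal_ne_zero.2 Real.pi_ne_zero
  field_simp

open Complex MeasureTheory in
lemma conj_airyMoment (k : ℕ) (t : ℝ) :
    (starRingEnd ℂ) (airyMoment k t) = airyMoment k t := by
  unfold airyMoment
  rw [map_mul, ← integral_conj]
  congr 1
  · simp [Complex.conj_ofNat]
  · rw [← integral_neg_eq_self]
    congr 1
    ext y
    simp [airyLine, airyExp, ← exp_conj, Complex.conj_ofNat]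

lemma ofReal_airyAi (t : ℝ) : (airyAi t : ℂ) = airyMoment 0 t := by
  unfold airyAi
  rw [airyRays_eq_airyMoment]
  exact Complex.conj_eq_iff_re.1 (conj_airyMoment 0 t)

lemma hasDerivAt_airyAi (t : ℝ) : HasDerivAt airyAi (-(airyMoment 1 t).re) t := by
  have h := Complex.reCLM.hasFDerivAt.comp_hasDerivAt t (hasDerivAt_airyMoment 0 t)
  have e : airyAi = fun t => (airyMoment 0 t).re := by
    ext t
    rw [← ofReal_airyAi, Complex.ofReal_re]
  rw [e]
  exact h.congr_deriv (by simp)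

lemma ofReal_airyAi' (t : ℝ) : (airyAi' t : ℂ) = -airyMoment 1 t := by
  rw [airyAi', (hasDerivAt_airyAi t).deriv, Complex.ofReal_neg,
    Complex.conj_eq_iff_re.1 (conj_airyMoment 1 t)]

lemma hasDerivAt_airyAi' (t : ℝ) : HasDerivAt airyAi' (t * airyAi t) t := by
  have h := (Complex.reCLM.hasFDerivAt.comp_hasDerivAt t (hasDerivAt_airyMoment 1 t)).neg
  have e : airyAi' = -fun t => (airyMoment 1 t).re := by
    ext t
    rw [Pi.neg_apply, ← Complex.neg_re, ← ofReal_airyAi', Complex.ofReal_re]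
  rw [e]
  have e2 : airyMoment 2 t = ((t * airyAi t : ℝ) : ℂ) := by
    rw [airyMoment_two, Complex.ofReal_mul, ofReal_airyAi]
  exact h.congr_deriv (by simp [e2])

/-! ### Laguerre polynomials: integral representation and Christoffel–Darboux formula -/

open Complex in
/-- The circle `|u| = r`, traversed so that `u = -r` at `η = 0`. -/
noncomputable def laguerreCircle (r η : ℝ) : ℂ := -(r * exp (-(η * I)))

open Complex in
/-- The generating integrand `e^{-xu} (1+u)^b u^{-m}`, whose mean over a circle `|u| = r < 1` is the
coefficient of `u^m` in `e^{-xu} (1+u)^b`. -/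
noncomputable def laguerreIntegrand (b : ℝ) (m : ℕ) (x : ℝ) (u : ℂ) : ℂ :=
  exp (-(x * u)) * (1 + u) ^ (b : ℂ) / u ^ m

lemma norm_laguerreCircle {r : ℝ} (hr : 0 < r) (η : ℝ) : ‖laguerreCircle r η‖ = r := by
  unfold laguerreCircle
  rw [norm_neg, norm_mul, Complex.norm_real, Real.norm_of_nonneg hr.le,
    show -((η : ℂ) * Complex.I) = ((-η : ℝ) : ℂ) * Complex.I by push_cast; ring,
    Complex.norm_exp_ofReal_mul_I, mul_one]

lemma laguerreCircle_ne_zero {r : ℝ} (hr : 0 < r) (η : ℝ) : laguerreCircle r η ≠ 0 := by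
  rw [← norm_pos_iff, norm_laguerreCircle hr]
  exact hr

lemma one_add_laguerreCircle_mem {r : ℝ} (hr : 0 < r) (hr1 : r < 1) (η : ℝ) :
    1 + laguerreCircle r η ∈ Complex.slitPlane :=
  Complex.mem_slitPlane_of_norm_lt_one (by rwa [norm_laguerreCircle hr])

lemma continuous_laguerreIntegrand_circle {r : ℝ} (hr : 0 < r) (hr1 : r < 1) (b : ℝ) (m : ℕ)
    (x : ℝ) : Continuous fun η => laguerreIntegrand b m x (laguerreCircle r η) := by
  have h : Continuous (laguerreCircle r) := by unfold laguerreCircle; fun_prop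
  unfold laguerreIntegrand
  refine Continuous.div (Continuous.mul (by fun_prop) ?_) (by fun_prop)
    fun η => pow_ne_zero _ (laguerreCircle_ne_zero hr η)
  exact (continuous_const.add h).cpow continuous_const fun η => one_add_laguerreCircle_mem hr hr1 η

open Complex Filter Topology in
lemma iteratedDeriv_one_add_cpow {b : ℝ} {n : ℕ} (hb : n ≤ b) {z : ℂ} (hz : ‖z‖ < 1) :
    iteratedDeriv n (fun z : ℂ => (1 + z) ^ (b : ℂ)) z
      = (Real.Gamma (b + 1) / Real.Gamma (b - n + 1) : ℝ) * (1 + z) ^ ((b - n : ℝ) : ℂ) := by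
  induction n generalizing z with
  | zero =>
    have hb0 : (0 : ℝ) ≤ b := by simpa using hb
    have : Real.Gamma (b + 1) ≠ 0 := (Real.Gamma_pos_of_pos (by linarith)).ne'
    simp [this]
  | succ n ih =>
    push_cast at hb
    have heq : iteratedDeriv n (fun z : ℂ => (1 + z) ^ (b : ℂ)) =ᶠ[𝓝 z] fun z =>
        (Real.Gamma (b + 1) / Real.Gamma (b - n + 1) : ℝ) * (1 + z) ^ ((b - n : ℝ) : ℂ) := by
      filter_upwards [Metric.isOpen_ball.mem_nhds (mem_ball_zero_iff.2 hz)] with w hw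
      exact ih (by linarith) (mem_ball_zero_iff.1 hw)
    rw [iteratedDeriv_succ, heq.deriv_eq]
    have hd : HasDerivAt (fun z : ℂ => (1 + z) ^ ((b - n : ℝ) : ℂ))
        (((b - n : ℝ) : ℂ) * (1 + z) ^ (((b - n : ℝ) : ℂ) - 1) * 1) z :=
      ((hasDerivAt_id z).const_add 1).cpow_const (mem_slitPlane_of_norm_lt_one hz)
    rw [(hd.const_mul _).deriv]
    have hG : Real.Gamma (b - n + 1) = (b - n) * Real.Gamma (b - (n + 1 : ℕ) + 1) := by
      rw [Real.Gamma_add_one (by linarith)]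
      congr 2
      push_cast
      ring
    have h0 : b - n ≠ 0 := by linarith
    rw [hG, mul_one, show (((b - n : ℝ) : ℂ) - 1) = ((b - (n + 1 : ℕ) : ℝ) : ℂ) by push_cast; ring,
      ← mul_assoc, ← ofReal_mul]
    congr 2
    field_simp

open Complex in
lemma iteratedDeriv_laguerre_generating (n : ℕ) {a : ℝ} (ha : 0 ≤ a) (x : ℝ) :
    iteratedDeriv n (fun u : ℂ => exp (-(x * u)) * (1 + u) ^ ((n + a : ℝ) : ℂ)) 0
      = n.factorial * (laguerreL n a x : ℂ) := by
  have h1 : ContDiffAt ℂ n (fun u : ℂ => exp (-(x * u))) 0 := by fun_prop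
  have h2 : ContDiffAt ℂ n (fun u : ℂ => (1 + u) ^ ((n + a : ℝ) : ℂ)) 0 := by
    refine AnalyticAt.contDiffAt ?_
    exact (analyticAt_const.add analyticAt_id).cpow analyticAt_const (by simp)
  have h3 : ∀ k, iteratedDeriv k (fun u : ℂ => exp (-(x * u))) 0 = (-x) ^ k := by
    intro k
    have := iteratedDeriv_cexp_const_mul k (-x : ℂ)
    simp only [neg_mul] at this
    rw [this]
    simp
  rw [iteratedDeriv_fun_mul h1 h2]
  unfold laguerreL
  rw [ofReal_sum, Finset.mul_sum]
  refine Finset.sum_congr rfl fun k hk => ?_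
  have hk' : k ≤ n := Nat.lt_succ_iff.1 (Finset.mem_range.1 hk)
  have hc : ((n - k : ℕ) : ℝ) = n - k := Nat.cast_sub hk'
  rw [h3, iteratedDeriv_one_add_cpow (by rw [hc]; have : (0:ℝ) ≤ k := Nat.cast_nonneg k; linarith)
    (by simp), hc]
  rw [add_zero, one_cpow, mul_one, show (n : ℝ) + a - (n - k) + 1 = k + a + 1 by ring,
    Nat.cast_choose ℂ hk']
  have f1 : (k.factorial : ℂ) ≠ 0 := by exact_mod_cast k.factorial_ne_zero
  have f2 : ((n - k).factorial : ℂ) ≠ 0 := by exact_mod_cast (n - k).factorial_ne_zero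
  have f3 : ((Real.Gamma (k + a + 1) : ℝ) : ℂ) ≠ 0 := by
    exact_mod_cast (Real.Gamma_pos_of_pos (by positivity)).ne'
  push_cast
  field_simp
  rw [neg_pow (x : ℂ) k]
  ring

open Complex in
/-- `L_n^a(x)` is the coefficient of `u^n` in `e^{-xu} (1+u)^{n+a}`, by Cauchy's formula. -/
lemma ofReal_laguerreL (n : ℕ) {a : ℝ} (ha : 0 ≤ a) (x : ℝ) {r : ℝ} (hr : 0 < r) (hr1 : r < 1) :
    (laguerreL n a x : ℂ) = (1 / (2 * Real.pi)) *
      ∫ η in (-Real.pi)..Real.pi, laguerreIntegrand (n + a) n x (laguerreCircle r η) := by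
  have hd : DifferentiableOn ℂ (fun u : ℂ => exp (-(x * u)) * (1 + u) ^ ((n + a : ℝ) : ℂ))
      (Metric.closedBall 0 r) := by
    refine DifferentiableOn.mul (by fun_prop) ?_
    refine DifferentiableOn.cpow_const (by fun_prop) fun u hu => ?_
    exact mem_slitPlane_of_norm_lt_one (by
      rw [mem_closedBall_zero_iff] at hu; linarith)
  have h := hd.circleIntegral_one_div_sub_center_pow_smul hr n
  rw [iteratedDeriv_laguerre_generating n ha x] at h
  have f1 : (n.factorial : ℂ) ≠ 0 := by exact_mod_cast n.factorial_ne_zero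
  have hpi : (Real.pi : ℂ) ≠ 0 := ofReal_ne_zero.2 Real.pi_ne_zero
  have h2 : ∫ η in (-Real.pi)..Real.pi, laguerreIntegrand (n + a) n x (laguerreCircle r η)
      = ∫ θ in (0 : ℝ)..(2 * Real.pi), laguerreIntegrand (n + a) n x (circleMap 0 r θ) := by
    have h3 := intervalIntegral.integral_comp_sub_left (a := -Real.pi) (b := Real.pi)
      (fun θ => laguerreIntegrand (n + a) n x (circleMap 0 r θ)) Real.pi
    rw [show Real.pi - Real.pi = 0 by ring, show Real.pi - -Real.pi = 2 * Real.pi by ring] at h3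
    rw [← h3]
    congr 1
    ext η
    congr 1
    unfold laguerreCircle circleMap
    rw [ofReal_sub, sub_mul, sub_eq_add_neg, exp_add, exp_pi_mul_I]
    ring
  rw [h2]
  have h4 : (∮ z in C(0, r), (1 / (z - 0) ^ (n + 1)) •
      (exp (-(x * z)) * (1 + z) ^ ((n + a : ℝ) : ℂ)))
      = I * ∫ θ in (0 : ℝ)..(2 * Real.pi), laguerreIntegrand (n + a) n x (circleMap 0 r θ) := by
    rw [circleIntegral, ← intervalIntegral.integral_const_mul]
    congr 1
    ext θ
    have hz : circleMap 0 r θ ≠ 0 := circleMap_ne_center hr.ne'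
    unfold laguerreIntegrand
    rw [deriv_circleMap, smul_eq_mul, smul_eq_mul, sub_zero, pow_succ]
    field_simp
  rw [h4, smul_eq_mul] at h
  have hI := I_ne_zero
  field_simp at h
  field_simp
  linear_combination -h

open Complex in
lemma hasDerivAt_laguerreCircle (r η : ℝ) :
    HasDerivAt (laguerreCircle r) (-I * laguerreCircle r η) η := by
  have h := (((((hasDerivAt_id (η : ℂ)).mul_const I).neg).cexp).const_mul (r : ℂ)).neg
  exact h.comp_ofReal.congr_deriv (by simp [laguerreCircle]; ring)

open Complex in
/-- The total derivative whose vanishing mean is the three-term recurrence. -/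
lemma hasDerivAt_laguerreIntegrand_circle {r : ℝ} (hr : 0 < r) (hr1 : r < 1) (b : ℝ) (n : ℕ)
    (x η : ℝ) :
    HasDerivAt (fun η => laguerreIntegrand b (n + 2) x (laguerreCircle r η))
      (I * ((n + 2) * laguerreIntegrand (b + 1) (n + 2) x (laguerreCircle r η)
        - (b + n + 2 - x) * laguerreIntegrand b (n + 1) x (laguerreCircle r η)
        + b * laguerreIntegrand (b - 1) n x (laguerreCircle r η))) η := by
  set u := laguerreCircle r η with hu
  have hu0 : u ≠ 0 := laguerreCircle_ne_zero hr η
  have hs := one_add_laguerreCircle_mem hr hr1 η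
  have h1u : 1 + u ≠ 0 := slitPlane_ne_zero hs
  have d1 : HasDerivAt (fun u : ℂ => exp (-(x * u))) (exp (-(x * u)) * (-(x * 1))) u :=
    ((hasDerivAt_id u).const_mul (x : ℂ)).neg.cexp
  have d2 : HasDerivAt (fun u : ℂ => (1 + u) ^ (b : ℂ))
      ((b : ℂ) * (1 + u) ^ ((b : ℂ) - 1) * 1) u :=
    ((hasDerivAt_id u).const_add 1).cpow_const hs
  have d3 : HasDerivAt (fun u : ℂ => u ^ (n + 2)) (((n + 2 : ℕ) : ℂ) * u ^ (n + 1)) u := by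
    simpa using hasDerivAt_pow (n + 2) u
  have h := ((d1.mul d2).div d3 (pow_ne_zero _ hu0)).comp η (hasDerivAt_laguerreCircle r η)
  refine h.congr_deriv ?_
  simp only [laguerreIntegrand, Pi.mul_apply]
  rw [← hu]
  push_cast
  rw [cpow_add _ _ h1u, cpow_sub _ _ h1u, cpow_one]
  field_simp
  ring

lemma laguerreCircle_pi (r : ℝ) : laguerreCircle r Real.pi = r := by
  simp [laguerreCircle, Complex.exp_neg, Complex.exp_pi_mul_I]

lemma laguerreCircle_neg_pi (r : ℝ) : laguerreCircle r (-Real.pi) = r := by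
  simp [laguerreCircle, Complex.exp_pi_mul_I]

lemma laguerreL_recurrence (n : ℕ) {a : ℝ} (ha : 0 ≤ a) (x : ℝ) :
    (n + 2) * laguerreL (n + 2) a x
      = (2 * n + 3 + a - x) * laguerreL (n + 1) a x - (n + 1 + a) * laguerreL n a x := by
  have hr : (0 : ℝ) < 1 / 2 := by norm_num
  have hr1 : (1 / 2 : ℝ) < 1 := by norm_num
  have e0 := ofReal_laguerreL n ha x hr hr1
  have e1 := ofReal_laguerreL (n + 1) ha x hr hr1
  have e2 := ofReal_laguerreL (n + 2) ha x hr hr1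
  have hint : ∀ (b : ℝ) (m : ℕ), IntervalIntegrable
      (fun η => laguerreIntegrand b m x (laguerreCircle (1 / 2) η)) MeasureTheory.volume
      (-Real.pi) Real.pi := fun b m =>
    (continuous_laguerreIntegrand_circle hr hr1 b m x).intervalIntegrable _ _
  have h := intervalIntegral.integral_eq_sub_of_hasDerivAt
    (fun η _ => hasDerivAt_laguerreIntegrand_circle hr hr1 (n + 1 + a) n x η)
    (((((hint _ _).const_mul _).sub ((hint _ _).const_mul _)).add
      ((hint _ _).const_mul _)).const_mul _) (a := -Real.pi) (b := Real.pi)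
  rw [laguerreCircle_pi, laguerreCircle_neg_pi, sub_self, intervalIntegral.integral_const_mul,
    intervalIntegral.integral_add (((hint _ _).const_mul _).sub ((hint _ _).const_mul _))
      ((hint _ _).const_mul _),
    intervalIntegral.integral_sub ((hint _ _).const_mul _) ((hint _ _).const_mul _),
    intervalIntegral.integral_const_mul, intervalIntegral.integral_const_mul,
    intervalIntegral.integral_const_mul, mul_eq_zero, or_iff_right Complex.I_ne_zero] at h
  rw [show (n : ℝ) + 1 + a + 1 = (n + 2 : ℕ) + a by push_cast; ring,
    show (n : ℝ) + 1 + a - 1 = n + a by ring,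
    show (n : ℝ) + 1 + a = (n + 1 : ℕ) + a by push_cast; ring] at h
  have : (((n + 2) * laguerreL (n + 2) a x : ℝ) : ℂ)
      = ((2 * n + 3 + a - x) * laguerreL (n + 1) a x - (n + 1 + a) * laguerreL n a x : ℝ) := by
    push_cast
    rw [e0, e1, e2]
    push_cast at h ⊢
    linear_combination (1 / (2 * Real.pi) : ℂ) * h
  exact_mod_cast this

lemma laguerreL_zero {a : ℝ} (ha : 0 ≤ a) (x : ℝ) : laguerreL 0 a x = 1 := by
  have : Real.Gamma (a + 1) ≠ 0 := (Real.Gamma_pos_of_pos (by linarith)).ne'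
  simp [laguerreL, this]

lemma laguerreL_one {a : ℝ} (ha : 0 ≤ a) (x : ℝ) : laguerreL 1 a x = 1 + a - x := by
  have h : Real.Gamma (a + 1) ≠ 0 := (Real.Gamma_pos_of_pos (by linarith)).ne'
  have h2 : Real.Gamma (1 + a + 1) = (1 + a) * Real.Gamma (a + 1) := by
    rw [Real.Gamma_add_one (by linarith), add_comm a 1]
  have h3 : Real.Gamma (1 + a + 1) ≠ 0 := (Real.Gamma_pos_of_pos (by linarith)).ne'
  simp only [laguerreL, Finset.sum_range_succ, Finset.range_one, Finset.sum_singleton]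
  norm_num
  rw [div_self h3, h2, mul_div_cancel_right₀ _ h]
  ring

/-- The Christoffel–Darboux formula for the Laguerre weight. -/
lemma laguerre_christoffel_darboux (n : ℕ) {a : ℝ} (ha : 0 ≤ a) (x y : ℝ) :
    (x - y) * ∑ k ∈ Finset.range (n + 1),
        laguerreMonic k a x * laguerreMonic k a y / laguerreNormSq k a
      = -((n + 1).factorial / Real.Gamma (n + 1 + a))
        * (laguerreL (n + 1) a x * laguerreL n a y - laguerreL n a x * laguerreL (n + 1) a y) := by
  have hterm : ∀ k : ℕ, laguerreMonic k a x * laguerreMonic k a y / laguerreNormSq k a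
      = k.factorial / Real.Gamma (k + 1 + a) * (laguerreL k a x * laguerreL k a y) := by
    intro k
    have f : (k.factorial : ℝ) ≠ 0 := by exact_mod_cast k.factorial_ne_zero
    have s : ((-1 : ℝ) ^ k) * (-1) ^ k = 1 := by rw [← mul_pow]; norm_num
    unfold laguerreMonic laguerreNormSq
    rw [show a + k + 1 = k + 1 + a by ring]
    field_simp
    linear_combination (laguerreL k a x * laguerreL k a y) * s
  simp only [hterm]
  induction n with
  | zero =>
    simp only [zero_add, Finset.sum_range_one, laguerreL_zero ha, laguerreL_one ha,
      Nat.factorial, Nat.cast_zero]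
    push_cast
    ring
  | succ n ih =>
    rw [Finset.sum_range_succ, mul_add, ih]
    have r1 := laguerreL_recurrence n ha x
    have r2 := laguerreL_recurrence n ha y
    have hpos : (0 : ℝ) < n + 1 + a := by positivity
    have hG : Real.Gamma ((n + 1 : ℕ) + 1 + a) = (n + 1 + a) * Real.Gamma (n + 1 + a) := by
      rw [← Real.Gamma_add_one hpos.ne']
      congr 1
      push_cast
      ring
    have hG0 : Real.Gamma (n + 1 + a) ≠ 0 := (Real.Gamma_pos_of_pos hpos).ne'
    rw [hG, Nat.factorial_succ (n + 1)]
    push_cast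
    field_simp
    linear_combination (laguerreL (n + 1) a y) * r1 - (laguerreL (n + 1) a x) * r2

/-! ### Expansions to second order in a small parameter -/

/-- A domain with a parameter `eps` and a weight `wt`, for estimates of the form
`C * eps ^ k * wt ^ m` with an unspecified constant `C` and an unspecified power `m`. The condition
`eps ≤ wt` lets surplus powers of `eps` be traded for powers of `wt`. -/
structure AsymScale (ι : Type*) where
  /-- The domain of validity of the estimates. -/
  dom : Set ι
  /-- The small parameter. -/
  eps : ι → ℝ
  /-- The weight, of which an arbitrary power may be lost. -/
  wt : ι → ℝ
  eps_nonneg : ∀ i ∈ dom, 0 ≤ eps i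
  eps_le_wt : ∀ i ∈ dom, eps i ≤ wt i
  one_le_wt : ∀ i ∈ dom, 1 ≤ wt i

namespace AsymScale

variable {ι : Type*} {σ : AsymScale ι}

/-- `F = O(eps ^ k)` up to a power of the weight. -/
def Bdd (σ : AsymScale ι) (k : ℕ) (F : ι → ℂ) : Prop :=
  ∃ (C : ℝ) (m : ℕ), 0 ≤ C ∧ ∀ i ∈ σ.dom, ‖F i‖ ≤ C * σ.eps i ^ k * σ.wt i ^ m

lemma Bdd.add {k : ℕ} {F G : ι → ℂ} (hF : σ.Bdd k F) (hG : σ.Bdd k G) :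
    σ.Bdd k (fun i => F i + G i) := by
  obtain ⟨C, m, hC, h⟩ := hF
  obtain ⟨D, n, hD, h'⟩ := hG
  refine ⟨C + D, m + n, by positivity, fun i hi => ?_⟩
  have he := σ.eps_nonneg i hi
  have hw := σ.one_le_wt i hi
  have h1 : σ.wt i ^ m ≤ σ.wt i ^ (m + n) := pow_le_pow_right₀ hw (by omega)
  have h2 : σ.wt i ^ n ≤ σ.wt i ^ (m + n) := pow_le_pow_right₀ hw (by omega)
  calc _ ≤ ‖F i‖ + ‖G i‖ := norm_add_le _ _
    _ ≤ C * σ.eps i ^ k * σ.wt i ^ (m + n) + D * σ.eps i ^ k * σ.wt i ^ (m + n) :=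
      add_le_add ((h i hi).trans (by gcongr)) ((h' i hi).trans (by gcongr))
    _ = _ := by ring

lemma Bdd.neg {k : ℕ} {F : ι → ℂ} (hF : σ.Bdd k F) : σ.Bdd k (fun i => -F i) := by
  simpa only [Bdd, norm_neg] using hF

lemma Bdd.sub {k : ℕ} {F G : ι → ℂ} (hF : σ.Bdd k F) (hG : σ.Bdd k G) :
    σ.Bdd k (fun i => F i - G i) := by
  simpa only [sub_eq_add_neg] using hF.add hG.neg

lemma Bdd.mul {k l : ℕ} {F G : ι → ℂ} (hF : σ.Bdd k F) (hG : σ.Bdd l G) :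
    σ.Bdd (k + l) (fun i => F i * G i) := by
  obtain ⟨C, m, hC, h⟩ := hF
  obtain ⟨D, n, hD, h'⟩ := hG
  refine ⟨C * D, m + n, by positivity, fun i hi => ?_⟩
  rw [norm_mul]
  have he := σ.eps_nonneg i hi
  have hw := σ.one_le_wt i hi
  calc _ ≤ (C * σ.eps i ^ k * σ.wt i ^ m) * (D * σ.eps i ^ l * σ.wt i ^ n) :=
        mul_le_mul (h i hi) (h' i hi) (norm_nonneg _) (by positivity)
    _ = _ := by ring

lemma Bdd.mono {k l : ℕ} {F : ι → ℂ} (hF : σ.Bdd k F) (hl : l ≤ k) : σ.Bdd l F := by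
  obtain ⟨C, m, hC, h⟩ := hF
  refine ⟨C, (k - l) + m, hC, fun i hi => (h i hi).trans ?_⟩
  have he := σ.eps_nonneg i hi
  have hw := σ.one_le_wt i hi
  have h1 : σ.eps i ^ (k - l) ≤ σ.wt i ^ (k - l) := pow_le_pow_left₀ he (σ.eps_le_wt i hi) _
  calc _ = C * σ.eps i ^ l * (σ.eps i ^ (k - l) * σ.wt i ^ m) := by
        rw [← Nat.sub_add_cancel hl, pow_add, Nat.add_sub_cancel]; ring
    _ ≤ C * σ.eps i ^ l * (σ.wt i ^ (k - l) * σ.wt i ^ m) := by gcongr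
    _ = _ := by rw [pow_add]

lemma Bdd.of_norm_le {F : ι → ℂ} {C : ℝ} (h : ∀ i ∈ σ.dom, ‖F i‖ ≤ C) : σ.Bdd 0 F :=
  ⟨|C|, 0, abs_nonneg _, fun i hi => by simpa using (h i hi).trans (le_abs_self C)⟩

lemma Bdd.const (σ : AsymScale ι) (c : ℂ) : σ.Bdd 0 (fun _ => c) :=
  Bdd.of_norm_le fun _ _ => le_rfl

lemma Bdd.const_mul {k : ℕ} {F : ι → ℂ} (c : ℂ) (hF : σ.Bdd k F) :
    σ.Bdd k (fun i => c * F i) := by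
  simpa using (Bdd.const σ c).mul hF

lemma Bdd.div_const {k : ℕ} {F : ι → ℂ} (hF : σ.Bdd k F) (c : ℂ) :
    σ.Bdd k (fun i => F i / c) := by
  simpa only [div_eq_inv_mul] using hF.const_mul c⁻¹

lemma Bdd.pow {k : ℕ} {F : ι → ℂ} (hF : σ.Bdd k F) (n : ℕ) : σ.Bdd (n * k) (fun i => F i ^ n) := by
  induction n with
  | zero => simpa using Bdd.const σ 1
  | succ n ih => simpa only [pow_succ, Nat.succ_mul] using ih.mul hF

lemma Bdd.eps (σ : AsymScale ι) : σ.Bdd 1 (fun i => (σ.eps i : ℂ)) :=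
  ⟨1, 0, zero_le_one, fun i hi => by simp [abs_of_nonneg (σ.eps_nonneg i hi)]⟩

lemma Bdd.congr {k : ℕ} {F G : ι → ℂ} (hF : σ.Bdd k F) (h : ∀ i ∈ σ.dom, G i = F i) :
    σ.Bdd k G := by
  obtain ⟨C, m, hC, hb⟩ := hF
  exact ⟨C, m, hC, fun i hi => by rw [h i hi]; exact hb i hi⟩

lemma Bdd.div_eps_pow {k : ℕ} (l : ℕ) {F : ι → ℂ} (hF : σ.Bdd (k + l) F) :
    σ.Bdd k (fun i => F i / (σ.eps i : ℂ) ^ l) := by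
  obtain ⟨C, m, hC, h⟩ := hF
  refine ⟨C, m, hC, fun i hi => ?_⟩
  have he := σ.eps_nonneg i hi
  have hw := σ.one_le_wt i hi
  rw [norm_div, norm_pow, Complex.norm_real, Real.norm_of_nonneg he]
  refine div_le_of_le_mul₀ (by positivity) (by positivity) ((h i hi).trans_eq ?_)
  ring

/-- Pullback of an estimate along a map that is compatible with the scales. -/
lemma Bdd.comp {κ : Type*} {τ : AsymScale κ} {k : ℕ} {F : ι → ℂ} (hF : σ.Bdd k F) (φ : κ → ι)
    (hφ : ∀ j ∈ τ.dom, φ j ∈ σ.dom) (c : ℝ)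
    (he : ∀ j ∈ τ.dom, σ.eps (φ j) ≤ c * τ.eps j * τ.wt j)
    (hw : ∀ j ∈ τ.dom, σ.wt (φ j) ≤ c * τ.wt j) :
    τ.Bdd k (fun j => F (φ j)) := by
  obtain ⟨C, m, hC, h⟩ := hF
  refine ⟨C * |c| ^ k * |c| ^ m, k + m, by positivity, fun j hj => (h _ (hφ j hj)).trans ?_⟩
  have he0 := τ.eps_nonneg j hj
  have hw0 := τ.one_le_wt j hj
  have he1 := σ.eps_nonneg _ (hφ j hj)
  have hw1 := σ.one_le_wt _ (hφ j hj)
  have h1 : σ.eps (φ j) ≤ |c| * τ.eps j * τ.wt j := (he j hj).trans (by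
    gcongr; exact le_abs_self c)
  have h2 : σ.wt (φ j) ≤ |c| * τ.wt j := (hw j hj).trans (by gcongr; exact le_abs_self c)
  calc _ ≤ C * (|c| * τ.eps j * τ.wt j) ^ k * (|c| * τ.wt j) ^ m := by gcongr
    _ = _ := by rw [pow_add]; ring

/-- `F = a₀ + eps a₁ + eps² a₂ + O(eps³)` with coefficients `O(1)`, up to powers of the weight. -/
structure Exp2 (σ : AsymScale ι) (F a₀ a₁ a₂ : ι → ℂ) : Prop where
  bdd₀ : σ.Bdd 0 a₀
  bdd₁ : σ.Bdd 0 a₁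
  bdd₂ : σ.Bdd 0 a₂
  rem : σ.Bdd 3 (fun i => F i - (a₀ i + σ.eps i * a₁ i + σ.eps i ^ 2 * a₂ i))

variable {F G a₀ a₁ a₂ b₀ b₁ b₂ : ι → ℂ}

/-- The polynomial in `eps` formed by three bounded coefficients is its own expansion. -/
lemma Exp2.of_bdd (h₀ : σ.Bdd 0 a₀) (h₁ : σ.Bdd 0 a₁) (h₂ : σ.Bdd 0 a₂) :
    σ.Exp2 (fun i => a₀ i + σ.eps i * a₁ i + σ.eps i ^ 2 * a₂ i) a₀ a₁ a₂ :=
  ⟨h₀, h₁, h₂, ⟨0, 0, le_rfl, fun i _ => by simp⟩⟩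

lemma Bdd.exp2 (h : σ.Bdd 0 F) : σ.Exp2 F F (fun _ => 0) (fun _ => 0) :=
  ⟨h, Bdd.const σ 0, Bdd.const σ 0, ⟨0, 0, le_rfl, fun i _ => by simp⟩⟩

lemma Exp2.const (σ : AsymScale ι) (c : ℂ) :
    σ.Exp2 (fun _ => c) (fun _ => c) (fun _ => 0) (fun _ => 0) := (Bdd.const σ c).exp2

lemma Exp2.congr {F' a₀' a₁' a₂' : ι → ℂ} (h : σ.Exp2 F a₀ a₁ a₂)
    (hF : ∀ i ∈ σ.dom, F' i = F i) (h₀ : ∀ i ∈ σ.dom, a₀' i = a₀ i)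
    (h₁ : ∀ i ∈ σ.dom, a₁' i = a₁ i) (h₂ : ∀ i ∈ σ.dom, a₂' i = a₂ i) :
    σ.Exp2 F' a₀' a₁' a₂' :=
  ⟨h.bdd₀.congr h₀, h.bdd₁.congr h₁, h.bdd₂.congr h₂,
    h.rem.congr fun i hi => by rw [hF i hi, h₀ i hi, h₁ i hi, h₂ i hi]⟩

lemma Exp2.sub (hF : σ.Exp2 F a₀ a₁ a₂) (hG : σ.Exp2 G b₀ b₁ b₂) :
    σ.Exp2 (fun i => F i - G i) (fun i => a₀ i - b₀ i) (fun i => a₁ i - b₁ i)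
      (fun i => a₂ i - b₂ i) :=
  ⟨hF.bdd₀.sub hG.bdd₀, hF.bdd₁.sub hG.bdd₁, hF.bdd₂.sub hG.bdd₂,
    (hF.rem.sub hG.rem).congr fun i _ => by ring⟩

lemma Exp2.bdd (hF : σ.Exp2 F a₀ a₁ a₂) : σ.Bdd 0 F := by
  have h1 := ((Bdd.eps σ).mul hF.bdd₁).mono (Nat.zero_le _)
  have h2 := (((Bdd.eps σ).pow 2).mul hF.bdd₂).mono (Nat.zero_le _)
  refine (((hF.rem.mono (Nat.zero_le _)).add hF.bdd₀).add (h1.add h2)).congr fun i _ => ?_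
  ring

lemma Exp2.mul (hF : σ.Exp2 F a₀ a₁ a₂) (hG : σ.Exp2 G b₀ b₁ b₂) :
    σ.Exp2 (fun i => F i * G i) (fun i => a₀ i * b₀ i) (fun i => a₀ i * b₁ i + a₁ i * b₀ i)
      (fun i => a₀ i * b₂ i + a₁ i * b₁ i + a₂ i * b₀ i) := by
  refine ⟨by simpa using hF.bdd₀.mul hG.bdd₀,
    by simpa using (hF.bdd₀.mul hG.bdd₁).add (hF.bdd₁.mul hG.bdd₀),
    by simpa using ((hF.bdd₀.mul hG.bdd₂).add (hF.bdd₁.mul hG.bdd₁)).add (hF.bdd₂.mul hG.bdd₀), ?_⟩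
  have e3 := (Bdd.eps σ).pow 3
  have e4 := ((Bdd.eps σ).pow 4).mono (show 3 ≤ 4 * 1 by norm_num)
  have t1 := hF.rem.mul hG.bdd
  have t2 := (Exp2.of_bdd hF.bdd₀ hF.bdd₁ hF.bdd₂).bdd.mul hG.rem
  have t3 := e3.mul ((hF.bdd₁.mul hG.bdd₂).add (hF.bdd₂.mul hG.bdd₁))
  have t4 := e4.mul (hF.bdd₂.mul hG.bdd₂)
  simp only [add_zero, zero_add, mul_one] at t1 t2 t3 t4
  refine ((t1.add t2).add (t3.add t4)).congr fun i _ => ?_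
  ring

end AsymScale

/-- The mean value inequality on the segment from `0` to `z`. -/
lemma norm_le_of_norm_deriv_le_segment {h h' : ℂ → ℂ} {z : ℂ} {C : ℝ} (h0 : h 0 = 0)
    (hd : ∀ τ ∈ Set.Icc (0 : ℝ) 1, HasDerivAt h (h' (τ * z)) (τ * z))
    (hb : ∀ τ ∈ Set.Icc (0 : ℝ) 1, ‖h' (τ * z)‖ ≤ C) : ‖h z‖ ≤ C * ‖z‖ := by
  have hs : ∀ w ∈ segment ℝ 0 z, ∃ τ ∈ Set.Icc (0 : ℝ) 1, w = τ * z := by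
    intro w hw
    rw [segment_eq_image] at hw
    obtain ⟨τ, hτ, rfl⟩ := hw
    exact ⟨τ, hτ, by simp⟩
  have := (convex_segment (0 : ℂ) z).norm_image_sub_le_of_norm_hasDerivWithin_le (f := h)
    (f' := h') (C := C) (fun w hw => by
      obtain ⟨τ, hτ, rfl⟩ := hs w hw
      exact (hd τ hτ).hasDerivWithinAt) (fun w hw => by
      obtain ⟨τ, hτ, rfl⟩ := hs w hw
      exact hb τ hτ) (left_mem_segment ℝ 0 z) (right_mem_segment ℝ 0 z)
  simpa [h0] using this

open Complex in
/-- Taylor's formula for `exp`, with a remainder controlled by the values of `exp` at the end points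
only; for `Re z < 0` this is much better than a bound by `exp ‖z‖`. -/
lemma norm_exp_sub_taylor_two_le (z : ℂ) :
    ‖exp z - 1 - z - z ^ 2 / 2‖ ≤ max 1 ‖exp z‖ * ‖z‖ ^ 3 := by
  have hmax : ∀ (z : ℂ), ∀ τ ∈ Set.Icc (0 : ℝ) 1, max 1 ‖exp (τ * z)‖ ≤ max 1 ‖exp z‖ := by
    intro z τ hτ
    refine max_le (le_max_left _ _) ?_
    rw [norm_exp, norm_exp, re_ofReal_mul]
    rcases le_total z.re 0 with h | h
    · refine le_max_of_le_left (Real.exp_le_one_iff.2 (mul_nonpos_of_nonneg_of_nonpos hτ.1 h))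
    · refine le_max_of_le_right (Real.exp_le_exp.2 (mul_le_of_le_one_left h hτ.2))
  have hn : ∀ (z : ℂ), ∀ τ ∈ Set.Icc (0 : ℝ) 1, ‖(τ : ℂ) * z‖ ≤ ‖z‖ := by
    intro z τ hτ
    rw [norm_mul, norm_real, Real.norm_of_nonneg hτ.1]
    exact mul_le_of_le_one_left (norm_nonneg _) hτ.2
  have h1 : ∀ z : ℂ, ‖exp z - 1‖ ≤ max 1 ‖exp z‖ * ‖z‖ := fun z =>
    norm_le_of_norm_deriv_le_segment (h := fun z => exp z - 1) (h' := exp) (by simp)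
      (fun τ _ => (hasDerivAt_exp _).sub_const 1)
      fun τ hτ => (le_max_right _ _).trans (hmax z τ hτ)
  have h2 : ∀ z : ℂ, ‖exp z - 1 - z‖ ≤ max 1 ‖exp z‖ * ‖z‖ * ‖z‖ := fun z =>
    norm_le_of_norm_deriv_le_segment (h := fun z => exp z - 1 - z) (h' := fun z => exp z - 1)
      (by simp) (fun τ _ => ((hasDerivAt_exp _).sub_const 1).sub (hasDerivAt_id _))
      fun τ hτ => (h1 _).trans (mul_le_mul (hmax z τ hτ) (hn z τ hτ) (norm_nonneg _)
        (by positivity))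
  have h3 := norm_le_of_norm_deriv_le_segment (z := z) (h := fun z => exp z - 1 - z - z ^ 2 / 2)
      (h' := fun z => exp z - 1 - z) (C := max 1 ‖exp z‖ * ‖z‖ * ‖z‖)
      (by simp) (fun τ _ => by
        have h := (((hasDerivAt_exp ((τ : ℂ) * z)).sub_const 1).sub (hasDerivAt_id _)).sub
          ((hasDerivAt_pow 2 ((τ : ℂ) * z)).div_const 2)
        exact h.congr_deriv (by simp))
      fun τ hτ => (h2 _).trans (mul_le_mul (mul_le_mul (hmax z τ hτ) (hn z τ hτ) (norm_nonneg _)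
        (by positivity)) (hn z τ hτ) (norm_nonneg _) (by positivity))
  exact h3.trans_eq (by ring)

namespace AsymScale

variable {ι : Type*} {σ : AsymScale ι} {F a₁ a₂ : ι → ℂ}

/-- The exponential of a small expansion; the error is relative to the larger one of `1` and
`‖exp F‖`. -/
lemma Exp2.exists_norm_exp_sub_le (hF : σ.Exp2 F (fun _ => 0) a₁ a₂) :
    ∃ (C : ℝ) (m : ℕ), 0 ≤ C ∧ ∀ i ∈ σ.dom,
      ‖Complex.exp (F i) - (1 + σ.eps i * a₁ i + σ.eps i ^ 2 * (a₂ i + a₁ i ^ 2 / 2))‖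
        ≤ C * σ.eps i ^ 3 * σ.wt i ^ m * max 1 ‖Complex.exp (F i)‖ := by
  have hF1 : σ.Bdd 1 F := by
    have h1 := (Bdd.eps σ).mul hF.bdd₁
    have h2 := (((Bdd.eps σ).pow 2).mul hF.bdd₂).mono (show 1 ≤ 2 * 1 + 0 by norm_num)
    refine ((hF.rem.mono (show 1 ≤ 3 by norm_num)).add (h1.add h2)).congr fun i _ => ?_
    ring
  have hrem := (hF.mul hF).rem.div_const 2
  have hlin := hrem.add hF.rem
  obtain ⟨C, m, hC, h⟩ := hlin
  obtain ⟨D, n, hD, h'⟩ := hF1.pow 3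
  refine ⟨C + D, m + n, by positivity, fun i hi => ?_⟩
  have he := σ.eps_nonneg i hi
  have hw := σ.one_le_wt i hi
  have h1 : σ.wt i ^ m ≤ σ.wt i ^ (m + n) := pow_le_pow_right₀ hw (by omega)
  have h2 : σ.wt i ^ n ≤ σ.wt i ^ (m + n) := pow_le_pow_right₀ hw (by omega)
  set M := max 1 ‖Complex.exp (F i)‖ with hM
  have hM1 : 1 ≤ M := le_max_left _ _
  have hT := norm_exp_sub_taylor_two_le (F i)
  have hc := h' i hi
  rw [norm_pow, mul_one] at hc
  calc _ = ‖(Complex.exp (F i) - 1 - F i - F i ^ 2 / 2)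
          + ((F i * F i - (0 * 0 + σ.eps i * (0 * a₁ i + a₁ i * 0)
            + σ.eps i ^ 2 * (0 * a₂ i + a₁ i * a₁ i + a₂ i * 0))) / 2
          + (F i - (0 + σ.eps i * a₁ i + σ.eps i ^ 2 * a₂ i)))‖ := by congr 1; ring
    _ ≤ M * ‖F i‖ ^ 3 + C * σ.eps i ^ 3 * σ.wt i ^ m := (norm_add_le _ _).trans
        (add_le_add hT (h i hi))
    _ ≤ M * (D * σ.eps i ^ 3 * σ.wt i ^ (m + n)) + C * σ.eps i ^ 3 * σ.wt i ^ (m + n) * M := by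
        refine add_le_add ?_ ?_
        · exact mul_le_mul_of_nonneg_left (hc.trans (by gcongr)) (by positivity)
        · have hx : C * σ.eps i ^ 3 * σ.wt i ^ m ≤ C * σ.eps i ^ 3 * σ.wt i ^ (m + n) := by gcongr
          exact hx.trans (le_mul_of_one_le_right (by positivity) hM1)
    _ = _ := by ring

/-- The exponential of a small expansion whose real part is bounded above. -/
lemma Exp2.cexp (hF : σ.Exp2 F (fun _ => 0) a₁ a₂) {K : ℝ}
    (hK : ∀ i ∈ σ.dom, ‖Complex.exp (F i)‖ ≤ K) :
    σ.Exp2 (fun i => Complex.exp (F i)) (fun _ => 1) a₁ (fun i => a₂ i + a₁ i ^ 2 / 2) := by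
  obtain ⟨C, m, hC, h⟩ := hF.exists_norm_exp_sub_le
  refine ⟨Bdd.const σ 1, hF.bdd₁, hF.bdd₂.add ((hF.bdd₁.pow 2).div_const 2),
    ⟨C * max 1 K, m, by positivity, fun i hi => (h i hi).trans ?_⟩⟩
  have he := σ.eps_nonneg i hi
  have hw := σ.one_le_wt i hi
  have : max 1 ‖Complex.exp (F i)‖ ≤ max 1 K := max_le_max le_rfl (hK i hi)
  calc _ ≤ C * σ.eps i ^ 3 * σ.wt i ^ m * max 1 K := by gcongr
    _ = _ := by ring

end AsymScale

/-! ### The phase function at the double saddle point -/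

/-- The closed right half-plane with `eps = ‖z‖`, so that `Bdd k` means a zero of order `k` at the
origin together with polynomial growth. -/
noncomputable def halfPlaneScale : AsymScale ℂ where
  dom := {z | 0 ≤ z.re}
  eps z := ‖z‖
  wt z := 1 + ‖z‖
  eps_nonneg _ _ := norm_nonneg _
  eps_le_wt _ _ := by linarith
  one_le_wt z _ := by linarith [norm_nonneg z]

open AsymScale

lemma halfPlaneScale_bdd_of_deriv {h h' : ℂ → ℂ} {k : ℕ} (h0 : h 0 = 0)
    (hd : ∀ z : ℂ, 0 ≤ z.re → HasDerivAt h (h' z) z) (hb : halfPlaneScale.Bdd k h') :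
    halfPlaneScale.Bdd (k + 1) h := by
  obtain ⟨C, m, hC, hb⟩ := hb
  refine ⟨C, m, hC, fun z hz => ?_⟩
  have hz' : 0 ≤ z.re := hz
  have hre : ∀ τ ∈ Set.Icc (0 : ℝ) 1, 0 ≤ ((τ : ℂ) * z).re := fun τ hτ => by
    rw [Complex.re_ofReal_mul]; exact mul_nonneg hτ.1 hz'
  have h := norm_le_of_norm_deriv_le_segment (z := z) (C := C * ‖z‖ ^ k * (1 + ‖z‖) ^ m) h0
    (fun τ hτ => hd _ (hre τ hτ)) fun τ hτ => (hb _ (hre τ hτ)).trans (by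
      have hn : ‖(τ : ℂ) * z‖ ≤ ‖z‖ := by
        rw [norm_mul, Complex.norm_real, Real.norm_of_nonneg hτ.1]
        exact mul_le_of_le_one_left (norm_nonneg _) hτ.2
      simp only [halfPlaneScale]
      gcongr)
  refine h.trans_eq ?_
  simp only [halfPlaneScale]
  ring

lemma halfPlaneScale_bdd_id : halfPlaneScale.Bdd 1 (fun z => z) :=
  ⟨1, 0, zero_le_one, fun z _ => by simp [halfPlaneScale]⟩

open Complex in
lemma hasDerivAt_exp_neg (z : ℂ) : HasDerivAt (fun z => exp (-z)) (-exp (-z)) z :=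
  (hasDerivAt_neg z).cexp.congr_deriv (by ring)

open Complex in
lemma halfPlaneScale_bdd_exp_zero : halfPlaneScale.Bdd 0 (fun z => exp (-z)) :=
  Bdd.of_norm_le (C := 1) fun z hz => by
    rw [norm_exp, neg_re]
    exact Real.exp_le_one_iff.2 (neg_nonpos.2 hz)

open Complex in
lemma halfPlaneScale_bdd_exp_one : halfPlaneScale.Bdd 1 (fun z => exp (-z) - 1) :=
  halfPlaneScale_bdd_of_deriv (by simp) (fun z _ => (hasDerivAt_exp_neg z).sub_const 1)
    halfPlaneScale_bdd_exp_zero.neg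

open Complex in
lemma halfPlaneScale_bdd_exp_two : halfPlaneScale.Bdd 2 (fun z => exp (-z) - 1 + z) :=
  halfPlaneScale_bdd_of_deriv (h' := fun z => -(exp (-z) - 1)) (by simp)
    (fun z _ => (((hasDerivAt_exp_neg z).sub_const 1).add (hasDerivAt_id z)).congr_deriv (by ring))
    halfPlaneScale_bdd_exp_one.neg

open Complex in
lemma halfPlaneScale_bdd_exp_three :
    halfPlaneScale.Bdd 3 (fun z => exp (-z) - 1 + z - z ^ 2 / 2) :=
  halfPlaneScale_bdd_of_deriv (h' := fun z => -(exp (-z) - 1 + z)) (by simp)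
    (fun z _ => ((((hasDerivAt_exp_neg z).sub_const 1).add (hasDerivAt_id z)).sub
      ((hasDerivAt_pow 2 z).div_const 2)).congr_deriv (by simp; ring))
    halfPlaneScale_bdd_exp_two.neg

open Complex in
lemma halfPlaneScale_bdd_exp_four :
    halfPlaneScale.Bdd 4 (fun z => exp (-z) - 1 + z - z ^ 2 / 2 + z ^ 3 / 6) :=
  halfPlaneScale_bdd_of_deriv (h' := fun z => -(exp (-z) - 1 + z - z ^ 2 / 2)) (by simp)
    (fun z _ => (((((hasDerivAt_exp_neg z).sub_const 1).add (hasDerivAt_id z)).sub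
      ((hasDerivAt_pow 2 z).div_const 2)).add
      ((hasDerivAt_pow 3 z).div_const 6)).congr_deriv (by simp; ring))
    halfPlaneScale_bdd_exp_three.neg

/-- The parameters of the soft edge. In terms of `s = √(1 + α)` they are `p = 1 / (s + 1)`,
`q = s / (s + 1)` and `lam = q ^ (1/3)`; the saddle point of the generating integrand is at
`u = -p`. -/
structure EdgeParam where
  /-- Minus the position of the double saddle point. -/
  p : ℝ
  /-- The distance of the saddle point from the branch point. -/
  q : ℝ
  /-- The cube root of `q`, which normalises the cubic term of the phase. -/
  lam : ℝ
  p_pos : 0 < p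
  p_le_q : p ≤ q
  p_add_q : p + q = 1
  lam_pos : 0 < lam
  lam_cube : lam ^ 3 = q

namespace EdgeParam

variable (e : EdgeParam)

lemma q_pos : 0 < e.q := e.p_pos.trans_le e.p_le_q

lemma p_lt_one : e.p < 1 := by linarith [e.p_add_q, e.q_pos]

lemma p_le_half : e.p ≤ 1 / 2 := by linarith [e.p_add_q, e.p_le_q]

lemma half_le_q : 1 / 2 ≤ e.q := by linarith [e.p_add_q, e.p_le_q]

lemma q_lt_one : e.q < 1 := by linarith [e.p_add_q, e.p_pos]

lemma lam_lt_one : e.lam < 1 := by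
  by_contra h
  have := one_le_pow₀ (not_lt.1 h) (n := 3)
  linarith [e.lam_cube, e.q_lt_one]

open Complex

/-- `log ((1 - p e^{-z}) / q)`, the logarithm of `1 + u` relative to its value at the saddle
point. -/
noncomputable def logRatio (z : ℂ) : ℂ := log (1 - e.p * exp (-z)) - log e.q

/-- The phase `N⁻¹ log (e^{-xu} (1+u)^b u^{-N})` with `x = N / p²` and `b = N q² / p²`, relative to
its value at the saddle point, in the coordinate `u = -p e^{-z}`. -/
noncomputable def phase (z : ℂ) : ℂ :=
  (exp (-z) - 1) / e.p + (e.q ^ 2 / e.p ^ 2) * e.logRatio z + z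

lemma norm_p_mul_exp_le {z : ℂ} (hz : 0 ≤ z.re) : ‖(e.p : ℂ) * exp (-z)‖ ≤ 1 / 2 := by
  rw [norm_mul, norm_real, Real.norm_of_nonneg e.p_pos.le, norm_exp, neg_re]
  have : Real.exp (-z.re) ≤ 1 := Real.exp_le_one_iff.2 (neg_nonpos.2 hz)
  nlinarith [e.p_le_half, e.p_pos, Real.exp_pos (-z.re)]

lemma one_sub_mem {z : ℂ} (hz : 0 ≤ z.re) : 1 - e.p * exp (-z) ∈ slitPlane := by
  rw [sub_eq_add_neg]
  refine mem_slitPlane_of_norm_lt_one ?_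
  rw [norm_neg]
  exact (e.norm_p_mul_exp_le hz).trans_lt (by norm_num)

lemma one_sub_ne_zero {z : ℂ} (hz : 0 ≤ z.re) : 1 - (e.p : ℂ) * exp (-z) ≠ 0 :=
  slitPlane_ne_zero (e.one_sub_mem hz)

lemma half_le_norm_one_sub {z : ℂ} (hz : 0 ≤ z.re) : 1 / 2 ≤ ‖1 - (e.p : ℂ) * exp (-z)‖ := by
  have h1 := norm_sub_norm_le (1 : ℂ) (e.p * exp (-z))
  rw [norm_one] at h1
  linarith [e.norm_p_mul_exp_le hz]

lemma bdd_inv_one_sub : halfPlaneScale.Bdd 0 (fun z => (1 - (e.p : ℂ) * exp (-z))⁻¹) :=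
  Bdd.of_norm_le (C := 2) fun z hz => by
    rw [norm_inv]
    exact inv_le_of_inv_le₀ (by norm_num) (by simpa using e.half_le_norm_one_sub hz)

lemma hasDerivAt_logRatio {z : ℂ} (hz : 0 ≤ z.re) :
    HasDerivAt e.logRatio (e.p * exp (-z) * (1 - e.p * exp (-z))⁻¹) z := by
  have h := ((((hasDerivAt_exp_neg z).const_mul (e.p : ℂ)).const_sub 1).clog
    (e.one_sub_mem hz)).sub_const (log e.q)
  exact h.congr_deriv (by rw [div_eq_mul_inv]; ring)

lemma q_eq : (e.q : ℂ) = 1 - e.p := by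
  rw [eq_sub_iff_add_eq', ← ofReal_add, e.p_add_q, ofReal_one]

lemma p_ne : (e.p : ℂ) ≠ 0 := ofReal_ne_zero.2 e.p_pos.ne'

lemma q_ne : (e.q : ℂ) ≠ 0 := ofReal_ne_zero.2 e.q_pos.ne'

lemma lam_ne : (e.lam : ℂ) ≠ 0 := ofReal_ne_zero.2 e.lam_pos.ne'

lemma lam_cube' : (e.lam : ℂ) ^ 3 = e.q := by rw [← ofReal_pow, e.lam_cube]

lemma logRatio_zero : e.logRatio 0 = 0 := by
  simp [logRatio, e.q_eq]

/-- The derivative of the phase has a double zero: the saddle point is degenerate. -/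
lemma hasDerivAt_phase {z : ℂ} (hz : 0 ≤ z.re) :
    HasDerivAt e.phase ((1 - exp (-z)) ^ 2 * (1 - e.p * exp (-z))⁻¹) z := by
  have h := ((((hasDerivAt_exp_neg z).sub_const 1).div_const (e.p : ℂ)).add
    ((e.hasDerivAt_logRatio hz).const_mul ((e.q : ℂ) ^ 2 / e.p ^ 2))).add (hasDerivAt_id z)
  refine h.congr_deriv ?_
  have h1 := e.one_sub_ne_zero hz
  have h2 := e.p_ne
  rw [e.q_eq]
  have hinv := inv_mul_cancel₀ h1
  generalize (1 - (e.p : ℂ) * exp (-z))⁻¹ = Y at hinv ⊢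
  generalize exp (-z) = X at hinv ⊢
  field_simp
  linear_combination (X - e.p) * hinv

/-- The quartic coefficient of the phase, relative to the cubic one. -/
noncomputable def d₁ : ℂ := -1 / e.q

/-- The quintic coefficient of the phase, relative to the cubic one. -/
noncomputable def d₂ : ℂ := 7 / 12 + e.p / (2 * e.q) + e.p / e.q ^ 2

lemma bdd_phase : halfPlaneScale.Bdd 6
    (fun z => e.phase z - (z ^ 3 / 3 + e.d₁ * z ^ 4 / 4 + e.d₂ * z ^ 5 / 5) / e.q) := by
  have hq := e.q_ne
  refine halfPlaneScale_bdd_of_deriv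
    (h' := fun z => (1 - exp (-z)) ^ 2 * (1 - e.p * exp (-z))⁻¹
      - (z ^ 2 + e.d₁ * z ^ 3 + e.d₂ * z ^ 4) / e.q) (by simp [phase, logRatio_zero])
    (fun z hz => ((e.hasDerivAt_phase hz).sub (((((hasDerivAt_pow 3 z).div_const 3).add
      (((hasDerivAt_pow 4 z).const_mul e.d₁).div_const 4)).add
      (((hasDerivAt_pow 5 z).const_mul e.d₂).div_const 5)).div_const (e.q : ℂ))).congr_deriv (by
        push_cast; ring)) ?_
  have hz := halfPlaneScale_bdd_id
  have hX := halfPlaneScale_bdd_exp_zero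
  have hP := (((hz.mono (Nat.zero_le 1)).sub (((hz.pow 2).mono (Nat.zero_le _)).div_const 2)).add
    (((hz.pow 3).mono (Nat.zero_le _)).div_const 6))
  have t1 := halfPlaneScale_bdd_exp_four.mul
    ((halfPlaneScale_bdd_exp_one.neg).add ((hz.sub (((hz.pow 2).mono
      (show 1 ≤ 2 * 1 by norm_num)).div_const 2)).add (((hz.pow 3).mono
      (show 1 ≤ 3 * 1 by norm_num)).div_const 6)))
  have t2 := (hz.pow 5).mul (((Bdd.const halfPlaneScale
    (-1 / 6 - e.d₂ * e.p / e.q + e.d₁ * e.p / (2 * e.q))).add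
    ((hz.mono (Nat.zero_le 1)).const_mul (1 / 36 + e.d₂ * e.p / (2 * e.q)))))
  have t3 := ((hz.pow 2).mul ((Bdd.const halfPlaneScale 1).add
    (((hz.mono (Nat.zero_le 1)).const_mul e.d₁).add
    (((hz.pow 2).mono (Nat.zero_le _)).const_mul e.d₂)))).mul
    (halfPlaneScale_bdd_exp_three.const_mul (e.p / e.q))
  have t := ((t2.sub t1).add t3).mul e.bdd_inv_one_sub
  refine t.congr fun z hz => ?_
  have h1 := e.one_sub_ne_zero hz
  rw [← mul_left_inj' h1]
  have hinv := inv_mul_cancel₀ h1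
  set X := exp (-z)
  set Y := (1 - (e.p : ℂ) * X)⁻¹
  have hp : (e.p : ℂ) = 1 - e.q := by rw [e.q_eq]; ring
  have key : (1 - X) ^ 2 - (z ^ 2 + e.d₁ * z ^ 3 + e.d₂ * z ^ 4) / e.q * (1 - e.p * X)
      = z ^ 5 * (-1 / 6 - e.d₂ * e.p / e.q + e.d₁ * e.p / (2 * e.q)
          + (1 / 36 + e.d₂ * e.p / (2 * e.q)) * z)
        - (X - 1 + z - z ^ 2 / 2 + z ^ 3 / 6) * (-(X - 1) + (z - z ^ 2 / 2 + z ^ 3 / 6))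
        + z ^ 2 * (1 + (e.d₁ * z + e.d₂ * z ^ 2)) * (e.p / e.q * (X - 1 + z - z ^ 2 / 2)) := by
    simp only [d₁, d₂]
    rw [hp]
    field_simp
    ring
  linear_combination key + ((1 - X) ^ 2 - (z ^ 5 * (-1 / 6 - e.d₂ * e.p / e.q
    + e.d₁ * e.p / (2 * e.q) + (1 / 36 + e.d₂ * e.p / (2 * e.q)) * z)
        - (X - 1 + z - z ^ 2 / 2 + z ^ 3 / 6) * (-(X - 1) + (z - z ^ 2 / 2 + z ^ 3 / 6))
        + z ^ 2 * (1 + (e.d₁ * z + e.d₂ * z ^ 2)) * (e.p / e.q * (X - 1 + z - z ^ 2 / 2)))) * hinv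

lemma bdd_logRatio : halfPlaneScale.Bdd 3
    (fun z => e.logRatio z - (e.p / e.q * z - e.p / (2 * e.q ^ 2) * z ^ 2)) := by
  have hq := e.q_ne
  refine halfPlaneScale_bdd_of_deriv
    (h' := fun z => e.p * exp (-z) * (1 - e.p * exp (-z))⁻¹
      - (e.p / e.q - e.p / e.q ^ 2 * z)) (by simp [logRatio_zero])
    (fun z hz => ((e.hasDerivAt_logRatio hz).sub (((hasDerivAt_id z).const_mul
      ((e.p : ℂ) / e.q)).sub ((hasDerivAt_pow 2 z).const_mul
      ((e.p : ℂ) / (2 * e.q ^ 2))))).congr_deriv (by push_cast; field_simp)) ?_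
  have hz := halfPlaneScale_bdd_id
  have t1 := (halfPlaneScale_bdd_exp_two.const_mul (e.p / e.q))
  have t2 := (hz.mul halfPlaneScale_bdd_exp_one).const_mul (-(e.p / e.q : ℂ) * (e.p / e.q))
  have t := (t1.add t2).mul e.bdd_inv_one_sub
  refine t.congr fun z hz => ?_
  have h1 := e.one_sub_ne_zero hz
  rw [← mul_left_inj' h1]
  have hinv := inv_mul_cancel₀ h1
  set X := exp (-z)
  set Y := (1 - (e.p : ℂ) * X)⁻¹
  have hp : (e.p : ℂ) = 1 - e.q := by rw [e.q_eq]; ring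
  have key : e.p * X - (e.p / e.q - e.p / e.q ^ 2 * z) * (1 - e.p * X)
      = e.p / e.q * (X - 1 + z) + -(e.p / e.q : ℂ) * (e.p / e.q) * (z * (X - 1)) := by
    rw [hp]
    field_simp
    ring
  linear_combination key + (e.p * X - (e.p / e.q * (X - 1 + z)
    + -(e.p / e.q : ℂ) * (e.p / e.q) * (z * (X - 1)))) * hinv

end EdgeParam

/-! ### Asymptotics of the scaled contour integrals -/

open AsymScale

/-- The scale of the edge integrals: a triple `(ε, t, y)` consists of `ε = N^{-1/3}`, the edge
variable `t` and the imaginary part `y` of the integration variable; the weight is `1 + |y|`. -/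
noncomputable def edgeScale (R : ℝ) : AsymScale (ℝ × ℝ × ℝ) where
  dom := {i | 0 < i.1 ∧ i.1 ≤ 1 ∧ |i.2.1| ≤ R}
  eps i := i.1
  wt i := 1 + |i.2.2|
  eps_nonneg _ hi := hi.1.le
  eps_le_wt i hi := by linarith [hi.2.1, abs_nonneg i.2.2]
  one_le_wt i _ := by linarith [abs_nonneg i.2.2]

lemma edgeScale_bdd_line (R : ℝ) : (edgeScale R).Bdd 0 (fun i => airyLine i.2.2) :=
  ⟨1, 1, zero_le_one, fun i _ => by simpa [edgeScale] using norm_airyLine_le i.2.2⟩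

lemma edgeScale_bdd_var (R : ℝ) : (edgeScale R).Bdd 0 (fun i => (i.2.1 : ℂ)) :=
  Bdd.of_norm_le (C := R) fun i hi => by
    rw [Complex.norm_real, Real.norm_eq_abs]
    exact hi.2.2

namespace EdgeParam

variable (e : EdgeParam)

open Complex

/-- The point `λ ε (1 + i y)` of the vertical integration segment. -/
noncomputable def edgePoint (ε y : ℝ) : ℂ := e.lam * ε * airyLine y

/-- The logarithm of the generating integrand (times `1 / (1 + u)`), relative to the saddle
point and in edge scaling; it is close to `w³/3 - t w` with `w = 1 + i y`. -/
noncomputable def edgeExponent (ε t y : ℝ) : ℂ :=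
  e.phase (e.edgePoint ε y) / (ε : ℂ) ^ 3 - e.logRatio (e.edgePoint ε y)
    - t * (1 - exp (-e.edgePoint ε y)) / (e.lam * ε)

/-- The scaled displacement from the saddle point, close to `w = 1 + i y`. -/
noncomputable def edgeShift (ε y : ℝ) : ℂ := (1 - exp (-e.edgePoint ε y)) / (e.lam * ε)

lemma edgePoint_re (ε y : ℝ) : (e.edgePoint ε y).re = e.lam * ε := by
  rw [edgePoint, ← ofReal_mul, re_ofReal_mul, airyLine_re, mul_one]

lemma edgePoint_im (ε y : ℝ) : (e.edgePoint ε y).im = e.lam * ε * y := by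
  rw [edgePoint, ← ofReal_mul, im_ofReal_mul, airyLine_im]

lemma edgePoint_re_nonneg {ε : ℝ} (hε : 0 ≤ ε) (y : ℝ) : 0 ≤ (e.edgePoint ε y).re := by
  rw [edgePoint_re]; exact mul_nonneg e.lam_pos.le hε

lemma bdd_comp_edgePoint {R : ℝ} {k : ℕ} {F : ℂ → ℂ} (hF : halfPlaneScale.Bdd k F) :
    (edgeScale R).Bdd k (fun i => F (e.edgePoint i.1 i.2.2)) := by
  have hn : ∀ i ∈ (edgeScale R).dom, ‖e.edgePoint i.1 i.2.2‖ ≤ i.1 * (1 + |i.2.2|) := by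
    intro i hi
    have h0 : 0 < i.1 := hi.1
    rw [edgePoint, norm_mul, norm_mul, norm_real, norm_real, Real.norm_of_nonneg e.lam_pos.le,
      Real.norm_of_nonneg h0.le]
    have := mul_le_mul_of_nonneg_right e.lam_lt_one.le h0.le
    rw [one_mul] at this
    exact mul_le_mul this (norm_airyLine_le _) (norm_nonneg _) h0.le
  refine hF.comp _ (fun i hi => e.edgePoint_re_nonneg (le_of_lt hi.1) _) 2
    (fun i hi => (hn i hi).trans ?_) (fun i hi => ?_)
  · have h0 : 0 < i.1 := hi.1
    simp only [edgeScale]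
    nlinarith [mul_nonneg h0.le (by positivity : 0 ≤ 1 + |i.2.2|)]
  · have h1 : i.1 ≤ 1 := hi.2.1
    have := hn i hi
    simp only [edgeScale, halfPlaneScale]
    nlinarith [abs_nonneg i.2.2]

/-- The coefficient of `ε` in the expansion of `edgeExponent`. -/
noncomputable def r₁ (t w : ℂ) : ℂ :=
  e.lam * e.d₁ / 4 * w ^ 4 + e.lam * t / 2 * w ^ 2 - e.p * e.lam / e.q * w

/-- The coefficient of `ε²` in the expansion of `edgeExponent`. -/
noncomputable def r₂ (t w : ℂ) : ℂ :=
  e.lam ^ 2 * e.d₂ / 5 * w ^ 5 - e.lam ^ 2 * t / 6 * w ^ 3 + e.p * e.lam ^ 2 / (2 * e.q ^ 2) * w ^ 2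

lemma exp2_edgeExponent (R : ℝ) : (edgeScale R).Exp2
    (fun i => e.edgeExponent i.1 i.2.1 i.2.2 - (airyLine i.2.2 ^ 3 / 3 - i.2.1 * airyLine i.2.2))
    (fun _ => 0) (fun i => e.r₁ i.2.1 (airyLine i.2.2)) (fun i => e.r₂ i.2.1 (airyLine i.2.2)) := by
  have hw := edgeScale_bdd_line R
  have ht := edgeScale_bdd_var R
  refine ⟨Bdd.const _ 0, ?_, ?_, ?_⟩
  · have h4 := (hw.pow 4).const_mul (e.lam * e.d₁ / 4 : ℂ)
    have h2 := (ht.mul (hw.pow 2)).const_mul (e.lam / 2 : ℂ)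
    have h1 := hw.const_mul (e.p * e.lam / e.q : ℂ)
    refine ((h4.add h2).sub h1).congr fun i _ => ?_
    simp only [r₁]; ring
  · have h5 := (hw.pow 5).const_mul (e.lam ^ 2 * e.d₂ / 5 : ℂ)
    have h3 := (ht.mul (hw.pow 3)).const_mul (e.lam ^ 2 / 6 : ℂ)
    have h2 := (hw.pow 2).const_mul (e.p * e.lam ^ 2 / (2 * e.q ^ 2) : ℂ)
    refine ((h5.sub h3).add h2).congr fun i _ => ?_
    simp only [r₂]; ring
  · have t1 := (e.bdd_comp_edgePoint (R := R) e.bdd_phase).div_eps_pow (k := 3) 3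
    have t2 := e.bdd_comp_edgePoint (R := R) e.bdd_logRatio
    have t3 := (ht.mul (((e.bdd_comp_edgePoint (R := R) halfPlaneScale_bdd_exp_four).div_eps_pow
      (k := 3) 1).div_const (e.lam : ℂ)))
    rw [zero_add] at t3
    refine ((t1.sub t2).add t3).congr fun i hi => ?_
    have hε : (i.1 : ℂ) ≠ 0 := ofReal_ne_zero.2 (ne_of_gt hi.1)
    have hl := e.lam_ne
    simp only [edgeExponent, edgeScale, r₁, r₂, d₁, d₂]
    generalize e.phase (e.edgePoint i.1 i.2.2) = P
    generalize e.logRatio (e.edgePoint i.1 i.2.2) = L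
    generalize exp (-e.edgePoint i.1 i.2.2) = X
    simp only [edgePoint, ← e.lam_cube']
    field_simp
    ring

lemma exp2_edgeShift (R : ℝ) : (edgeScale R).Exp2 (fun i => e.edgeShift i.1 i.2.2)
    (fun i => airyLine i.2.2) (fun i => -(e.lam / 2) * airyLine i.2.2 ^ 2)
    (fun i => e.lam ^ 2 / 6 * airyLine i.2.2 ^ 3) := by
  have hw := edgeScale_bdd_line R
  refine ⟨hw, (hw.pow 2).const_mul _, (hw.pow 3).const_mul _, ?_⟩
  have t3 := (((e.bdd_comp_edgePoint (R := R) halfPlaneScale_bdd_exp_four).div_eps_pow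
      (k := 3) 1).div_const (-e.lam : ℂ))
  refine t3.congr fun i hi => ?_
  have hε : (i.1 : ℂ) ≠ 0 := ofReal_ne_zero.2 (ne_of_gt hi.1)
  have hl := e.lam_ne
  simp only [edgeShift, edgeScale]
  generalize exp (-e.edgePoint i.1 i.2.2) = X
  simp only [edgePoint]
  field_simp
  ring

lemma edgeExponent_re (ε t y : ℝ) : (e.edgeExponent ε t y).re
    = (((exp (-e.edgePoint ε y)).re - 1) / e.p + e.q ^ 2 / e.p ^ 2 *
        (Real.log ‖1 - e.p * exp (-e.edgePoint ε y)‖ - Real.log e.q) + e.lam * ε) / ε ^ 3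
      - (Real.log ‖1 - e.p * exp (-e.edgePoint ε y)‖ - Real.log e.q)
      - t * (1 - (exp (-e.edgePoint ε y)).re) / (e.lam * ε) := by
  have h1 : (e.logRatio (e.edgePoint ε y)).re
      = Real.log ‖1 - e.p * exp (-e.edgePoint ε y)‖ - Real.log e.q := by
    rw [logRatio, sub_re, log_re, log_re, norm_real, Real.norm_of_nonneg e.q_pos.le]
  have h2 : e.edgeExponent ε t y = ((exp (-e.edgePoint ε y) - 1) / e.p
      + ((e.q ^ 2 / e.p ^ 2 : ℝ) : ℂ) * e.logRatio (e.edgePoint ε y) + e.edgePoint ε y)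
        / ((ε ^ 3 : ℝ) : ℂ) - e.logRatio (e.edgePoint ε y)
      - t * (1 - exp (-e.edgePoint ε y)) / ((e.lam * ε : ℝ) : ℂ) := by
    push_cast; rfl
  rw [h2, sub_re, sub_re, div_ofReal_re, div_ofReal_re, add_re, add_re, div_ofReal_re,
    re_ofReal_mul, re_ofReal_mul, h1, edgePoint_re, sub_re, sub_re, one_re]

lemma exp_neg_edgePoint_re (ε y : ℝ) : (exp (-e.edgePoint ε y)).re
    = Real.exp (-(e.lam * ε)) * Real.cos (e.lam * ε * y) := by
  rw [exp_re, neg_re, neg_im, Real.cos_neg, edgePoint_re, edgePoint_im]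

lemma norm_one_sub_sq (ε y : ℝ) : ‖1 - e.p * exp (-e.edgePoint ε y)‖ ^ 2
    = (1 - e.p * Real.exp (-(e.lam * ε))) ^ 2
      + 2 * e.p * Real.exp (-(e.lam * ε)) * (1 - Real.cos (e.lam * ε * y)) := by
  rw [← normSq_eq_norm_sq, normSq_apply, sub_re, sub_im, re_ofReal_mul, im_ofReal_mul, exp_re,
    exp_im, neg_re, neg_im, Real.cos_neg, Real.sin_neg, edgePoint_re, edgePoint_im, one_re, one_im]
  linear_combination (e.p * Real.exp (-(e.lam * ε))) ^ 2 * Real.sin_sq_add_cos_sq (e.lam * ε * y)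

lemma sq_div_sq_le {ρ : ℝ} (hρ : 0 ≤ ρ) (hρ1 : ρ ≤ 1) :
    e.q ^ 2 / (1 - e.p * ρ) ^ 2 ≤ 1 - e.p * (1 - ρ) / (2 * e.q) := by
  have hp := e.p_pos
  have hq := e.q_pos
  set δ := e.p * (1 - ρ) / e.q with hδ
  have hδ0 : 0 ≤ δ := div_nonneg (mul_nonneg hp.le (by linarith)) hq.le
  have hδ1 : δ ≤ 1 := by
    rw [hδ, div_le_one hq]
    nlinarith [e.p_le_q]
  have h1 : 1 - e.p * ρ = e.q * (1 + δ) := by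
    rw [hδ, mul_add, mul_div_cancel₀ _ hq.ne']
    linarith [e.p_add_q]
  have h2 : e.p * (1 - ρ) / (2 * e.q) = δ / 2 := by rw [hδ]; field_simp
  rw [h2, h1, mul_pow, ← div_div, div_self (by positivity), div_le_iff₀ (by positivity)]
  nlinarith [mul_nonneg hδ0 (sub_nonneg.2 hδ1), mul_nonneg (mul_nonneg hδ0 hδ0) (sub_nonneg.2 hδ1)]

lemma half_le_one_sub_exp_neg {s : ℝ} (hs0 : 0 < s) (hs1 : s ≤ 1) :
    s / 2 ≤ 1 - Real.exp (-s) := by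
  have h1 : Real.exp (-s) ≤ 1 / (1 + s) := by
    rw [Real.exp_neg, ← one_div]
    exact one_div_le_one_div_of_le (by linarith) (by linarith [Real.add_one_le_exp s])
  have h2 : 1 / (1 + s) ≤ 1 - s / 2 := by
    rw [div_le_iff₀ (by linarith)]
    nlinarith
  linarith

/-- The competition between the gain `1 - ρ ~ λε` at the scale `ε⁻³` and the term with `t`. -/
lemma edge_increment_le {R ε t ρ v L : ℝ} (hε : 0 < ε) (hεR : 8 * e.q * R * ε ≤ e.lam ^ 2)
    (ht : |t| ≤ R) (hρ : 0 ≤ ρ) (hρs : e.lam * ε / 2 ≤ 1 - ρ) (hv : 0 ≤ v) (hL0 : 0 ≤ L)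
    (hL : L ≤ e.p * ρ * v / (1 - e.p * ρ) ^ 2) :
    (-(ρ * v) / e.p + e.q ^ 2 / e.p ^ 2 * L) / ε ^ 3 - L - t * (ρ * v) / (e.lam * ε)
      ≤ -(ρ * v) * (e.lam / (8 * e.q * ε ^ 2)) := by
  have hp := e.p_pos
  have hq := e.q_pos
  have hl := e.lam_pos
  have hρv : 0 ≤ ρ * v := mul_nonneg hρ hv
  have hle : 0 < e.lam * ε := by positivity
  have hqD := e.sq_div_sq_le hρ (by linarith)
  have hb1 : e.q ^ 2 / e.p ^ 2 * L ≤ ρ * v / e.p * (1 - e.p * (1 - ρ) / (2 * e.q)) := by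
    calc _ ≤ e.q ^ 2 / e.p ^ 2 * (e.p * ρ * v / (1 - e.p * ρ) ^ 2) :=
          mul_le_mul_of_nonneg_left hL (by positivity)
      _ = ρ * v / e.p * (e.q ^ 2 / (1 - e.p * ρ) ^ 2) := by
          generalize (1 - e.p * ρ) ^ 2 = D
          rw [div_mul_div_comm, div_mul_div_comm, ← div_div, ← div_div]
          congr 1
          field_simp
      _ ≤ _ := mul_le_mul_of_nonneg_left hqD (by positivity)
  have hb2 : (-(ρ * v) / e.p + e.q ^ 2 / e.p ^ 2 * L) / ε ^ 3
      ≤ -(ρ * v) * (2 * (e.lam / (8 * e.q * ε ^ 2))) := by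
    calc _ ≤ (-(ρ * v) / e.p + ρ * v / e.p * (1 - e.p * (1 - ρ) / (2 * e.q))) / ε ^ 3 :=
          div_le_div_of_nonneg_right (by linarith) (by positivity)
      _ = -(ρ * v) * ((1 - ρ) / (2 * e.q * ε ^ 3)) := by field_simp; ring
      _ ≤ -(ρ * v) * (e.lam * ε / 2 / (2 * e.q * ε ^ 3)) :=
          mul_le_mul_of_nonpos_left (div_le_div_of_nonneg_right hρs (by positivity)) (by linarith)
      _ = _ := by field_simp; norm_num
  have hb3 : -(t * (ρ * v) / (e.lam * ε)) ≤ ρ * v * (e.lam / (8 * e.q * ε ^ 2)) := by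
    have h1 : -t ≤ R := (neg_le_abs t).trans ht
    have h2 : R / (e.lam * ε) ≤ e.lam / (8 * e.q * ε ^ 2) := by
      rw [div_le_div_iff₀ hle (by positivity)]
      have := mul_le_mul_of_nonneg_left hεR hε.le
      linarith
    calc _ = ρ * v * (-t / (e.lam * ε)) := by ring
      _ ≤ ρ * v * (R / (e.lam * ε)) :=
          mul_le_mul_of_nonneg_left (div_le_div_of_nonneg_right h1 hle.le) hρv
      _ ≤ _ := mul_le_mul_of_nonneg_left h2 hρv
  linarith

/-- On the circle through a point slightly to the right of the saddle point the integrand is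
largest on the real axis, with Gaussian decay in the scaled angle. The gain
`1 - e^{-λε} ~ λε` is what the shift off the saddle point provides. -/
lemma edgeExponent_re_le {R ε t y : ℝ} (hε : 0 < ε) (hε1 : ε ≤ 1)
    (hεR : 8 * e.q * R * ε ≤ e.lam ^ 2) (ht : |t| ≤ R) (hy : |e.lam * ε * y| ≤ Real.pi) :
    (e.edgeExponent ε t y).re ≤ (e.edgeExponent ε t 0).re - 1 / (12 * Real.pi ^ 2) * y ^ 2 := by
  have hp := e.p_pos
  have hq := e.q_pos
  have hl := e.lam_pos
  have hpi := Real.pi_pos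
  have hn0 : ‖1 - e.p * exp (-e.edgePoint ε 0)‖ = 1 - e.p * Real.exp (-(e.lam * ε)) := by
    have h := e.norm_one_sub_sq ε 0
    rw [mul_zero, Real.cos_zero, sub_self, mul_zero, add_zero] at h
    refine (pow_left_inj₀ (norm_nonneg _) ?_ two_ne_zero).1 h
    have : Real.exp (-(e.lam * ε)) ≤ 1 := Real.exp_le_one_iff.2 (by
      rw [neg_nonpos]; positivity)
    nlinarith [e.p_lt_one]
  have hsq := e.norm_one_sub_sq ε y
  rw [edgeExponent_re, edgeExponent_re, hn0, exp_neg_edgePoint_re, exp_neg_edgePoint_re, mul_zero,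
    Real.cos_zero]
  set s := e.lam * ε with hs
  have hs0 : 0 < s := by positivity
  have hs1 : s ≤ 1 := by nlinarith [e.lam_lt_one]
  set ρ := Real.exp (-s) with hρ
  have hρ0 : 0 < ρ := Real.exp_pos _
  have hρ3 : 1 / 3 ≤ ρ := by
    have h1 : Real.exp (-1) ≤ ρ := Real.exp_le_exp.2 (by linarith)
    have h2 := Real.exp_neg_one_gt_d9
    linarith
  have hρs : s / 2 ≤ 1 - ρ := half_le_one_sub_exp_neg hs0 hs1
  set n := ‖1 - e.p * exp (-e.edgePoint ε y)‖ with hn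
  set D := 1 - e.p * ρ with hD
  set v := 1 - Real.cos (s * y) with hv
  have hDq : D = e.q + e.p * (1 - ρ) := by rw [hD]; linarith [e.p_add_q]
  have hD0 : 0 < D := by rw [hDq]; nlinarith
  have hvlow : 2 / Real.pi ^ 2 * (s * y) ^ 2 ≤ v := by
    have := Real.cos_le_one_sub_mul_cos_sq hy
    rw [hv]; linarith
  have hv0 : 0 ≤ v := le_trans (by positivity) hvlow
  have hnD : D ^ 2 ≤ n ^ 2 := by rw [hsq]; nlinarith [mul_nonneg (mul_nonneg hp.le hρ0.le) hv0]
  have hn0' : 0 ≤ n := norm_nonneg _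
  have hDn : D ≤ n := (pow_le_pow_iff_left₀ hD0.le hn0' two_ne_zero).1 hnD
  have hnpos : 0 < n := hD0.trans_le hDn
  set L := Real.log n - Real.log D with hL
  have hL0 : 0 ≤ L := sub_nonneg.2 (Real.log_le_log hD0 hDn)
  have hLup : L ≤ e.p * ρ * v / D ^ 2 := by
    have h1 : 2 * L = Real.log (n ^ 2 / D ^ 2) := by
      rw [Real.log_div (by positivity) (by positivity), Real.log_pow, Real.log_pow, hL]
      push_cast; ring
    have h2 := Real.log_le_sub_one_of_pos (x := n ^ 2 / D ^ 2) (by positivity)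
    have h3 : n ^ 2 / D ^ 2 - 1 = 2 * (e.p * ρ * v / D ^ 2) := by
      rw [hsq]; field_simp; ring
    linarith
  -- the difference of the two exponents
  have hdiff : (((ρ * Real.cos (s * y) - 1) / e.p + e.q ^ 2 / e.p ^ 2 *
        (Real.log n - Real.log e.q) + s) / ε ^ 3 - (Real.log n - Real.log e.q)
        - t * (1 - ρ * Real.cos (s * y)) / s)
      - (((ρ * 1 - 1) / e.p + e.q ^ 2 / e.p ^ 2 *
        (Real.log D - Real.log e.q) + s) / ε ^ 3 - (Real.log D - Real.log e.q)
        - t * (1 - ρ * 1) / s)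
      = (-(ρ * v) / e.p + e.q ^ 2 / e.p ^ 2 * L) / ε ^ 3 - L - t * (ρ * v) / s := by
    rw [hL, hv]
    field_simp
    ring
  have hinc := e.edge_increment_le hε hεR ht hρ0.le hρs hv0 hL0 hLup
  have hfin : 1 / (12 * Real.pi ^ 2) * y ^ 2 ≤ ρ * v * (e.lam / (8 * e.q * ε ^ 2)) := by
    calc _ = 1 / 3 * (2 / Real.pi ^ 2 * (s * y) ^ 2) * (e.lam / (8 * e.q * ε ^ 2)) := by
          rw [hs, ← e.lam_cube]; field_simp; ring
      _ ≤ _ := mul_le_mul_of_nonneg_right (mul_le_mul hρ3 hvlow (by positivity) hρ0.le)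
          (by positivity)
  rw [← hs] at hinc
  linarith

lemma exists_norm_exp_edgeExponent_le (R : ℝ) : ∃ (K ε₀ : ℝ), 0 < ε₀ ∧ ε₀ ≤ 1 ∧ 0 ≤ K ∧
    ∀ ε t y : ℝ, 0 < ε → ε ≤ ε₀ → |t| ≤ R → |e.lam * ε * y| ≤ Real.pi →
      ‖exp (e.edgeExponent ε t y)‖ ≤ K * Real.exp (-(1 / (12 * Real.pi ^ 2)) * y ^ 2) := by
  obtain ⟨C, m, hC, hb⟩ := (e.exp2_edgeExponent R).bdd
  have hl := e.lam_pos
  have hq := e.q_pos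
  refine ⟨Real.exp (C + (1 / 3 + R)), min 1 (e.lam ^ 2 / (8 * e.q * (|R| + 1))),
    lt_min one_pos (by positivity), min_le_left _ _, (Real.exp_pos _).le,
    fun ε t y hε hε0 ht hy => ?_⟩
  have hε1 : ε ≤ 1 := hε0.trans (min_le_left _ _)
  have hεR : 8 * e.q * R * ε ≤ e.lam ^ 2 := by
    have h1 := hε0.trans (min_le_right _ _)
    rw [le_div_iff₀ (by positivity)] at h1
    have h2 : R ≤ |R| + 1 := (le_abs_self R).trans (by linarith)
    calc _ ≤ 8 * e.q * (|R| + 1) * ε := by gcongr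
      _ = ε * (8 * e.q * (|R| + 1)) := by ring
      _ ≤ _ := h1
  have h := e.edgeExponent_re_le hε hε1 hεR ht hy
  have h0 := hb (ε, t, 0) ⟨hε, hε1, ht⟩
  have hre : (e.edgeExponent ε t 0).re ≤ C + (1 / 3 + R) := by
    have h1 := (re_le_norm _).trans h0
    simp only [edgeScale, airyLine, sub_re] at h1
    have h2 : -t ≤ R := (neg_le_abs t).trans ht
    simp at h1
    norm_num at h1
    linarith
  rw [norm_exp, ← Real.exp_add, Real.exp_le_exp]
  linarith

lemma continuous_edgePoint (ε : ℝ) : Continuous (e.edgePoint ε) := by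
  unfold edgePoint; fun_prop

lemma continuous_edgeShift (ε : ℝ) : Continuous (e.edgeShift ε) := by
  have := e.continuous_edgePoint ε
  unfold edgeShift; fun_prop

lemma continuous_edgeExponent {ε : ℝ} (hε : 0 ≤ ε) (t : ℝ) : Continuous (e.edgeExponent ε t) := by
  have h := e.continuous_edgePoint ε
  have hlr : Continuous fun y => e.logRatio (e.edgePoint ε y) :=
    continuous_iff_continuousAt.2 fun y =>
      (e.hasDerivAt_logRatio (e.edgePoint_re_nonneg hε y)).continuousAt.comp h.continuousAt
  unfold edgeExponent phase
  fun_prop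

open MeasureTheory in
/-- The scaled contour integral of `exp(edgeExponent)` against a function with a known expansion is
an integral against the Airy exponential, up to `O(ε³)` and uniformly in `t`. -/
lemma exists_norm_integral_sub_le (R : ℝ) {T c₀ c₁ c₂ : ℝ × ℝ × ℝ → ℂ}
    (hT : (edgeScale R).Exp2 T c₀ c₁ c₂) (hTc : ∀ ε t, Continuous fun y => T (ε, t, y))
    (hc₀ : ∀ ε t, Continuous fun y => c₀ (ε, t, y)) (hc₁ : ∀ ε t, Continuous fun y => c₁ (ε, t, y))
    (hc₂ : ∀ ε t, Continuous fun y => c₂ (ε, t, y)) :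
    ∃ (C ε₀ : ℝ), 0 < ε₀ ∧ ε₀ ≤ 1 ∧ ∀ ε t : ℝ, 0 < ε → ε ≤ ε₀ → |t| ≤ R →
      ‖(∫ y in (-(Real.pi / (e.lam * ε)))..(Real.pi / (e.lam * ε)),
          exp (e.edgeExponent ε t y) * T (ε, t, y))
        - ∫ y : ℝ, airyExp t (airyLine y) * (c₀ (ε, t, y)
          + ε * (c₁ (ε, t, y) + e.r₁ t (airyLine y) * c₀ (ε, t, y))
          + ε ^ 2 * (c₂ (ε, t, y) + e.r₁ t (airyLine y) * c₁ (ε, t, y)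
            + (e.r₂ t (airyLine y) + e.r₁ t (airyLine y) ^ 2 / 2) * c₀ (ε, t, y)))‖
        ≤ C * ε ^ 3 := by
  obtain ⟨K, ε₀, hε₀, hε₀1, hK, hgauss⟩ := e.exists_norm_exp_edgeExponent_le R
  have hR := e.exp2_edgeExponent R
  obtain ⟨C₁, m₁, hC₁, h₁⟩ := hR.exists_norm_exp_sub_le
  have htr := Exp2.of_bdd (Bdd.const (edgeScale R) 1) hR.bdd₁
    (hR.bdd₂.add ((hR.bdd₁.pow 2).div_const 2))
  have hprod := htr.mul hT
  obtain ⟨C₂, m₂, hC₂, h₂⟩ := hprod.rem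
  obtain ⟨C₃, m₃, hC₃, h₃⟩ := hT.bdd
  obtain ⟨C₄, m₄, hC₄, h₄⟩ := (Exp2.of_bdd hprod.bdd₀ hprod.bdd₁ hprod.bdd₂).bdd
  set c : ℝ := 1 / (12 * Real.pi ^ 2) with hc
  have hpi3 := Real.pi_gt_three
  have hcpos : 0 < c := by positivity
  have hc1 : c ≤ 1 := by
    rw [hc, div_le_one (by positivity)]
    nlinarith
  set B : ℝ := Real.exp (1 / 3 + R) with hB
  set m := m₁ + m₂ + m₃ + m₄ + 3 with hm
  set Q : ℝ := C₁ * C₃ * max B K + C₂ * B + C₄ * B with hQ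
  have hBpos : 0 < B := Real.exp_pos _
  set I₀ : ℝ := ∫ y : ℝ, (1 + |y|) ^ m * Real.exp (-c * y ^ 2) with hI₀
  refine ⟨Q * I₀, ε₀, hε₀, hε₀1, fun ε t hε hεε ht => ?_⟩
  have hε1 : ε ≤ 1 := hεε.trans hε₀1
  have hdom : ∀ y, (ε, t, y) ∈ (edgeScale R).dom := fun y => ⟨hε, hε1, ht⟩
  have hl := e.lam_pos
  set b := Real.pi / (e.lam * ε) with hb
  have hb0 : 0 < b := by positivity
  set f : ℝ → ℂ := fun y => exp (e.edgeExponent ε t y) * T (ε, t, y) with hf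
  set P : ℝ → ℂ := fun y => c₀ (ε, t, y)
          + ε * (c₁ (ε, t, y) + e.r₁ t (airyLine y) * c₀ (ε, t, y))
          + ε ^ 2 * (c₂ (ε, t, y) + e.r₁ t (airyLine y) * c₁ (ε, t, y)
            + (e.r₂ t (airyLine y) + e.r₁ t (airyLine y) ^ 2 / 2) * c₀ (ε, t, y)) with hP
  have hfc : Continuous f := ((e.continuous_edgeExponent hε.le t).cexp).mul (hTc ε t)
  have hPc : Continuous P := by
    have hr₁ : Continuous fun y => e.r₁ t (airyLine y) := by unfold r₁; fun_prop
    have hr₂ : Continuous fun y => e.r₂ t (airyLine y) := by unfold r₂; fun_prop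
    exact ((hc₀ ε t).add (continuous_const.mul ((hc₁ ε t).add (hr₁.mul (hc₀ ε t))))).add
      (continuous_const.mul (((hc₂ ε t).add (hr₁.mul (hc₁ ε t))).add
        ((hr₂.add ((hr₁.pow 2).div_const 2)).mul (hc₀ ε t))))
  -- the Airy exponential is dominated by the same Gaussian
  have hAiry : ∀ y, ‖airyExp t (airyLine y)‖ ≤ B * Real.exp (-c * y ^ 2) := by
    intro y
    rw [norm_airyExp_airyLine]
    have h1 : -t ≤ R := (neg_le_abs t).trans ht
    have h2 : Real.exp (1 / 3 - t) ≤ B := Real.exp_le_exp.2 (by linarith)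
    have h3 : Real.exp (-1 * y ^ 2) ≤ Real.exp (-c * y ^ 2) := by
      rw [Real.exp_le_exp]
      nlinarith [mul_nonneg (sub_nonneg.2 hc1) (sq_nonneg y)]
    exact mul_le_mul h2 h3 (Real.exp_pos _).le hBpos.le
  have hPb : ∀ y, ‖P y‖ ≤ C₄ * (1 + |y|) ^ m₄ := by
    intro y
    have := h₄ (ε, t, y) (hdom y)
    simp only [edgeScale, pow_zero, mul_one] at this
    refine le_trans (le_of_eq ?_) this
    congr 1
    simp only [hP]; ring
  have hw : ∀ y : ℝ, 1 ≤ 1 + |y| := fun y => by linarith [abs_nonneg y]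
  have hpow : ∀ (y : ℝ) (k : ℕ), k ≤ m → (1 + |y|) ^ k ≤ (1 + |y|) ^ m := fun y k hk =>
    pow_le_pow_right₀ (hw y) hk
  have hgint : Integrable fun y => airyExp t (airyLine y) * P y := by
    refine ((integrable_one_add_abs_pow_mul_exp m₄ hcpos).const_mul (B * C₄)).mono'
      (by fun_prop) (Filter.Eventually.of_forall fun y => ?_)
    rw [norm_mul]
    calc _ ≤ B * Real.exp (-c * y ^ 2) * (C₄ * (1 + |y|) ^ m₄) :=
          mul_le_mul (hAiry y) (hPb y) (norm_nonneg _) (by positivity)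
      _ = _ := by ring
  have hfint : Integrable ((Set.Ioc (-b) b).indicator f) :=
    (integrable_indicator_iff measurableSet_Ioc).2
      ((hfc.integrableOn_Icc (a := -b) (b := b)).mono_set Set.Ioc_subset_Icc_self)
  rw [intervalIntegral.integral_of_le (by linarith), ← integral_indicator measurableSet_Ioc,
    ← integral_sub hfint hgint]
  have hIint := (integrable_one_add_abs_pow_mul_exp m hcpos).const_mul (Q * ε ^ 3)
  refine (norm_integral_le_of_norm_le hIint (Filter.Eventually.of_forall fun y => ?_)).trans_eq ?_
  swap
  · rw [integral_const_mul]; ring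
  have hE := Real.exp_pos (-c * y ^ 2)
  have hw0 : 0 ≤ 1 + |y| := by positivity
  have hmaxB : B ≤ max B K := le_max_left _ _
  by_cases hy : y ∈ Set.Ioc (-b) b
  · rw [Set.indicator_of_mem hy]
    have hyb : |e.lam * ε * y| ≤ Real.pi := by
      have h1 : |y| ≤ b := abs_le.2 ⟨hy.1.le, hy.2⟩
      rw [abs_mul, abs_of_pos (by positivity)]
      calc _ ≤ e.lam * ε * b := by gcongr
        _ = _ := by rw [hb]; field_simp
    have hEx := hgauss ε t y hε hεε ht hyb
    set Rm := e.edgeExponent ε t y - (airyLine y ^ 3 / 3 - t * airyLine y) with hRm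
    set tr : ℂ := 1 + ε * e.r₁ t (airyLine y) + ε ^ 2 * (e.r₂ t (airyLine y)
      + e.r₁ t (airyLine y) ^ 2 / 2) with htrdef
    have hfac : exp (e.edgeExponent ε t y) = airyExp t (airyLine y) * exp Rm := by
      rw [airyExp, ← exp_add, hRm]
      congr 1
      ring
    have b1 : ‖airyExp t (airyLine y) * (exp Rm - tr)‖
        ≤ C₁ * ε ^ 3 * (1 + |y|) ^ m₁ * (max B K * Real.exp (-c * y ^ 2)) := by
      rw [norm_mul]
      have h5 := h₁ (ε, t, y) (hdom y)
      simp only [edgeScale] at h5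
      calc _ ≤ ‖airyExp t (airyLine y)‖ * (C₁ * ε ^ 3 * (1 + |y|) ^ m₁ * max 1 ‖exp Rm‖) := by
            gcongr
        _ = C₁ * ε ^ 3 * (1 + |y|) ^ m₁ * max (‖airyExp t (airyLine y)‖)
            (‖airyExp t (airyLine y) * exp Rm‖) := by
            rw [norm_mul, mul_left_comm, mul_max_of_nonneg _ _ (norm_nonneg _), mul_one]
        _ ≤ _ := by
            gcongr
            rw [← hfac]
            refine max_le ((hAiry y).trans ?_) (hEx.trans ?_)
            · gcongr
            · gcongr
              exact le_max_right _ _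
    have b2 : ‖T (ε, t, y)‖ ≤ C₃ * (1 + |y|) ^ m₃ := by
      simpa [edgeScale] using h₃ (ε, t, y) (hdom y)
    have b3 : ‖tr * T (ε, t, y) - P y‖ ≤ C₂ * ε ^ 3 * (1 + |y|) ^ m₂ := by
      have h5 := h₂ (ε, t, y) (hdom y)
      simp only [edgeScale] at h5
      refine le_trans (le_of_eq ?_) h5
      congr 1
      simp only [hP, htrdef]
      ring
    calc ‖f y - airyExp t (airyLine y) * P y‖
        = ‖airyExp t (airyLine y) * (exp Rm - tr) * T (ε, t, y)
          + airyExp t (airyLine y) * (tr * T (ε, t, y) - P y)‖ := by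
          simp only [hf]
          rw [hfac]
          congr 1
          ring
      _ ≤ C₁ * ε ^ 3 * (1 + |y|) ^ m₁ * (max B K * Real.exp (-c * y ^ 2)) * (C₃ * (1 + |y|) ^ m₃)
          + B * Real.exp (-c * y ^ 2) * (C₂ * ε ^ 3 * (1 + |y|) ^ m₂) := by
          refine (norm_add_le _ _).trans (add_le_add ?_ ?_)
          · rw [norm_mul]
            exact mul_le_mul b1 b2 (norm_nonneg _) (by positivity)
          · rw [norm_mul]
            exact mul_le_mul (hAiry y) b3 (norm_nonneg _) (by positivity)
      _ = C₁ * C₃ * max B K * ε ^ 3 * ((1 + |y|) ^ (m₁ + m₃) * Real.exp (-c * y ^ 2))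
          + C₂ * B * ε ^ 3 * ((1 + |y|) ^ m₂ * Real.exp (-c * y ^ 2)) := by rw [pow_add]; ring
      _ ≤ C₁ * C₃ * max B K * ε ^ 3 * ((1 + |y|) ^ m * Real.exp (-c * y ^ 2))
          + C₂ * B * ε ^ 3 * ((1 + |y|) ^ m * Real.exp (-c * y ^ 2)) := by
          have := hpow y (m₁ + m₃) (by omega)
          have := hpow y m₂ (by omega)
          gcongr
      _ ≤ _ := by
          have : 0 ≤ C₄ * B * ε ^ 3 * ((1 + |y|) ^ m * Real.exp (-c * y ^ 2)) := by positivity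
          rw [hQ]
          linarith
  · -- outside the segment `ε |y|` is bounded below, and powers of it are lost at no cost
    rw [Set.indicator_of_notMem hy, zero_sub, norm_neg, norm_mul]
    have hyb : b ≤ |y| := by
      by_contra hlt
      have := abs_lt.1 (not_le.1 hlt)
      exact hy ⟨this.1, this.2.le⟩
    have h1 : 1 ≤ ε * (1 + |y|) := by
      rw [hb, div_le_iff₀ (by positivity)] at hyb
      have h2 : e.lam * ε ≤ ε := by nlinarith [e.lam_lt_one]
      nlinarith [mul_le_mul_of_nonneg_left h2 (abs_nonneg y)]
    have h3 : 1 ≤ ε ^ 3 * (1 + |y|) ^ 3 := by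
      rw [← mul_pow]; exact one_le_pow₀ h1
    calc _ ≤ B * Real.exp (-c * y ^ 2) * (C₄ * (1 + |y|) ^ m₄) :=
          mul_le_mul (hAiry y) (hPb y) (norm_nonneg _) (by positivity)
      _ ≤ B * Real.exp (-c * y ^ 2) * (C₄ * (1 + |y|) ^ m₄) * (ε ^ 3 * (1 + |y|) ^ 3) :=
          le_mul_of_one_le_right (by positivity) h3
      _ = C₄ * B * ε ^ 3 * ((1 + |y|) ^ (m₄ + 3) * Real.exp (-c * y ^ 2)) := by rw [pow_add]; ring
      _ ≤ C₄ * B * ε ^ 3 * ((1 + |y|) ^ m * Real.exp (-c * y ^ 2)) := by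
          have := hpow y (m₄ + 3) (by omega)
          gcongr
      _ ≤ _ := by
          have : 0 ≤ C₁ * C₃ * max B K * ε ^ 3 * ((1 + |y|) ^ m * Real.exp (-c * y ^ 2)) := by
            have := le_max_left B K
            have : 0 ≤ max B K := hBpos.le.trans this
            positivity
          have : 0 ≤ C₂ * B * ε ^ 3 * ((1 + |y|) ^ m * Real.exp (-c * y ^ 2)) := by positivity
          rw [hQ]
          linarith

end EdgeParam

/-! ### The edge integrals and their expansion in Airy moments -/

open AsymScale

lemma integral_sum_mul_airyExp (k n : ℕ) (c : Fin n → ℂ) (t : ℝ) :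
    (1 / (2 * Real.pi) : ℂ) * ∫ y : ℝ, airyExp t (airyLine y) * ∑ j, c j * airyLine y ^ (k + j.1)
      = ∑ j, c j * airyMoment (k + j.1) t := by
  have h : ∀ y : ℝ, airyExp t (airyLine y) * ∑ j, c j * airyLine y ^ (k + j.1)
      = ∑ j, c j * (airyLine y ^ (k + j.1) * airyExp t (airyLine y)) := fun y => by
    rw [Finset.mul_sum]
    exact Finset.sum_congr rfl fun j _ => by ring
  simp only [h]
  rw [MeasureTheory.integral_finsetSum _ fun j _ => (integrable_pow_mul_airyExp _ t).const_mul _,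
    Finset.mul_sum]
  refine Finset.sum_congr rfl fun j _ => ?_
  rw [MeasureTheory.integral_const_mul, airyMoment]
  ring

namespace EdgeParam

variable (e : EdgeParam)

open Complex

/-- The scaled contour integral with `k` factors of the displacement from the saddle point. For
`k = 0` it represents `L_N^{a-1}` near the soft edge, and it is `(-1)^k` times the `k`-th derivative
of that function of the edge variable. -/
noncomputable def edgeIntegral (k : ℕ) (ε t : ℝ) : ℂ :=
  (1 / (2 * Real.pi)) * ∫ y in (-(Real.pi / (e.lam * ε)))..(Real.pi / (e.lam * ε)),
    exp (e.edgeExponent ε t y) * e.edgeShift ε y ^ k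

lemma hasDerivAt_exp_edgeExponent (ε t y : ℝ) :
    HasDerivAt (fun t : ℝ => exp (e.edgeExponent ε t y))
      (-(exp (e.edgeExponent ε t y) * e.edgeShift ε y)) t := by
  have h : HasDerivAt (fun τ : ℂ => exp (e.phase (e.edgePoint ε y) / (ε : ℂ) ^ 3
      - e.logRatio (e.edgePoint ε y) - τ * (1 - exp (-e.edgePoint ε y)) / (e.lam * ε)))
      (exp (e.edgeExponent ε t y) * -(1 * (1 - exp (-e.edgePoint ε y)) / (e.lam * ε))) t :=
    ((((hasDerivAt_id (t : ℂ)).mul_const _).div_const _).const_sub _).cexp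
  exact h.comp_ofReal.congr_deriv (by rw [edgeShift]; ring)

open MeasureTheory in
lemma hasDerivAt_edgeIntegral (k : ℕ) {ε : ℝ} (hε : 0 ≤ ε) (t : ℝ) :
    HasDerivAt (e.edgeIntegral k ε) (-e.edgeIntegral (k + 1) ε t) t := by
  have hsh := e.continuous_edgeShift ε
  have hfact : ∀ t y : ℝ, exp (e.edgeExponent ε t y)
      = exp (e.edgeExponent ε 0 y) * exp (-(t * e.edgeShift ε y)) := by
    intro t y
    rw [← exp_add, edgeExponent, edgeExponent, edgeShift]
    congr 1
    push_cast
    ring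
  have hc : ∀ t, Continuous (e.edgeExponent ε t) := e.continuous_edgeExponent hε
  have hcont : ∀ (t : ℝ) (k : ℕ), Continuous fun y =>
      exp (e.edgeExponent ε t y) * e.edgeShift ε y ^ k := fun t k =>
    (hc t).cexp.mul (hsh.pow k)
  have h := intervalIntegral.hasDerivAt_integral_of_dominated_loc_of_deriv_le (μ := volume)
    (F := fun t y => exp (e.edgeExponent ε t y) * e.edgeShift ε y ^ k)
    (F' := fun t y => -(exp (e.edgeExponent ε t y) * e.edgeShift ε y ^ (k + 1)))
    (a := -(Real.pi / (e.lam * ε))) (b := Real.pi / (e.lam * ε))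
    (bound := fun y => ‖exp (e.edgeExponent ε 0 y)‖ * Real.exp ((|t| + 1) * ‖e.edgeShift ε y‖)
      * ‖e.edgeShift ε y‖ ^ (k + 1))
    (x₀ := t) (Metric.ball_mem_nhds t one_pos)
    (Filter.Eventually.of_forall fun t => (hcont t k).aestronglyMeasurable)
    ((hcont t k).intervalIntegrable _ _) (hcont t (k + 1)).neg.aestronglyMeasurable
    (Filter.Eventually.of_forall fun y _ t' ht' => by
      rw [norm_neg, norm_mul, norm_pow, hfact, norm_mul]
      gcongr
      refine (norm_exp_le_exp_norm _).trans (Real.exp_le_exp.2 ?_)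
      rw [norm_neg, norm_mul, norm_real, Real.norm_eq_abs]
      gcongr
      rw [Metric.mem_ball, Real.dist_eq] at ht'
      have := abs_sub_abs_le_abs_sub t' t
      linarith)
    (((hc 0).cexp.norm.mul (by fun_prop)).mul (by fun_prop) |>.intervalIntegrable _ _)
    (Filter.Eventually.of_forall fun y _ t' _ =>
      ((e.hasDerivAt_exp_edgeExponent ε t' y).mul_const _).congr_deriv (by ring))
  have h2 := h.2.const_mul (1 / (2 * Real.pi) : ℂ)
  rwa [intervalIntegral.integral_neg, mul_neg] at h2

lemma exp2_edgeShift_pow (R : ℝ) (k : ℕ) : (edgeScale R).Exp2 (fun i => e.edgeShift i.1 i.2.2 ^ k)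
    (fun i => airyLine i.2.2 ^ k) (fun i => -(k * (e.lam / 2)) * airyLine i.2.2 ^ (k + 1))
    (fun i => (k * (e.lam ^ 2 / 6) + k * (k - 1) / 2 * (e.lam / 2) ^ 2)
      * airyLine i.2.2 ^ (k + 2)) := by
  induction k with
  | zero => simpa using Exp2.const (edgeScale R) 1
  | succ k ih =>
    refine (ih.mul (e.exp2_edgeShift R)).congr (fun i _ => by ring) (fun i _ => by ring)
      (fun i _ => by push_cast; ring) (fun i _ => by push_cast; ring)

/-- The coefficient of `ε` in the expansion of `edgeIntegral k`. -/
noncomputable def coeff₁ (k : ℕ) (t : ℝ) : ℂ :=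
  e.lam * e.d₁ / 4 * airyMoment (k + 4) t
    + e.lam / 2 * (t * airyMoment (k + 2) t - k * airyMoment (k + 1) t)
    - e.p * e.lam / e.q * airyMoment (k + 1) t

/-- The coefficient of `ε²` in the expansion of `edgeIntegral k`. -/
noncomputable def coeff₂ (k : ℕ) (t : ℝ) : ℂ :=
  e.lam ^ 2 * e.d₂ / 5 * airyMoment (k + 5) t
    - e.lam ^ 2 / 6 * (t * airyMoment (k + 3) t - k * airyMoment (k + 2) t)
    + e.p * e.lam ^ 2 / (2 * e.q ^ 2) * airyMoment (k + 2) t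
    + ((e.lam * e.d₁ / 4) ^ 2 * airyMoment (k + 8) t
      + 2 * (e.lam * e.d₁ / 4) * (e.lam / 2) * (t * airyMoment (k + 6) t - k * airyMoment (k + 5) t)
      - 2 * (e.lam * e.d₁ / 4) * (e.p * e.lam / e.q) * airyMoment (k + 5) t
      + (e.lam / 2) ^ 2 * (t ^ 2 * airyMoment (k + 4) t - 2 * k * t * airyMoment (k + 3) t
        + k * (k - 1) * airyMoment (k + 2) t)
      - 2 * (e.lam / 2) * (e.p * e.lam / e.q)
        * (t * airyMoment (k + 3) t - k * airyMoment (k + 2) t)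
      + (e.p * e.lam / e.q) ^ 2 * airyMoment (k + 2) t) / 2

lemma hasDerivAt_mul_airyMoment (j : ℕ) (t : ℝ) :
    HasDerivAt (fun t : ℝ => t * airyMoment j t) (airyMoment j t - t * airyMoment (j + 1) t) t := by
  have h : HasDerivAt (fun t : ℝ => (t : ℂ)) 1 t := (hasDerivAt_id (t : ℂ)).comp_ofReal
  exact (h.mul (hasDerivAt_airyMoment j t)).congr_deriv (by ring)

lemma hasDerivAt_sq_mul_airyMoment (j : ℕ) (t : ℝ) :
    HasDerivAt (fun t : ℝ => (t : ℂ) ^ 2 * airyMoment j t)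
      (2 * t * airyMoment j t - t ^ 2 * airyMoment (j + 1) t) t := by
  have h : HasDerivAt (fun t : ℝ => (t : ℂ) ^ 2) (2 * t) t := by
    simpa using (hasDerivAt_pow 2 (t : ℂ)).comp_ofReal
  exact (h.mul (hasDerivAt_airyMoment j t)).congr_deriv (by ring)

lemma hasDerivAt_coeff₁ (k : ℕ) (t : ℝ) :
    HasDerivAt (e.coeff₁ k) (-e.coeff₁ (k + 1) t) t := by
  have m := fun j => hasDerivAt_airyMoment (k + j) t
  have tm := fun j => hasDerivAt_mul_airyMoment (k + j) t
  have h := (((m 4).const_mul (e.lam * e.d₁ / 4)).add (((tm 2).sub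
    ((m 1).const_mul (k : ℂ))).const_mul (e.lam / 2 : ℂ))).sub
    ((m 1).const_mul (e.p * e.lam / e.q : ℂ))
  refine h.congr_deriv ?_
  simp only [coeff₁, add_right_comm k 1]
  push_cast
  ring

lemma hasDerivAt_coeff₂ (k : ℕ) (t : ℝ) :
    HasDerivAt (e.coeff₂ k) (-e.coeff₂ (k + 1) t) t := by
  have m := fun j => hasDerivAt_airyMoment (k + j) t
  have tm := fun j => hasDerivAt_mul_airyMoment (k + j) t
  have t2m := hasDerivAt_sq_mul_airyMoment (k + 4) t
  have tm3 : HasDerivAt (fun t : ℝ => 2 * k * t * airyMoment (k + 3) t)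
      (2 * k * (airyMoment (k + 3) t - t * airyMoment (k + 3 + 1) t)) t := by
    simpa only [mul_assoc] using ((tm 3).const_mul (2 * k : ℂ))
  have h := (((((m 5).const_mul (e.lam ^ 2 * e.d₂ / 5)).sub (((tm 3).sub
    ((m 2).const_mul (k : ℂ))).const_mul (e.lam ^ 2 / 6 : ℂ))).add
    ((m 2).const_mul (e.p * e.lam ^ 2 / (2 * e.q ^ 2) : ℂ))).add
    (((((((m 8).const_mul ((e.lam * e.d₁ / 4) ^ 2)).add (((tm 6).sub
      ((m 5).const_mul (k : ℂ))).const_mul (2 * (e.lam * e.d₁ / 4) * (e.lam / 2)))).sub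
      ((m 5).const_mul (2 * (e.lam * e.d₁ / 4) * (e.p * e.lam / e.q)))).add
      (((t2m.sub tm3).add ((m 2).const_mul (k * (k - 1) : ℂ))).const_mul ((e.lam / 2 : ℂ) ^ 2))).sub
      (((tm 3).sub ((m 2).const_mul (k : ℂ))).const_mul
        (2 * (e.lam / 2) * (e.p * e.lam / e.q) : ℂ))).add
      ((m 2).const_mul ((e.p * e.lam / e.q : ℂ) ^ 2)) |>.div_const 2))
  refine h.congr_deriv ?_
  simp only [coeff₂, add_right_comm k 1]
  push_cast
  ring

/-- The expansion of the edge integrals in Airy moments, uniform for bounded `t`. -/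
lemma exists_norm_edgeIntegral_sub_le (R : ℝ) (k : ℕ) :
    ∃ (C ε₀ : ℝ), 0 < ε₀ ∧ ε₀ ≤ 1 ∧ ∀ ε t : ℝ, 0 < ε → ε ≤ ε₀ → |t| ≤ R →
      ‖e.edgeIntegral k ε t - (airyMoment k t + ε * e.coeff₁ k t + ε ^ 2 * e.coeff₂ k t)‖
        ≤ C * ε ^ 3 := by
  obtain ⟨C, ε₀, h0, h1, h⟩ := e.exists_norm_integral_sub_le R (e.exp2_edgeShift_pow R k)
    (fun ε t => (e.continuous_edgeShift ε).pow k) (fun ε t => by fun_prop)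
    (fun ε t => by fun_prop) (fun ε t => by fun_prop)
  refine ⟨‖(1 / (2 * Real.pi) : ℂ)‖ * C, ε₀, h0, h1, fun ε t hε hε0 ht => ?_⟩
  have hb := mul_le_mul_of_nonneg_left (h ε t hε hε0 ht) (norm_nonneg (1 / (2 * Real.pi) : ℂ))
  rw [← norm_mul, mul_sub] at hb
  refine le_trans (le_of_eq ?_) (hb.trans_eq (by ring))
  congr 2
  have hs := integral_sum_mul_airyExp k 9
    ![1 + ε ^ 2 * 0, ε * (-(e.p * e.lam / e.q) - k * (e.lam / 2)),
      ε * (e.lam / 2 * t) + ε ^ 2 * (k * (e.lam ^ 2 / 6) + e.p * e.lam ^ 2 / (2 * e.q ^ 2)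
        + k * (k - 1) / 2 * (e.lam / 2) ^ 2 + k * (e.lam / 2) * (e.p * e.lam / e.q)
        + (e.p * e.lam / e.q) ^ 2 / 2),
      ε ^ 2 * (-(e.lam ^ 2 / 6) * t - e.lam / 2 * (e.p * e.lam / e.q) * t
        - k * (e.lam / 2) ^ 2 * t),
      ε * (e.lam * e.d₁ / 4) + ε ^ 2 * ((e.lam / 2) ^ 2 * t ^ 2 / 2),
      ε ^ 2 * (e.lam ^ 2 * e.d₂ / 5 - e.lam * e.d₁ / 4 * (e.p * e.lam / e.q)
        - k * (e.lam * e.d₁ / 4) * (e.lam / 2)),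
      ε ^ 2 * (e.lam * e.d₁ / 4 * (e.lam / 2) * t), 0, ε ^ 2 * ((e.lam * e.d₁ / 4) ^ 2 / 2)] t
  simp only [Fin.sum_univ_succ, Fin.sum_univ_zero, Matrix.cons_val_zero, Matrix.cons_val_succ,
    Fin.val_zero, Fin.val_succ] at hs
  calc _ = _ := ?_
    _ = _ := hs.symm
    _ = _ := ?_
  · simp only [coeff₁, coeff₂]
    norm_num
    ring
  · congr 2
    ext y
    congr 1
    simp only [r₁, r₂]
    norm_num
    ring

end EdgeParam

/-! ### Closed forms of the expansion coefficients -/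

open AsymScale

namespace EdgeParam

variable (e : EdgeParam)

open Complex

/-- The constant `γ` in the expansion `exp (-γ ε t² + O(ε³))` of the factor that comes from the
weight. -/
noncomputable def gam : ℝ := (e.q - e.p) / (4 * e.lam ^ 2)

lemma coeff₁_zero (t : ℝ) :
    e.coeff₁ 0 t = 2 * e.gam * airyMoment 1 t + e.gam * t ^ 2 * airyMoment 0 t := by
  have m3 := airyMoment_add_three 0 t
  have m4 := airyMoment_add_three 1 t
  have m2 := airyMoment_two t
  have hq : (e.q : ℂ) = e.lam ^ 3 := e.lam_cube'.symm
  have hp : (e.p : ℂ) = 1 - e.lam ^ 3 := by linear_combination e.q_eq - hq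
  simp only [coeff₁, gam, d₁, zero_add] at *
  norm_num at *
  rw [m4, m2, hq, hp]
  have hl := e.lam_ne
  generalize (e.lam : ℂ) = l at hl ⊢
  field_simp
  ring

lemma coeff₁_one (t : ℝ) : e.coeff₁ 1 t = e.gam * t ^ 2 * airyMoment 1 t := by
  have m3 := airyMoment_add_three 0 t
  have m4 := airyMoment_add_three 1 t
  have m5 := airyMoment_add_three 2 t
  have m2 := airyMoment_two t
  have hq : (e.q : ℂ) = e.lam ^ 3 := e.lam_cube'.symm
  have hp : (e.p : ℂ) = 1 - e.lam ^ 3 := by linear_combination e.q_eq - hq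
  simp only [coeff₁, gam, d₁, zero_add] at *
  norm_num at *
  rw [m5, m3, m2, hq, hp]
  have hl := e.lam_ne
  generalize (e.lam : ℂ) = l at hl ⊢
  field_simp
  ring

lemma coeff₂_zero (t : ℝ) :
    e.coeff₂ 0 t = ((3 / 40 - e.q / 10 + e.q ^ 2 / 10) * t * airyMoment 0 t
        - (1 / 20 - 2 * e.q / 5 + 2 * e.q ^ 2 / 5) * t ^ 2 * airyMoment 1 t) / e.lam ^ 4
      + 2 * e.gam ^ 2 * t ^ 2 * airyMoment 1 t + e.gam ^ 2 * t ^ 4 / 2 * airyMoment 0 t := by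
  have m3 := airyMoment_add_three 0 t
  have m4 := airyMoment_add_three 1 t
  have m5 := airyMoment_add_three 2 t
  have m6 := airyMoment_add_three 3 t
  have m7 := airyMoment_add_three 4 t
  have m8 := airyMoment_add_three 5 t
  have m2 := airyMoment_two t
  have hq : (e.q : ℂ) = e.lam ^ 3 := e.lam_cube'.symm
  have hp : (e.p : ℂ) = 1 - e.lam ^ 3 := by linear_combination e.q_eq - hq
  simp only [coeff₂, gam, d₁, d₂, zero_add] at *
  norm_num at *
  rw [m8, m6, m5, m4, m3, m2, hq, hp]
  have hl := e.lam_ne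
  generalize (e.lam : ℂ) = l at hl ⊢
  field_simp
  ring

lemma coeff₂_one (t : ℝ) :
    e.coeff₂ 1 t = (-(3 / 40 - e.q / 10 + e.q ^ 2 / 10) * airyMoment 0 t
        - (1 / 20 - 2 * e.q / 5 + 2 * e.q ^ 2 / 5) * t ^ 3 * airyMoment 0 t
        - (3 / 40 - e.q / 10 + e.q ^ 2 / 10) * t * airyMoment 1 t) / e.lam ^ 4
      + e.gam ^ 2 * t ^ 4 / 2 * airyMoment 1 t := by
  have m3 := airyMoment_add_three 0 t
  have m4 := airyMoment_add_three 1 t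
  have m5 := airyMoment_add_three 2 t
  have m6 := airyMoment_add_three 3 t
  have m7 := airyMoment_add_three 4 t
  have m8 := airyMoment_add_three 5 t
  have m9 := airyMoment_add_three 6 t
  have m2 := airyMoment_two t
  have hq : (e.q : ℂ) = e.lam ^ 3 := e.lam_cube'.symm
  have hp : (e.p : ℂ) = 1 - e.lam ^ 3 := by linear_combination e.q_eq - hq
  simp only [coeff₂, gam, d₁, d₂, zero_add] at *
  norm_num at *
  rw [m9, m7, m6, m5, m4, m3, m2, hq, hp]
  have hl := e.lam_ne
  generalize (e.lam : ℂ) = l at hl ⊢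
  field_simp
  ring

end EdgeParam

/-! ### Difference quotients -/

/-- The difference quotient of a function; for `x = y` it has the junk value `0`. -/
noncomputable def diffQuot (f : ℝ → ℂ) (x y : ℝ) : ℂ := (f x - f y) / (x - y)

lemma norm_diffQuot_le {f f' : ℝ → ℂ} {R C : ℝ} (hf : ∀ t, HasDerivAt f (f' t) t)
    (hC : ∀ t, |t| ≤ R → ‖f' t‖ ≤ C) {x y : ℝ} (hx : |x| ≤ R) (hy : |y| ≤ R) (hxy : x ≠ y) :
    ‖diffQuot f x y‖ ≤ C := by
  have h := (convex_Icc (-R) R).norm_image_sub_le_of_norm_hasDerivWithin_le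
    (fun t _ => (hf t).hasDerivWithinAt) (fun t ht => hC t (abs_le.2 ht)) (abs_le.1 hy)
    (abs_le.1 hx)
  rw [diffQuot, norm_div, ← Complex.ofReal_sub, Complex.norm_real,
    div_le_iff₀ (norm_pos_iff.2 (sub_ne_zero.2 hxy))]
  exact h

lemma exists_norm_le_of_continuous {f : ℝ → ℂ} (hf : Continuous f) (R : ℝ) :
    ∃ C, ∀ t, |t| ≤ R → ‖f t‖ ≤ C := by
  obtain ⟨C, hC⟩ := (isCompact_Icc (a := -R) (b := R)).exists_bound_of_continuousOn hf.continuousOn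
  exact ⟨C, fun t ht => hC t (abs_le.1 ht)⟩

/-- The scale of the kernel expansion: triples `(ε, x, y)` with `x ≠ y` in `[-R, R]`. -/
noncomputable def offDiagScale (R ε₁ : ℝ) : AsymScale (ℝ × ℝ × ℝ) where
  dom := {i | (0 < i.1 ∧ i.1 ≤ 1 ∧ i.1 ≤ ε₁) ∧ |i.2.1| ≤ R ∧ |i.2.2| ≤ R ∧ i.2.1 ≠ i.2.2}
  eps i := i.1
  wt _ := 1
  eps_nonneg _ hi := hi.1.1.le
  eps_le_wt _ hi := hi.1.2.1
  one_le_wt _ _ := le_rfl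

namespace offDiagScale

variable {R ε₁ : ℝ}

lemma bdd_fst {f : ℝ → ℂ} (hf : Continuous f) : (offDiagScale R ε₁).Bdd 0 (fun i => f i.2.1) := by
  obtain ⟨C, hC⟩ := exists_norm_le_of_continuous hf R
  exact Bdd.of_norm_le fun i hi => hC _ hi.2.1

lemma bdd_snd {f : ℝ → ℂ} (hf : Continuous f) : (offDiagScale R ε₁).Bdd 0 (fun i => f i.2.2) := by
  obtain ⟨C, hC⟩ := exists_norm_le_of_continuous hf R
  exact Bdd.of_norm_le fun i hi => hC _ hi.2.2.1

lemma bdd_diffQuot {f f' : ℝ → ℂ} (hf : ∀ t, HasDerivAt f (f' t) t) (hf' : Continuous f') :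
    (offDiagScale R ε₁).Bdd 0 (fun i => diffQuot f i.2.1 i.2.2) := by
  obtain ⟨C, hC⟩ := exists_norm_le_of_continuous hf' R
  exact Bdd.of_norm_le fun _ hi => norm_diffQuot_le hf hC hi.2.1 hi.2.2.1 hi.2.2.2

lemma bdd_of_forall {k : ℕ} {F : ℝ × ℝ × ℝ → ℂ} {C : ℝ}
    (h : ∀ i ∈ (offDiagScale R ε₁).dom, ‖F i‖ ≤ C * i.1 ^ k) : (offDiagScale R ε₁).Bdd k F := by
  refine ⟨|C|, 0, abs_nonneg _, fun i hi => (h i hi).trans ?_⟩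
  rw [pow_zero, mul_one]
  exact mul_le_mul_of_nonneg_right (le_abs_self C) (pow_nonneg hi.1.1.le k)

end offDiagScale

namespace EdgeParam

variable (e : EdgeParam)

lemma continuous_coeff₁ (k : ℕ) : Continuous (e.coeff₁ k) :=
  continuous_iff_continuousAt.2 fun t => (e.hasDerivAt_coeff₁ k t).continuousAt

lemma continuous_coeff₂ (k : ℕ) : Continuous (e.coeff₂ k) :=
  continuous_iff_continuousAt.2 fun t => (e.hasDerivAt_coeff₂ k t).continuousAt

variable {e} {R ε₁ C : ℝ} {k : ℕ}

lemma exp2_edgeIntegral (h : ∀ ε t : ℝ, 0 < ε → ε ≤ ε₁ → |t| ≤ R →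
      ‖e.edgeIntegral k ε t - (airyMoment k t + ε * e.coeff₁ k t + ε ^ 2 * e.coeff₂ k t)‖
        ≤ C * ε ^ 3) :
    (offDiagScale R ε₁).Exp2 (fun i => e.edgeIntegral k i.1 i.2.1)
      (fun i => airyMoment k i.2.1) (fun i => e.coeff₁ k i.2.1) (fun i => e.coeff₂ k i.2.1) :=
  ⟨offDiagScale.bdd_fst (continuous_airyMoment k), offDiagScale.bdd_fst (e.continuous_coeff₁ k),
    offDiagScale.bdd_fst (e.continuous_coeff₂ k),
    offDiagScale.bdd_of_forall fun _ hi => h _ _ hi.1.1 hi.1.2.2 hi.2.1⟩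

/-- Since the expansion of `edgeIntegral` may be differentiated in `t`, the difference quotients
have the expected expansion, uniformly up to the diagonal. -/
lemma exp2_diffQuot_edgeIntegral (h : ∀ ε t : ℝ, 0 < ε → ε ≤ ε₁ → |t| ≤ R →
      ‖e.edgeIntegral (k + 1) ε t
        - (airyMoment (k + 1) t + ε * e.coeff₁ (k + 1) t + ε ^ 2 * e.coeff₂ (k + 1) t)‖
        ≤ C * ε ^ 3) :
    (offDiagScale R ε₁).Exp2 (fun i => diffQuot (e.edgeIntegral k i.1) i.2.1 i.2.2)
      (fun i => diffQuot (airyMoment k) i.2.1 i.2.2) (fun i => diffQuot (e.coeff₁ k) i.2.1 i.2.2)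
      (fun i => diffQuot (e.coeff₂ k) i.2.1 i.2.2) := by
  refine ⟨offDiagScale.bdd_diffQuot (hasDerivAt_airyMoment k) (continuous_airyMoment _).neg,
    offDiagScale.bdd_diffQuot (e.hasDerivAt_coeff₁ k) (e.continuous_coeff₁ _).neg,
    offDiagScale.bdd_diffQuot (e.hasDerivAt_coeff₂ k) (e.continuous_coeff₂ _).neg,
    offDiagScale.bdd_of_forall (C := C) fun i hi => ?_⟩
  have hd := fun t => ((e.hasDerivAt_edgeIntegral k hi.1.1.le t).sub
    (((hasDerivAt_airyMoment k t).add ((e.hasDerivAt_coeff₁ k t).const_mul (i.1 : ℂ))).add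
      ((e.hasDerivAt_coeff₂ k t).const_mul ((i.1 : ℂ) ^ 2))))
  refine le_trans (le_of_eq ?_) (norm_diffQuot_le hd (C := C * i.1 ^ 3) (fun t ht => ?_)
    hi.2.1 hi.2.2.1 hi.2.2.2)
  · congr 1
    simp only [diffQuot, offDiagScale, Pi.sub_apply, Pi.add_apply]
    ring
  · rw [← norm_neg]
    refine le_trans (le_of_eq ?_) (h i.1 t hi.1.1 hi.1.2.2 ht)
    congr 1
    ring

end EdgeParam

/-! ### Expansion of the scaled kernel -/

open AsymScale

lemma abs_log_one_add_sub_le {z : ℝ} (hz : |z| ≤ 1 / 2) :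
    |Real.log (1 + z) - z + z ^ 2 / 2| ≤ 2 * |z| ^ 3 := by
  have h := Real.abs_log_sub_add_sum_range_le (x := -z) (by rw [abs_neg]; linarith) 2
  rw [abs_neg] at h
  have hs : ∑ i ∈ Finset.range 2, (-z) ^ (i + 1) / ((i : ℝ) + 1) + Real.log (1 - -z)
      = Real.log (1 + z) - z + z ^ 2 / 2 := by
    rw [Finset.sum_range_succ, Finset.sum_range_one, sub_neg_eq_add]
    norm_num
    ring
  rw [hs] at h
  refine h.trans ((div_le_iff₀ (by linarith)).2 ?_)
  have : 0 ≤ |z| ^ 3 := by positivity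
  rw [show 2 + 1 = 3 from rfl]
  nlinarith

lemma exists_pos_le_mul_le {δ₀ δ₁ δ₂ : ℝ} (h0 : 0 < δ₀) (h1 : 0 < δ₁) (h2 : 0 < δ₂) (R : ℝ) :
    ∃ ε₁ : ℝ, 0 < ε₁ ∧ ε₁ ≤ δ₀ ∧ ε₁ ≤ δ₁ ∧ ε₁ ≤ δ₂ ∧ ε₁ ≤ 1 ∧ ε₁ * R ≤ 1 / 2 := by
  refine ⟨min (min δ₀ δ₁) (min δ₂ (min 1 (1 / (2 * (|R| + 1))))), ?_, ?_, ?_, ?_, ?_, ?_⟩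
  · have : 0 < 1 / (2 * (|R| + 1)) := by positivity
    exact lt_min (lt_min h0 h1) (lt_min h2 (lt_min one_pos this))
  · exact (min_le_left _ _).trans (min_le_left _ _)
  · exact (min_le_left _ _).trans (min_le_right _ _)
  · exact (min_le_right _ _).trans (min_le_left _ _)
  · exact (min_le_right _ _).trans ((min_le_right _ _).trans (min_le_left _ _))
  · have hle : min (min δ₀ δ₁) (min δ₂ (min 1 (1 / (2 * (|R| + 1))))) ≤ 1 / (2 * (|R| + 1)) :=
      (min_le_right _ _).trans ((min_le_right _ _).trans (min_le_right _ _))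
    have hp : 0 < min (min δ₀ δ₁) (min δ₂ (min 1 (1 / (2 * (|R| + 1))))) := by positivity
    calc _ ≤ min (min δ₀ δ₁) (min δ₂ (min 1 (1 / (2 * (|R| + 1))))) * (|R| + 1) :=
          mul_le_mul_of_nonneg_left (by linarith [le_abs_self R]) hp.le
      _ ≤ 1 / (2 * (|R| + 1)) * (|R| + 1) := mul_le_mul_of_nonneg_right hle (by positivity)
      _ = 1 / 2 := by field_simp

namespace EdgeParam

variable (e : EdgeParam)

lemma half_le_lam : 1 / 2 ≤ e.lam := by
  have h1 : e.lam ^ 2 ≤ 1 := pow_le_one₀ e.lam_pos.le e.lam_lt_one.le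
  have h2 : e.lam ^ 3 ≤ e.lam := by
    calc e.lam ^ 3 = e.lam ^ 2 * e.lam := by ring
      _ ≤ 1 * e.lam := mul_le_mul_of_nonneg_right h1 e.lam_pos.le
      _ = e.lam := one_mul _
  linarith [e.lam_cube, e.half_le_q]

/-- The function `√w(x) e^{p x}` of `x = N / p² + t / (p λ ε)`, relative to its value at `t = 0`.
The factor `e^{p x}` comes from the generating integrand at the saddle point and makes the
logarithmic derivative at `t = 0` vanish. -/
noncomputable def weightFactor (ε t : ℝ) : ℝ :=
  Real.exp ((e.q - e.p) / (2 * e.p ^ 2 * ε ^ 3)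
    * (Real.log (1 + e.p / e.lam * ε ^ 2 * t) - e.p / e.lam * ε ^ 2 * t))

/-- The constant prefactor of the kernel: the quotient of `N!/Γ(N + a)` by its leading order in
Stirling's formula, with `N = ε⁻³`. -/
noncomputable def prefactor (ε : ℝ) : ℝ :=
  Real.exp (stirlingRemainder (1 / ε ^ 3) - stirlingRemainder (e.q ^ 2 / e.p ^ 2 / ε ^ 3))

lemma abs_edge_arg_le {R ε t : ℝ} (ht : |t| ≤ R) :
    |e.p / e.lam * ε ^ 2 * t| ≤ ε ^ 2 * R := by
  have h1 : e.p / e.lam ≤ 1 := by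
    rw [div_le_one e.lam_pos]; linarith [e.p_le_half, e.half_le_lam]
  have h2 : 0 ≤ e.p / e.lam := (div_pos e.p_pos e.lam_pos).le
  rw [abs_mul, abs_mul, abs_of_nonneg h2, abs_of_nonneg (sq_nonneg ε)]
  have := mul_le_mul_of_nonneg_right h1 (sq_nonneg ε)
  rw [one_mul] at this
  exact mul_le_mul this ht (abs_nonneg _) (sq_nonneg _)

lemma exp2_weightFactor {R ε₁ : ℝ} (hR : ε₁ * R ≤ 1 / 2) {T : ℝ × ℝ × ℝ → ℝ}
    (hT : ∀ i ∈ (offDiagScale R ε₁).dom, |T i| ≤ R)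
    (hb : (offDiagScale R ε₁).Bdd 0 (fun i => (T i : ℂ))) :
    (offDiagScale R ε₁).Exp2 (fun i => (e.weightFactor i.1 (T i) : ℂ)) (fun _ => 1)
      (fun i => -(e.gam * (T i) ^ 2)) (fun i => (e.gam * (T i : ℂ) ^ 2) ^ 2 / 2) := by
  have hp := e.p_pos
  have hqp : 0 ≤ e.q - e.p := sub_nonneg.2 e.p_le_q
  have hz : ∀ i ∈ (offDiagScale R ε₁).dom, |e.p / e.lam * i.1 ^ 2 * T i| ≤ 1 / 2 := by
    intro i hi
    have h0 : 0 < i.1 := hi.1.1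
    have hR0 : 0 ≤ R := (abs_nonneg _).trans (hT i hi)
    have h1 : i.1 ^ 2 ≤ ε₁ := by
      calc i.1 ^ 2 = i.1 * i.1 := by ring
        _ ≤ 1 * i.1 := mul_le_mul_of_nonneg_right hi.1.2.1 h0.le
        _ ≤ ε₁ := by rw [one_mul]; exact hi.1.2.2
    exact (e.abs_edge_arg_le (hT i hi)).trans ((mul_le_mul_of_nonneg_right h1 hR0).trans hR)
  have hF : (offDiagScale R ε₁).Exp2 (fun i => (((e.q - e.p) / (2 * e.p ^ 2 * i.1 ^ 3)
      * (Real.log (1 + e.p / e.lam * i.1 ^ 2 * T i) - e.p / e.lam * i.1 ^ 2 * T i) : ℝ) : ℂ))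
      (fun _ => 0) (fun i => -(e.gam * (T i) ^ 2)) (fun _ => 0) := by
    refine ⟨Bdd.const _ 0, ((hb.pow 2).const_mul _).neg, Bdd.const _ 0,
      offDiagScale.bdd_of_forall (C := (e.q - e.p) / e.p ^ 2 * R ^ 3) fun i hi => ?_⟩
    have h0 : 0 < i.1 := hi.1.1
    have hl := e.lam_pos
    have hz3 : |e.p / e.lam * i.1 ^ 2 * T i| ^ 3 ≤ (i.1 ^ 2 * R) ^ 3 :=
      pow_le_pow_left₀ (abs_nonneg _) (e.abs_edge_arg_le (hT i hi)) 3
    have hlog := (abs_log_one_add_sub_le (hz i hi)).trans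
      (mul_le_mul_of_nonneg_left hz3 zero_le_two)
    have hlog' := mul_le_mul_of_nonneg_left hlog
      (show 0 ≤ (e.q - e.p) / (2 * e.p ^ 2 * i.1 ^ 3) by positivity)
    rw [← abs_of_nonneg (show 0 ≤ (e.q - e.p) / (2 * e.p ^ 2 * i.1 ^ 3) by positivity), ← abs_mul,
      ← Real.norm_eq_abs, ← Complex.norm_real] at hlog'
    refine le_trans (le_of_eq ?_) (hlog'.trans_eq ?_)
    · congr 1
      simp only [offDiagScale, gam]
      push_cast
      have h0' : (i.1 : ℂ) ≠ 0 := by exact_mod_cast h0.ne'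
      have hl' := e.lam_ne
      have hp' := e.p_ne
      field_simp
      ring
    · rw [abs_of_nonneg (by positivity)]
      field_simp
  refine (hF.cexp (K := 1) fun i hi => ?_).congr (fun i _ => ?_) (fun _ _ => rfl) (fun _ _ => rfl)
    (fun i _ => by ring)
  · have h0 : 0 < i.1 := hi.1.1
    rw [Complex.norm_exp, Complex.ofReal_re, Real.exp_le_one_iff]
    have := abs_le.1 (hz i hi)
    have hlog := Real.log_le_sub_one_of_pos (x := 1 + e.p / e.lam * i.1 ^ 2 * T i) (by linarith)
    exact mul_nonpos_of_nonneg_of_nonpos (by positivity) (by linarith)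
  · rw [weightFactor, Complex.ofReal_exp]

lemma exp2_prefactor (R ε₁ : ℝ) :
    (offDiagScale R ε₁).Exp2 (fun i => (e.prefactor i.1 : ℂ)) (fun _ => 1) (fun _ => 0)
      (fun _ => 0) := by
  have hp := e.p_pos
  have hb : ∀ i ∈ (offDiagScale R ε₁).dom,
      |stirlingRemainder (1 / i.1 ^ 3) - stirlingRemainder (e.q ^ 2 / e.p ^ 2 / i.1 ^ 3)|
        ≤ 2 * i.1 ^ 3 := by
    intro i hi
    have h0 : 0 < i.1 := hi.1.1
    have hq := e.q_pos
    refine (abs_stirlingRemainder_sub_le (by positivity) (by positivity)).trans ?_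
    have h1 : e.p ^ 2 / e.q ^ 2 ≤ 1 := by
      rw [div_le_one (by positivity)]; exact pow_le_pow_left₀ hp.le e.p_le_q 2
    have h2 := mul_le_mul_of_nonneg_right h1 (pow_nonneg h0.le 3)
    calc _ = i.1 ^ 3 + e.p ^ 2 / e.q ^ 2 * i.1 ^ 3 := by field_simp
      _ ≤ _ := by linarith
  have hF : (offDiagScale R ε₁).Exp2 (fun i => ((stirlingRemainder (1 / i.1 ^ 3)
      - stirlingRemainder (e.q ^ 2 / e.p ^ 2 / i.1 ^ 3) : ℝ) : ℂ))
      (fun _ => 0) (fun _ => 0) (fun _ => 0) := by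
    refine ⟨Bdd.const _ 0, Bdd.const _ 0, Bdd.const _ 0,
      offDiagScale.bdd_of_forall (C := 2) fun i hi => ?_⟩
    simpa [← Complex.ofReal_sub, Complex.norm_real] using hb i hi
  refine (hF.cexp (K := Real.exp 2) fun i hi => ?_).congr (fun i _ => ?_) (fun _ _ => rfl)
    (fun _ _ => rfl) (fun i _ => by ring)
  · have h0 : 0 < i.1 := hi.1.1
    rw [Complex.norm_exp, Complex.ofReal_re, Real.exp_le_exp]
    have := pow_le_one₀ (n := 3) h0.le hi.1.2.1
    linarith [(abs_le.1 (hb i hi)).2]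
  · rw [prefactor, Complex.ofReal_exp]

/-- The kernel in edge scaling for `x ≠ y`, in terms of the edge integrals. -/
noncomputable def edgeKernel (ε x y : ℝ) : ℂ :=
  e.prefactor ε * (e.weightFactor ε x * e.weightFactor ε y)
    * (e.edgeIntegral 0 ε x * diffQuot (e.edgeIntegral 1 ε) x y
      - e.edgeIntegral 1 ε x * diffQuot (e.edgeIntegral 0 ε) x y)

/-- The correction kernel in terms of the edge parameters; the quartic terms of its definition
cancel. -/
noncomputable def correction (x y : ℝ) : ℝ :=
  (-8 * (e.q ^ 2 - 6 * e.q * e.p + e.p ^ 2) * (x ^ 2 + x * y + y ^ 2) * (airyAi x * airyAi y)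
    + 4 * (3 * e.q ^ 2 + 2 * e.q * e.p + 3 * e.p ^ 2)
      * (airyAi x * airyAi' y + airyAi' x * airyAi y)
    + 8 * (e.q ^ 2 - 6 * e.q * e.p + e.p ^ 2) * (x + y) * (airyAi' x * airyAi' y))
    / (160 * e.lam ^ 4)

/-- The terms of first order cancel: the parts `γ t² airyMoment k t` of `coeff₁ k` are compensated
by the weight, and the remaining part `2 γ airyMoment 1 t` of `coeff₁ 0` is proportional to the
leading term of the other factor, so it drops out of the antisymmetric combination. -/
lemma exists_norm_edgeKernel_sub_le (R : ℝ) : ∃ C ε₁ : ℝ, 0 < ε₁ ∧ ε₁ ≤ 1 ∧ ε₁ * R ≤ 1 / 2 ∧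
    ∀ ε x y : ℝ, 0 < ε → ε ≤ ε₁ → |x| ≤ R → |y| ≤ R → x ≠ y →
      ‖e.edgeKernel ε x y - (airyKernel x y + ε ^ 2 * e.correction x y : ℝ)‖ ≤ C * ε ^ 3 := by
  obtain ⟨C₀, δ₀, h0, -, H0⟩ := e.exists_norm_edgeIntegral_sub_le R 0
  obtain ⟨C₁, δ₁, h1, -, H1⟩ := e.exists_norm_edgeIntegral_sub_le R 1
  obtain ⟨C₂, δ₂, h2, -, H2⟩ := e.exists_norm_edgeIntegral_sub_le R 2
  obtain ⟨ε₁, hpos, l0, l1, l2, l3, l4⟩ := exists_pos_le_mul_le h0 h1 h2 R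
  have hS := e.exp2_weightFactor l4 (T := fun i => i.2.1) (fun i hi => hi.2.1)
    (offDiagScale.bdd_fst Complex.continuous_ofReal)
  have hS' := e.exp2_weightFactor l4 (T := fun i => i.2.2) (fun i hi => hi.2.2.1)
    (offDiagScale.bdd_snd Complex.continuous_ofReal)
  have hG0 := exp2_edgeIntegral fun ε t hε hε1 => H0 ε t hε (hε1.trans l0)
  have hG1 := exp2_edgeIntegral fun ε t hε hε1 => H1 ε t hε (hε1.trans l1)
  have hD0 := exp2_diffQuot_edgeIntegral (k := 0) fun ε t hε hε1 => H1 ε t hε (hε1.trans l1)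
  have hD1 := exp2_diffQuot_edgeIntegral (k := 1) fun ε t hε hε1 => H2 ε t hε (hε1.trans l2)
  have hT := ((e.exp2_prefactor R ε₁).mul (hS.mul hS')).mul ((hG0.mul hD1).sub (hG1.mul hD0))
  have hK : (offDiagScale R ε₁).Exp2 (fun i => e.edgeKernel i.1 i.2.1 i.2.2)
      (fun i => (airyKernel i.2.1 i.2.2 : ℂ)) (fun _ => 0)
      (fun i => (e.correction i.2.1 i.2.2 : ℂ)) := by
    refine hT.congr ?_ ?_ ?_ ?_
    · rintro ⟨ε, x, y⟩ -
      rw [edgeKernel]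
    · rintro ⟨ε, x, y⟩ hi
      have hxy : (x : ℂ) - y ≠ 0 := sub_ne_zero.2 (Complex.ofReal_injective.ne hi.2.2.2)
      simp only [airyKernel, if_neg hi.2.2.2, diffQuot]
      push_cast
      rw [ofReal_airyAi, ofReal_airyAi, ofReal_airyAi', ofReal_airyAi']
      generalize airyMoment 0 x = a, airyMoment 0 y = b, airyMoment 1 x = c, airyMoment 1 y = d
      field_simp
      ring
    · rintro ⟨ε, x, y⟩ hi
      simp only [diffQuot, coeff₁_zero, coeff₁_one]
      generalize airyMoment 0 x = a, airyMoment 0 y = b, airyMoment 1 x = c, airyMoment 1 y = d,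
        ((x : ℂ) - y) = z
      ring
    · rintro ⟨ε, x, y⟩ hi
      have hxy : (x : ℂ) - y ≠ 0 := sub_ne_zero.2 (Complex.ofReal_injective.ne hi.2.2.2)
      simp only [correction, diffQuot, coeff₁_zero, coeff₁_one, coeff₂_zero, coeff₂_one]
      push_cast
      rw [ofReal_airyAi, ofReal_airyAi, ofReal_airyAi', ofReal_airyAi',
        show (e.p : ℂ) = 1 - e.q by rw [e.q_eq]; ring]
      generalize airyMoment 0 x = a, airyMoment 0 y = b, airyMoment 1 x = c, airyMoment 1 y = d,
        (e.lam : ℂ) = l, (e.gam : ℂ) = g, (e.q : ℂ) = q, (x : ℂ) = x, (y : ℂ) = y at hxy ⊢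
      -- both sides are linear in `(x - y)⁻¹` once the left one is multiplied by `1 = (x - y) z`
      have hz : (x - y) * (x - y)⁻¹ = 1 := mul_inv_cancel₀ hxy
      simp only [div_eq_mul_inv _ (x - y)]
      generalize (x - y)⁻¹ = z at hz ⊢
      linear_combination (-((-8 * (q ^ 2 - 6 * q * (1 - q) + (1 - q) ^ 2)
          * (x ^ 2 + x * y + y ^ 2) * (a * b)
        + 4 * (3 * q ^ 2 + 2 * q * (1 - q) + 3 * (1 - q) ^ 2) * (a * -d + -c * b)
        + 8 * (q ^ 2 - 6 * q * (1 - q) + (1 - q) ^ 2) * (x + y) * (-c * -d)) / (160 * l ^ 4))) * hz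
  obtain ⟨C, m, -, h⟩ := hK.rem
  refine ⟨C, ε₁, hpos, l3, l4, fun ε x y hε hε1 hx hy hxy => ?_⟩
  have := h (ε, x, y) ⟨⟨hε, hε1.trans l3, hε1⟩, hx, hy, hxy⟩
  simpa [offDiagScale] using this

end EdgeParam

/-! ### Laguerre polynomials and the kernel in edge scaling -/

namespace EdgeParam

variable (e : EdgeParam)

/-- The soft edge variable `N / p² + t / (p λ ε)` with `N = ε⁻³`. -/
noncomputable def edgeVar (ε t : ℝ) : ℝ := 1 / (e.p ^ 2 * ε ^ 3) + t / (e.p * e.lam * ε)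

/-- The value of the generating integrand (times `1 / (1 + u)`) at the saddle point. -/
noncomputable def saddleValue (N : ℕ) (b x : ℝ) : ℝ :=
  ((-e.p) ^ N)⁻¹ * Real.exp (x * e.p + (b - 1) * Real.log e.q)

open Complex

lemma laguerreCircle_eq (ε y : ℝ) :
    laguerreCircle (e.p * Real.exp (-(e.lam * ε))) (e.lam * ε * y)
      = -(e.p * exp (-e.edgePoint ε y)) := by
  rw [laguerreCircle, edgePoint, airyLine]
  push_cast
  rw [mul_assoc, ← exp_add]
  congr 3
  ring

/-- The generating integrand in edge scaling. One factor `1 + u` is left out because the two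
polynomials in the Christoffel–Darboux formula, of degrees `N - 1` and `N`, differ from the common
expression here by the factors `u` and `1 + u`. -/
lemma laguerreIntegrand_edge {N : ℕ} {ε b : ℝ} (hε : 0 < ε) (hN : (N : ℝ) = 1 / ε ^ 3)
    (hb : b = e.q ^ 2 / e.p ^ 2 / ε ^ 3) (t y : ℝ) :
    laguerreIntegrand (b - 1) N (e.edgeVar ε t) (-(e.p * exp (-e.edgePoint ε y)))
      = e.saddleValue N b (e.edgeVar ε t) * exp (e.edgeExponent ε t y) := by
  have hz := e.edgePoint_re_nonneg hε.le y
  have hNc : (N : ℂ) = 1 / (ε : ℂ) ^ 3 := by exact_mod_cast congrArg ofReal hN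
  have hε' : (ε : ℂ) ≠ 0 := ofReal_ne_zero.2 hε.ne'
  have hp := e.p_ne
  have hl := e.lam_ne
  have hlog : log (1 - e.p * exp (-e.edgePoint ε y))
      = e.logRatio (e.edgePoint ε y) + Real.log e.q := by
    rw [logRatio, ofReal_log e.q_pos.le]; ring
  have hden : (-(e.p * exp (-e.edgePoint ε y))) ^ N
      = (-(e.p : ℂ)) ^ N * exp (-(N * e.edgePoint ε y)) := by
    rw [← neg_mul, mul_pow, ← exp_nat_mul, mul_neg]
  have hb' : (b : ℂ) = e.q ^ 2 / e.p ^ 2 / (ε : ℂ) ^ 3 := by rw [hb]; push_cast; rfl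
  rw [laguerreIntegrand, ← sub_eq_add_neg, cpow_def_of_ne_zero (e.one_sub_ne_zero hz), hlog, hden,
    saddleValue, div_eq_mul_inv, mul_inv, ← exp_neg]
  push_cast
  rw [show ∀ A B C D E F : ℂ, A * B * (C * D) = C * E * F ↔ C * (A * B * D) = C * (E * F) by
    intros; ring_nf, ← exp_add, ← exp_add, ← exp_add]
  congr 2
  rw [edgeExponent, phase, edgeVar, hNc, hb']
  push_cast
  field_simp
  ring

lemma laguerreIntegrand_sub_one {u : ℂ} (hu : u ≠ 0) (N : ℕ) (b x : ℝ) :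
    laguerreIntegrand b N x u = u * laguerreIntegrand b (N + 1) x u := by
  simp only [laguerreIntegrand, pow_succ]
  field_simp

lemma laguerreIntegrand_exponent {u : ℂ} (hu : 1 + u ≠ 0) (N : ℕ) (b x : ℝ) :
    laguerreIntegrand b N x u = (1 + u) * laguerreIntegrand (b - 1) N x u := by
  simp only [laguerreIntegrand]
  push_cast
  rw [cpow_sub _ _ hu, cpow_one]
  field_simp

/-- The integral representation in edge scaling. -/
lemma ofReal_laguerreL_edge (n : ℕ) {a ε : ℝ} (ha : 0 ≤ a) (hε : 0 < ε) (x : ℝ) :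
    (laguerreL n a x : ℂ) = e.lam * ε * ((1 / (2 * Real.pi)) *
      ∫ y in (-(Real.pi / (e.lam * ε)))..(Real.pi / (e.lam * ε)),
        laguerreIntegrand (n + a) n x (-(e.p * exp (-e.edgePoint ε y)))) := by
  have hc : 0 < e.lam * ε := mul_pos e.lam_pos hε
  have hr : 0 < e.p * Real.exp (-(e.lam * ε)) := mul_pos e.p_pos (Real.exp_pos _)
  have hr1 : e.p * Real.exp (-(e.lam * ε)) < 1 :=
    mul_lt_one_of_nonneg_of_lt_one_left e.p_pos.le e.p_lt_one
      (Real.exp_le_one_iff.2 (neg_nonpos.2 hc.le))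
  have h := intervalIntegral.smul_integral_comp_mul_left
    (a := -(Real.pi / (e.lam * ε))) (b := Real.pi / (e.lam * ε))
    (fun η => laguerreIntegrand (n + a) n x
      (laguerreCircle (e.p * Real.exp (-(e.lam * ε))) η)) (e.lam * ε)
  simp only [laguerreCircle_eq, mul_neg, mul_div_cancel₀ _ hc.ne'] at h
  rw [ofReal_laguerreL n ha x hr hr1, ← h, real_smul]
  push_cast
  ring

lemma p_mul_exp_neg_edgePoint {ε : ℝ} (hε : 0 < ε) (y : ℝ) :
    e.p * exp (-e.edgePoint ε y) = e.p - e.p * (e.lam * ε) * e.edgeShift ε y := by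
  have hc : (e.lam : ℂ) * ε ≠ 0 := mul_ne_zero e.lam_ne (ofReal_ne_zero.2 hε.ne')
  rw [edgeShift, mul_assoc, mul_div_cancel₀ _ hc]
  ring

lemma ofReal_laguerreL_of_integrand {n : ℕ} {a ε : ℝ} (ha : 0 ≤ a) (hε : 0 < ε) (x t : ℝ)
    (s A B : ℂ) (h : ∀ y, laguerreIntegrand (n + a) n x (-(e.p * exp (-e.edgePoint ε y)))
      = (A + B * e.edgeShift ε y) * (s * exp (e.edgeExponent ε t y))) :
    (laguerreL n a x : ℂ)
      = s * (e.lam * ε) * (A * e.edgeIntegral 0 ε t + B * e.edgeIntegral 1 ε t) := by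
  have hi : ∀ k : ℕ, IntervalIntegrable (fun y => exp (e.edgeExponent ε t y) * e.edgeShift ε y ^ k)
      MeasureTheory.volume (-(Real.pi / (e.lam * ε))) (Real.pi / (e.lam * ε)) := fun k =>
    ((e.continuous_edgeExponent hε.le t).cexp.mul
      ((e.continuous_edgeShift ε).pow k)).intervalIntegrable _ _
  have h' : ∀ y, laguerreIntegrand (n + a) n x (-(e.p * exp (-e.edgePoint ε y)))
      = s * (A * (exp (e.edgeExponent ε t y) * e.edgeShift ε y ^ 0)
        + B * (exp (e.edgeExponent ε t y) * e.edgeShift ε y ^ 1)) := fun y => by rw [h]; ring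
  rw [e.ofReal_laguerreL_edge n ha hε]
  simp only [h']
  rw [intervalIntegral.integral_const_mul, intervalIntegral.integral_add ((hi 0).const_mul _)
    ((hi 1).const_mul _), intervalIntegral.integral_const_mul, intervalIntegral.integral_const_mul,
    edgeIntegral, edgeIntegral]
  ring

variable {n : ℕ} {a b ε : ℝ}

/-- Since `u` and `1 + u` are affine in the scaled displacement, both polynomials of the
Christoffel–Darboux formula are combinations of the same two edge integrals. -/
lemma laguerreL_edge (ha : 0 ≤ a) (hε : 0 < ε) (hN : ((n + 1 : ℕ) : ℝ) = 1 / ε ^ 3)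
    (hb : b = e.q ^ 2 / e.p ^ 2 / ε ^ 3) (hab : (n + 1 : ℕ) + a = b) (t : ℝ) :
    (laguerreL n a (e.edgeVar ε t) : ℂ) = e.saddleValue (n + 1) b (e.edgeVar ε t) * (e.lam * ε)
      * (-e.p * e.edgeIntegral 0 ε t + e.p * (e.lam * ε) * e.edgeIntegral 1 ε t) := by
  refine e.ofReal_laguerreL_of_integrand ha hε _ t _ _ _ fun y => ?_
  have hu : -((e.p : ℂ) * exp (-e.edgePoint ε y)) ≠ 0 :=
    neg_ne_zero.2 (mul_ne_zero e.p_ne (exp_ne_zero _))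
  rw [laguerreIntegrand_sub_one hu, show (n : ℝ) + a = b - 1 by rw [← hab]; push_cast; ring,
    e.laguerreIntegrand_edge hε hN hb, e.p_mul_exp_neg_edgePoint hε]
  ring

lemma laguerreL_succ_edge (ha : 0 ≤ a) (hε : 0 < ε) (hN : ((n + 1 : ℕ) : ℝ) = 1 / ε ^ 3)
    (hb : b = e.q ^ 2 / e.p ^ 2 / ε ^ 3) (hab : (n + 1 : ℕ) + a = b) (t : ℝ) :
    (laguerreL (n + 1) a (e.edgeVar ε t) : ℂ) = e.saddleValue (n + 1) b (e.edgeVar ε t)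
      * (e.lam * ε) * (e.q * e.edgeIntegral 0 ε t
        + e.p * (e.lam * ε) * e.edgeIntegral 1 ε t) := by
  refine e.ofReal_laguerreL_of_integrand ha hε _ t _ _ _ fun y => ?_
  have hu : 1 + -((e.p : ℂ) * exp (-e.edgePoint ε y)) ≠ 0 := by
    rw [← sub_eq_add_neg]; exact e.one_sub_ne_zero (e.edgePoint_re_nonneg hε.le y)
  rw [laguerreIntegrand_exponent hu, hab, e.laguerreIntegrand_edge hε hN hb,
    e.p_mul_exp_neg_edgePoint hε, e.q_eq]
  ring

/-- All constants of the kernel combine to Stirling remainders and to two factors that come from the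
weight. -/
lemma sqrt_laguerreWeight_mul (hε : 0 < ε) (hN : ((n + 1 : ℕ) : ℝ) = 1 / ε ^ 3)
    (hb : b = e.q ^ 2 / e.p ^ 2 / ε ^ 3) (hab : (n + 1 : ℕ) + a = b) {x y : ℝ}
    (hx : 0 < 1 + e.p / e.lam * ε ^ 2 * x) (hy : 0 < 1 + e.p / e.lam * ε ^ 2 * y) :
    Real.sqrt (laguerreWeight a (e.edgeVar ε x) * laguerreWeight a (e.edgeVar ε y))
        * ((n + 1).factorial / Real.Gamma b)
        * (e.saddleValue (n + 1) b (e.edgeVar ε x) * e.saddleValue (n + 1) b (e.edgeVar ε y))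
        * (e.p * (e.lam * ε) ^ 3)
      = e.prefactor ε * (e.weightFactor ε x * e.weightFactor ε y) := by
  have hp := e.p_pos
  have hq := e.q_pos
  have hl := e.lam_pos
  have hV : ∀ t, e.edgeVar ε t = (n + 1 : ℕ) / e.p ^ 2 * (1 + e.p / e.lam * ε ^ 2 * t) := by
    intro t
    rw [edgeVar, hN]
    field_simp
  have hNpos : (0 : ℝ) < (n + 1 : ℕ) := by positivity
  have hb0 : 0 < b := by rw [hb]; positivity
  have hbN : b = e.q ^ 2 / e.p ^ 2 * (n + 1 : ℕ) := by rw [hb, hN]; ring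
  have haN : a = (e.q - e.p) / e.p ^ 2 * (n + 1 : ℕ) := by
    have hq1 : e.q = 1 - e.p := by linarith [e.p_add_q]
    rw [hq1] at hbN ⊢
    have : a = b - (n + 1 : ℕ) := by linarith
    rw [this, hbN]
    field_simp
    ring
  have hw : ∀ t, 0 < 1 + e.p / e.lam * ε ^ 2 * t → laguerreWeight a (e.edgeVar ε t)
      = Real.exp (a * (Real.log (n + 1 : ℕ) - 2 * Real.log e.p
        + Real.log (1 + e.p / e.lam * ε ^ 2 * t)) - e.edgeVar ε t) := by
    intro t ht
    have hpos : 0 < e.edgeVar ε t := by rw [hV]; positivity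
    have hlog : Real.log (e.edgeVar ε t) = Real.log (n + 1 : ℕ) - 2 * Real.log e.p
        + Real.log (1 + e.p / e.lam * ε ^ 2 * t) := by
      rw [hV, Real.log_mul (by positivity) ht.ne', Real.log_div hNpos.ne' (by positivity),
        Real.log_pow]
      push_cast
      ring
    rw [laguerreWeight, if_pos hpos, Real.rpow_def_of_pos hpos, ← Real.exp_add, hlog]
    congr 1
    ring
  have hfac : ((n + 1).factorial : ℝ) = Real.exp (Real.log (n + 1 : ℕ)
      + (stirlingRemainder (n + 1 : ℕ) + ((n + 1 : ℕ) - 1 / 2) * Real.log (n + 1 : ℕ)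
        - (n + 1 : ℕ))) := by
    rw [Real.exp_add, Real.exp_log hNpos, stirlingRemainder, Nat.factorial_succ,
      show Real.log (Real.Gamma (n + 1 : ℕ)) - ((n + 1 : ℕ) - 1 / 2) * Real.log (n + 1 : ℕ)
        + (n + 1 : ℕ) + ((n + 1 : ℕ) - 1 / 2) * Real.log (n + 1 : ℕ) - (n + 1 : ℕ)
        = Real.log (Real.Gamma (n + 1 : ℕ)) by ring,
      Real.exp_log (Real.Gamma_pos_of_pos hNpos)]
    push_cast
    rw [Real.Gamma_nat_eq_factorial]
  have hgam : (Real.Gamma b)⁻¹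
      = Real.exp (-(stirlingRemainder b + (b - 1 / 2) * Real.log b - b)) := by
    rw [Real.exp_neg, stirlingRemainder,
      show Real.log (Real.Gamma b) - (b - 1 / 2) * Real.log b + b + (b - 1 / 2) * Real.log b - b
        = Real.log (Real.Gamma b) by ring, Real.exp_log (Real.Gamma_pos_of_pos hb0)]
  have hlogb : Real.log b = 2 * Real.log e.q - 2 * Real.log e.p + Real.log (n + 1 : ℕ) := by
    rw [hbN, Real.log_mul (by positivity) hNpos.ne', Real.log_div (by positivity) (by positivity),
      Real.log_pow, Real.log_pow]
    push_cast
    ring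
  have hsq : (((-e.p) ^ (n + 1))⁻¹) * (((-e.p) ^ (n + 1))⁻¹)
      = Real.exp (-(2 * (n + 1 : ℕ) * Real.log e.p)) := by
    rw [← mul_inv, ← mul_pow, neg_mul_neg, Real.exp_neg, mul_assoc, mul_comm (2 : ℝ), mul_assoc,
      Real.exp_nat_mul, mul_comm (Real.log e.p), two_mul, Real.exp_add, Real.exp_log hp]
  have hlam : e.p * (e.lam * ε) ^ 3
      = Real.exp (Real.log e.p + Real.log e.q - Real.log (n + 1 : ℕ)) := by
    rw [Real.exp_sub, Real.exp_add, Real.exp_log hp, Real.exp_log hq, Real.exp_log hNpos, hN,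
      mul_pow, e.lam_cube]
    field_simp
  have hsqrt : ∀ u v : ℝ, Real.sqrt (Real.exp u * Real.exp v) = Real.exp ((u + v) / 2) := by
    intro u v
    rw [← Real.exp_add, Real.exp_half]
  rw [hw x hx, hw y hy, hsqrt, hfac, div_eq_mul_inv _ (Real.Gamma b), hgam, hlam,
    saddleValue, saddleValue, mul_mul_mul_comm _ (Real.exp _) _ (Real.exp _), hsq, prefactor,
    weightFactor, weightFactor]
  simp only [← Real.exp_add]
  have hcoef : (e.q - e.p) / (2 * e.p ^ 2 * ε ^ 3) = a / 2 := by
    rw [haN, hN]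
    field_simp
  -- `x = a / (1 - 2p)` at the centre of the edge: the terms linear in `t` cancel
  have hK : ((n + 1 : ℕ) : ℝ) / e.p ^ 2 * (1 - 2 * e.p) = a := by
    rw [haN, show e.q = 1 - e.p by linarith [e.p_add_q]]
    ring
  rw [← hN, ← hb, hcoef, hlogb, hV, hV]
  generalize ((n + 1 : ℕ) : ℝ) / e.p ^ 2 = K at hK ⊢
  congr 1
  subst hab
  linear_combination
    (-(2 + e.p / e.lam * ε ^ 2 * x + e.p / e.lam * ε ^ 2 * y) / 2) * hK

lemma edgeVar_sub (ε x y : ℝ) : e.edgeVar ε x - e.edgeVar ε y = (x - y) / (e.p * e.lam * ε) := by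
  rw [edgeVar, edgeVar]
  ring

/-- Off the diagonal, the Laguerre kernel in edge scaling is given by the edge integrals: this is
the Christoffel–Darboux formula. -/
lemma ofReal_lueKernel_edge (ha : 0 ≤ a) (hε : 0 < ε) (hN : ((n + 1 : ℕ) : ℝ) = 1 / ε ^ 3)
    (hb : b = e.q ^ 2 / e.p ^ 2 / ε ^ 3) (hab : (n + 1 : ℕ) + a = b) {x y : ℝ} (hxy : x ≠ y)
    (hx : 0 < 1 + e.p / e.lam * ε ^ 2 * x) (hy : 0 < 1 + e.p / e.lam * ε ^ 2 * y) :
    ((1 / (e.p * e.lam * ε) * lueKernel a (n + 1) (e.edgeVar ε x) (e.edgeVar ε y) : ℝ) : ℂ)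
      = e.edgeKernel ε x y := by
  have hp := e.p_pos
  have hl := e.lam_pos
  have hpl : 0 < e.p * e.lam * ε := by positivity
  have hcd := laguerre_christoffel_darboux n ha (e.edgeVar ε x) (e.edgeVar ε y)
  rw [show (n : ℝ) + 1 + a = b by rw [← hab]; push_cast; ring, edgeVar_sub, div_mul_eq_mul_div,
    div_eq_iff hpl.ne'] at hcd
  have hc := congrArg ofReal hcd
  have hw := congrArg ofReal (e.sqrt_laguerreWeight_mul hε hN hb hab hx hy)
  have hxy' : (x : ℂ) - y ≠ 0 := sub_ne_zero.2 (ofReal_injective.ne hxy)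
  have hε' : (ε : ℂ) ≠ 0 := ofReal_ne_zero.2 hε.ne'
  have hp' := e.p_ne
  have hl' := e.lam_ne
  push_cast [e.laguerreL_edge ha hε hN hb hab, e.laguerreL_succ_edge ha hε hN hb hab] at hc hw ⊢
  rw [edgeKernel, ← hw, lueKernel, diffQuot, diffQuot]
  push_cast
  rw [e.q_eq] at hc
  rw [mul_comm, ← eq_div_iff hxy'] at hc
  rw [hc]
  generalize (((n + 1).factorial : ℂ) / (Real.Gamma b : ℂ)) = Q
  generalize e.edgeIntegral 0 ε x = g₀, e.edgeIntegral 1 ε x = g₁, e.edgeIntegral 0 ε y = k₀,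
    e.edgeIntegral 1 ε y = k₁
  field_simp
  ring

end EdgeParam

/-! ### The constants of the soft edge -/

open Filter Topology

/-- The edge parameters belonging to `a = α N`. -/
noncomputable def edgeParam (α : ℝ) (hα : 0 ≤ α) : EdgeParam where
  p := 1 / (Real.sqrt (1 + α) + 1)
  q := Real.sqrt (1 + α) / (Real.sqrt (1 + α) + 1)
  lam := (Real.sqrt (1 + α) / (Real.sqrt (1 + α) + 1)) ^ (1 / 3 : ℝ)
  p_pos := by positivity
  p_le_q := by
    have : 1 ≤ Real.sqrt (1 + α) := Real.one_le_sqrt.2 (by linarith)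
    gcongr
  p_add_q := by
    have : 0 < Real.sqrt (1 + α) + 1 := by positivity
    field_simp
    ring
  lam_pos := by
    have : 0 < Real.sqrt (1 + α) := Real.sqrt_pos.2 (by linarith)
    positivity
  lam_cube := by
    rw [← Real.rpow_natCast, ← Real.rpow_mul (by positivity)]
    norm_num

lemma softEdge_eq_edgeVar {α ε : ℝ} (hα : 0 ≤ α) {N : ℕ} (hε : 0 < ε) (hN : (N : ℝ) = 1 / ε ^ 3)
    (t : ℝ) : softEdge α N t = (edgeParam α hα).edgeVar ε t := by
  have hs : 0 < Real.sqrt (1 + α) := Real.sqrt_pos.2 (by linarith)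
  have h1 : (N : ℝ) ^ (1 / 3 : ℝ) = 1 / ε := by
    rw [hN, show 1 / ε ^ 3 = (1 / ε) ^ (3 : ℝ) by rw [Real.rpow_ofNat, one_div_pow],
      ← Real.rpow_mul (by positivity)]
    norm_num
  have h2 : (1 / Real.sqrt (1 + α) + 1) ^ (1 / 3 : ℝ) = 1 / (edgeParam α hα).lam := by
    simp only [edgeParam]
    rw [one_div ((Real.sqrt (1 + α) / _) ^ _), ← Real.inv_rpow (by positivity)]
    congr 1
    field_simp
    ring
  have h3 : Real.sqrt (1 + α) + 1 = 1 / (edgeParam α hα).p := by simp [edgeParam]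
  have hl := (edgeParam α hα).lam_pos
  have hp := (edgeParam α hα).p_pos
  rw [softEdge, h1, h2, h3, hN, EdgeParam.edgeVar]
  field_simp

lemma EdgeParam.deriv_edgeVar (e : EdgeParam) (ε t : ℝ) :
    deriv (e.edgeVar ε) t = 1 / (e.p * e.lam * ε) := by
  have h : HasDerivAt (e.edgeVar ε) (1 / (e.p * e.lam * ε)) t :=
    ((hasDerivAt_id t).div_const _).const_add _
  exact h.deriv

/-- In the definition of the correction the two occurrences of `(x² + y²)² (Ai Ai' - Ai' Ai)` have
opposite coefficients. -/
lemma lueCorrection_eq {α : ℝ} (hα : 0 ≤ α) (x y : ℝ) :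
    lueCorrection α x y = (edgeParam α hα).correction x y := by
  have hs : 0 < Real.sqrt (1 + α) := Real.sqrt_pos.2 (by linarith)
  have hsq : α = Real.sqrt (1 + α) ^ 2 - 1 := by rw [Real.sq_sqrt (by linarith)]; ring
  have hlam : (edgeParam α hα).lam
      = Real.sqrt (1 + α) ^ (1 / 3 : ℝ) / (Real.sqrt (1 + α) + 1) ^ (1 / 3 : ℝ) :=
    Real.div_rpow hs.le (by positivity) _
  have hp : (edgeParam α hα).p = 1 / (Real.sqrt (1 + α) + 1) := rfl
  have hq : (edgeParam α hα).q = Real.sqrt (1 + α) / (Real.sqrt (1 + α) + 1) := rfl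
  generalize edgeParam α hα = e at *
  generalize Real.sqrt (1 + α) = s at *
  subst hsq
  have h0 : 1 + (s ^ 2 - 1) = s ^ 2 := by ring
  have hst : s ^ 2 + s = s * (s + 1) := by ring
  -- cube roots of `s` and `s + 1`
  obtain ⟨σ, hσ⟩ : ∃ σ, σ = s ^ (1 / 3 : ℝ) := ⟨_, rfl⟩
  obtain ⟨τ, hτ⟩ : ∃ τ, τ = (s + 1) ^ (1 / 3 : ℝ) := ⟨_, rfl⟩
  have hσ0 : 0 < σ := by rw [hσ]; positivity
  have hτ0 : 0 < τ := by rw [hτ]; positivity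
  have hσ3 : s = σ ^ 3 := by
    rw [hσ, ← Real.rpow_natCast, ← Real.rpow_mul hs.le]; norm_num
  have hτ3 : s + 1 = τ ^ 3 := by
    rw [hτ, ← Real.rpow_natCast, ← Real.rpow_mul (by positivity)]; norm_num
  have e1 : (s ^ 2 : ℝ) ^ (5 / 6 : ℝ) = σ ^ 5 := by
    rw [hσ, ← Real.rpow_natCast, ← Real.rpow_mul hs.le, ← Real.rpow_natCast, ← Real.rpow_mul hs.le]
    norm_num
  have e2 : (s ^ 2 : ℝ) ^ (2 / 3 : ℝ) = σ ^ 4 := by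
    rw [hσ, ← Real.rpow_natCast, ← Real.rpow_mul hs.le, ← Real.rpow_natCast, ← Real.rpow_mul hs.le]
    norm_num
  have e3 : (s + 1) ^ (2 / 3 : ℝ) = τ ^ 2 := by
    rw [hτ, ← Real.rpow_natCast, ← Real.rpow_mul (by positivity)]
    norm_num
  have e4 : (s * (s + 1)) ^ (1 / 3 : ℝ) = σ * τ := by
    rw [Real.mul_rpow hs.le (by positivity), hσ, hτ]
  have hc : (s ^ 2 - 1) ^ 2 * (σ * τ) / (32 * σ ^ 5 * (s + 1) ^ 3)
      = 5 * (s - 1) ^ 2 * (1 / (160 * σ ^ 4 * τ ^ 2)) := by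
    rw [show (s ^ 2 - 1) ^ 2 = (s - 1) ^ 2 * (s + 1) ^ 2 by ring, hτ3]
    field_simp
    ring
  have hcor : e.correction x y = 1 / (160 * σ ^ 4 * τ ^ 2)
      * (-8 * (s ^ 2 - 6 * s + 1) * (x ^ 2 + x * y + y ^ 2) * (airyAi x * airyAi y)
        + 4 * (3 * s ^ 2 + 2 * s + 3) * (airyAi x * airyAi' y + airyAi' x * airyAi y)
        + 8 * (s ^ 2 - 6 * s + 1) * (x + y) * (airyAi' x * airyAi' y)) := by
    rw [EdgeParam.correction, hp, hq, hlam, ← hσ, ← hτ, hτ3]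
    field_simp
  rw [lueCorrection, hcor, h0, Real.sqrt_sq hs.le, hst, add_comm 1 s, e1, e2, e3, e4, hc]
  split_ifs with hxy
  · subst hxy
    ring
  · have hxy' := sub_ne_zero.2 hxy
    have hz : (x - y) * (x - y)⁻¹ = 1 := mul_inv_cancel₀ hxy'
    simp only [one_div, mul_inv (160 * σ ^ 4 * τ ^ 2)]
    generalize (160 * σ ^ 4 * τ ^ 2)⁻¹ = κ
    simp only [div_eq_mul_inv]
    generalize (x - y)⁻¹ = z at hz ⊢
    linear_combination (κ
      * (-8 * (s ^ 2 - 6 * s + 1) * (x ^ 2 + x * y + y ^ 2) * (airyAi x * airyAi y)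
        + 4 * (3 * s ^ 2 + 2 * s + 3) * (airyAi x * airyAi' y + airyAi' x * airyAi y)
        + 8 * (s ^ 2 - 6 * s + 1) * (x + y) * (airyAi' x * airyAi' y))) * hz

lemma lueCorrection_zero (x y : ℝ) : lueCorrection 0 x y = lueFixedCorrection x y := by
  have hlam : (edgeParam 0 le_rfl).lam ^ 4 = (1 / 2) ^ (4 / 3 : ℝ) := by
    have : (edgeParam 0 le_rfl).lam = (1 / 2) ^ (1 / 3 : ℝ) := by
      simp only [edgeParam]; norm_num
    rw [this, ← Real.rpow_natCast, ← Real.rpow_mul (by norm_num)]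
    norm_num
  have h2 : (2 : ℝ) ^ (1 / 3 : ℝ) * (1 / 2) ^ (4 / 3 : ℝ) = 1 / 2 := by
    rw [one_div 2, Real.inv_rpow zero_le_two, ← Real.rpow_neg zero_le_two, ← Real.rpow_add two_pos]
    norm_num [Real.rpow_neg_one]
  have hp : (edgeParam 0 le_rfl).p = 1 / 2 := by simp only [edgeParam]; norm_num
  have hq : (edgeParam 0 le_rfl).q = 1 / 2 := by simp only [edgeParam]; norm_num
  have h0 : (1 / 2 : ℝ) ^ (4 / 3 : ℝ) ≠ 0 := by positivity
  rw [lueCorrection_eq le_rfl, EdgeParam.correction, lueFixedCorrection, hlam, hp, hq,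
    div_eq_iff (by positivity)]
  generalize (2 : ℝ) ^ (1 / 3 : ℝ) = c at h2 ⊢
  generalize (1 / 2 : ℝ) ^ (4 / 3 : ℝ) = d at h2 ⊢
  linear_combination (-16 * ((x ^ 2 + x * y + y ^ 2) * (airyAi x * airyAi y)
      - (x + y) * (airyAi' x * airyAi' y)
      + (airyAi' x * airyAi y + airyAi x * airyAi' y))) * h2

/-! ### The diagonal and the uniform expansion -/

lemma hasDerivAt_airyAi_deriv (x : ℝ) : HasDerivAt airyAi (airyAi' x) x :=
  (hasDerivAt_airyAi x).differentiableAt.hasDerivAt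

lemma continuous_airyAi : Continuous airyAi :=
  continuous_iff_continuousAt.2 fun x => (hasDerivAt_airyAi x).continuousAt

lemma continuous_airyAi' : Continuous airyAi' :=
  continuous_iff_continuousAt.2 fun x => (hasDerivAt_airyAi' x).continuousAt

lemma tendsto_airyKernel_diag (x : ℝ) : Tendsto (airyKernel x) (𝓝[≠] x) (𝓝 (airyKernel x x)) := by
  have h0 := hasDerivAt_iff_tendsto_slope.1 (hasDerivAt_airyAi_deriv x)
  have h1 := hasDerivAt_iff_tendsto_slope.1 (hasDerivAt_airyAi' x)
  have h := (h0.const_mul (airyAi' x)).sub (h1.const_mul (airyAi x))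
  rw [airyKernel, if_pos rfl, show airyAi' x ^ 2 - x * airyAi x ^ 2
    = airyAi' x * airyAi' x - airyAi x * (x * airyAi x) by ring]
  refine h.congr' ?_
  filter_upwards [self_mem_nhdsWithin] with y hy
  have hyx : y - x ≠ 0 := sub_ne_zero.2 hy
  have hxy : x - y ≠ 0 := sub_ne_zero.2 (Ne.symm hy)
  rw [airyKernel, if_neg (Ne.symm hy), slope_def_field, slope_def_field, ← neg_sub x y]
  field_simp
  ring

lemma continuous_laguerreMonic (n : ℕ) (a : ℝ) : Continuous (laguerreMonic n a) := by
  unfold laguerreMonic laguerreL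
  fun_prop

lemma continuousAt_laguerreWeight (a : ℝ) {x : ℝ} (hx : 0 < x) :
    ContinuousAt (laguerreWeight a) x := by
  have h : ContinuousAt (fun x : ℝ => x ^ a * Real.exp (-x)) x :=
    (Real.continuousAt_rpow_const x a (Or.inl hx.ne')).mul (by fun_prop)
  refine h.congr ?_
  filter_upwards [lt_mem_nhds hx] with y hy
  rw [laguerreWeight, if_pos hy]

lemma continuousAt_lueKernel (a : ℝ) (N : ℕ) (x : ℝ) {y : ℝ} (hy : 0 < y) :
    ContinuousAt (lueKernel a N x) y := by
  unfold lueKernel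
  refine ((continuousAt_const.mul (continuousAt_laguerreWeight a hy)).sqrt).mul ?_
  have := fun n => continuous_laguerreMonic n a
  exact (Continuous.continuousAt (by fun_prop))

namespace EdgeParam

variable (e : EdgeParam)

/-- The expansion of the kernel for all `x, y`. On the diagonal it follows by continuity, the
estimate being uniform in `x ≠ y`; the interval is enlarged by one so that there is room for the
limit. -/
lemma exists_abs_lueKernel_sub_le (R : ℝ) : ∃ C ε₁ : ℝ, 0 < ε₁ ∧
    ∀ (n : ℕ) (a ε x y : ℝ), 0 ≤ a → 0 < ε → ε ≤ ε₁ → ((n + 1 : ℕ) : ℝ) = 1 / ε ^ 3 →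
      (n + 1 : ℕ) + a = e.q ^ 2 / e.p ^ 2 / ε ^ 3 → |x| ≤ R → |y| ≤ R →
      |1 / (e.p * e.lam * ε) * lueKernel a (n + 1) (e.edgeVar ε x) (e.edgeVar ε y)
        - (airyKernel x y + ε ^ 2 * e.correction x y)| ≤ C * ε ^ 3 := by
  obtain ⟨C, ε₁, h0, h1, hR, H⟩ := e.exists_norm_edgeKernel_sub_le (R + 1)
  refine ⟨C, ε₁, h0, fun n a ε x y ha hε hε1 hN hab hx hy => ?_⟩
  have hz : ∀ t : ℝ, |t| ≤ R + 1 → 0 < 1 + e.p / e.lam * ε ^ 2 * t := by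
    intro t ht
    have h2 : ε ^ 2 ≤ ε₁ := by nlinarith
    have h3 := (e.abs_edge_arg_le (ε := ε) ht).trans
      (mul_le_mul_of_nonneg_right h2 ((abs_nonneg t).trans ht))
    linarith [(abs_le.1 (h3.trans hR)).1]
  have hoff : ∀ y, |y| ≤ R + 1 → x ≠ y →
      |1 / (e.p * e.lam * ε) * lueKernel a (n + 1) (e.edgeVar ε x) (e.edgeVar ε y)
        - (airyKernel x y + ε ^ 2 * e.correction x y)| ≤ C * ε ^ 3 := by
    intro y hy hxy
    have hx' : |x| ≤ R + 1 := by linarith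
    have h := H ε x y hε hε1 hx' hy hxy
    rw [← e.ofReal_lueKernel_edge ha hε hN rfl hab hxy (hz x hx') (hz y hy), ← Complex.ofReal_sub,
      Complex.norm_real, Real.norm_eq_abs] at h
    exact h
  rcases ne_or_eq x y with hxy | rfl
  · exact hoff y (by linarith) hxy
  have hpos : 0 < e.edgeVar ε x := by
    have hp := e.p_pos
    have hl := e.lam_pos
    have := hz x (by linarith)
    rw [show e.edgeVar ε x = 1 / (e.p ^ 2 * ε ^ 3) * (1 + e.p / e.lam * ε ^ 2 * x) by
      rw [edgeVar]; field_simp]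
    positivity
  have hev : Continuous (e.edgeVar ε) := by unfold edgeVar; fun_prop
  have hK : Tendsto (fun y => lueKernel a (n + 1) (e.edgeVar ε x) (e.edgeVar ε y)) (𝓝[≠] x)
      (𝓝 (lueKernel a (n + 1) (e.edgeVar ε x) (e.edgeVar ε x))) :=
    ((continuousAt_lueKernel a (n + 1) (e.edgeVar ε x) hpos).comp hev.continuousAt).mono_left
      nhdsWithin_le_nhds
  have hcor : Continuous (e.correction x) := by
    have := continuous_airyAi
    have := continuous_airyAi'
    unfold correction
    fun_prop
  have hlim := ((hK.const_mul (1 / (e.p * e.lam * ε))).sub ((tendsto_airyKernel_diag x).add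
    ((hcor.continuousAt.mono_left nhdsWithin_le_nhds).const_mul (ε ^ 2)))).abs
  refine le_of_tendsto hlim ?_
  have hball : {y : ℝ | |y - x| < 1} ∈ 𝓝[≠] x :=
    mem_nhdsWithin_of_mem_nhds (Metric.ball_mem_nhds x one_pos)
  filter_upwards [hball, self_mem_nhdsWithin] with y hy hyx
  refine hoff y ?_ (Ne.symm hyx)
  have h3 := abs_sub_abs_le_abs_sub y x
  have h4 : |y - x| < 1 := hy
  linarith

end EdgeParam

theorem proposition5 :
    (∀ α : ℝ, 0 ≤ α → ∀ R : ℝ, ∃ (C : ℝ) (N₀ : ℕ), ∀ N : ℕ, N₀ ≤ N →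
      ∀ x ∈ Set.Icc (-R) R, ∀ y ∈ Set.Icc (-R) R,
        |deriv (softEdge α N) x * lueKernel (α * N) N (softEdge α N x) (softEdge α N y)
            - (airyKernel x y + 1 / (N : ℝ) ^ (2 / 3 : ℝ) * lueCorrection α x y)|
          ≤ C / N) ∧
    (∀ x y : ℝ, lueCorrection 0 x y = lueFixedCorrection x y) := by
  refine ⟨fun α hα R => ?_, lueCorrection_zero⟩
  obtain ⟨C, ε₁, h0, H⟩ := (edgeParam α hα).exists_abs_lueKernel_sub_le R
  refine ⟨C, ⌈1 / ε₁ ^ 3⌉₊ + 1, fun N hN x hx y hy => ?_⟩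
  obtain ⟨n, rfl⟩ : ∃ n, N = n + 1 := ⟨N - 1, by omega⟩
  have hNpos : (0 : ℝ) < (n + 1 : ℕ) := by positivity
  -- the expansion parameter `ε = N^{-1/3}`
  obtain ⟨ε, hε⟩ : ∃ ε : ℝ, ε = ((n + 1 : ℕ) : ℝ) ^ (-(1 / 3) : ℝ) := ⟨_, rfl⟩
  have hεpos : 0 < ε := by rw [hε]; positivity
  have hε3 : ((n + 1 : ℕ) : ℝ) = 1 / ε ^ 3 := by
    rw [hε, ← Real.rpow_natCast, ← Real.rpow_mul hNpos.le, one_div, ← Real.rpow_neg hNpos.le]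
    norm_num
  have hε2 : 1 / ((n + 1 : ℕ) : ℝ) ^ (2 / 3 : ℝ) = ε ^ 2 := by
    rw [hε, ← Real.rpow_natCast, ← Real.rpow_mul hNpos.le, one_div, ← Real.rpow_neg hNpos.le]
    norm_num
  have hεle : ε ≤ ε₁ := by
    have h1 : 1 / ε₁ ^ 3 ≤ 1 / ε ^ 3 := by
      rw [← hε3]
      exact (Nat.le_ceil _).trans (by exact_mod_cast (Nat.le_succ _).trans hN)
    exact le_of_pow_le_pow_left₀ three_ne_zero h0.le
      ((one_div_le_one_div (by positivity) (by positivity)).1 h1)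
  have hs : softEdge α (n + 1) = (edgeParam α hα).edgeVar ε :=
    funext (softEdge_eq_edgeVar hα hεpos hε3)
  have hab : ((n + 1 : ℕ) : ℝ) + α * (n + 1 : ℕ)
      = (edgeParam α hα).q ^ 2 / (edgeParam α hα).p ^ 2 / ε ^ 3 := by
    have hp : (edgeParam α hα).q / (edgeParam α hα).p = Real.sqrt (1 + α) := by
      have : 0 < Real.sqrt (1 + α) + 1 := by positivity
      simp only [edgeParam]
      field_simp
    rw [← div_pow, hp, Real.sq_sqrt (by linarith), hε3]
    ring
  have h := H n (α * (n + 1 : ℕ)) ε x y (by positivity) hεpos hεle hε3 hab (abs_le.2 hx)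
    (abs_le.2 hy)
  rw [hs, EdgeParam.deriv_edgeVar, hε2, lueCorrection_eq hα]
  refine h.trans_eq ?_
  rw [hε3]
  field_simp
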